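/- Let $n\ge 3$ and let $p_0,\dots,p_{n-1}$ be pairwise distinct points of the Euclidean plane, lying in this counterclockwise order on a circle. Call four of these points $p_i,p_j,p_k,p_l$ with $i<j<k<l$ a symmetric quadruple if the diagonals $[p_ip_k]$ and $[p_jp_l]$ have the same length. For a triangulation $\tau$ of the convex polygon $p_0\cdots p_{n-1}$ (a maximal set of pairwise non-crossing diagonals), let $A(\tau)$ be the list of all angles of all its triangles, sorted from smallest to largest; a max-min angle Delaunay triangulation is a triangulation $\tau$ for which $A(\tau)$ is maximal in the lexicographic order. If there is no symmetric quadruple, then there is exactly one max-min angle Delaunay triangulation of $p_0,\dots,p_{n-1}$, and it can be computed using $O(n)$ arithmetic operations. That is, there are a single program for a real random access machine (exact addition, subtraction, multiplication and comparison of real numbers at unit cost; incrementing, decrementing and comparing natural numbers; indirect memory access) and a constant $C$ such that for all such $n$ and $p_0,\dots,p_{n-1}$ the program, given $n$ and the coordinates of the points in order, halts after at most $Cn$ steps of any kind and outputs the list of the diagonals of the unique max-min angle Delaunay triangulation. -/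

import Mathlib

noncomputable section

namespace ConcyclicDelaunay

/-! ## Points in counterclockwise order on a circle -/

/-- The Euclidean plane. -/
abbrev Plane := EuclideanSpace ℝ (Fin 2)

/-- The points `p 0, …, p (n-1)` are pairwise distinct and lie, in this counterclockwise order,
on a circle of positive radius. -/
def OnCircle {n : ℕ} (p : Fin n → Plane) : Prop :=
  ∃ (c : Plane) (r : ℝ) (θ : Fin n → ℝ), 0 < r ∧ StrictMono θ ∧
    (∀ i j, θ j < θ i + 2 * Real.pi) ∧
    ∀ i, p i = c + r • !₂[Real.cos (θ i), Real.sin (θ i)]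

/-- No four of the points, taken in their cyclic order, form a quadrilateral whose two diagonals
have the same length. -/
def NoSymmetricQuadruple {n : ℕ} (p : Fin n → Plane) : Prop :=
  ∀ i j k l : Fin n, i < j → j < k → k < l → dist (p i) (p k) ≠ dist (p j) (p l)

/-! ## Triangulations of a convex polygon with vertices `0, …, n-1` in cyclic order -/

/-- `i` and `j` (with `i < j`) are consecutive vertices of the polygon. -/
def IsSide {n : ℕ} (i j : Fin n) : Prop :=
  i.val + 1 = j.val ∨ (i.val = 0 ∧ j.val + 1 = n)

/-- A diagonal is a pair of distinct non-consecutive vertices, written with the smaller first. -/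
def IsDiagonal {n : ℕ} (d : Fin n × Fin n) : Prop :=
  d.1 < d.2 ∧ ¬ IsSide d.1 d.2

/-- Two diagonals of a convex polygon cross (in their relative interiors) exactly if their four
endpoints are distinct and alternate in the cyclic order. -/
def Cross {n : ℕ} (d e : Fin n × Fin n) : Prop :=
  (d.1 < e.1 ∧ e.1 < d.2 ∧ d.2 < e.2) ∨ (e.1 < d.1 ∧ d.1 < e.2 ∧ e.2 < d.2)

/-- A triangulation, given by its diagonals: a maximal set of pairwise non-crossing diagonals. -/
structure IsTriangulation {n : ℕ} (T : Finset (Fin n × Fin n)) : Prop where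
  isDiagonal : ∀ d ∈ T, IsDiagonal d
  noncrossing : ∀ d ∈ T, ∀ e ∈ T, ¬ Cross d e
  maximal : ∀ d, IsDiagonal d → (∀ e ∈ T, ¬ Cross d e) → d ∈ T

/-- The edges cut out by `T`: the sides of the polygon and the diagonals in `T`. -/
def IsEdge {n : ℕ} (T : Finset (Fin n × Fin n)) (i j : Fin n) : Prop :=
  IsSide i j ∨ (i, j) ∈ T

open Classical in
/-- The triangles of a triangulation, each listed once with increasing vertices: as all vertices
are in convex position, any three pairwise joined vertices bound one of the triangles. -/
def triangles {n : ℕ} (T : Finset (Fin n × Fin n)) : Finset (Fin n × Fin n × Fin n) :=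
  Finset.univ.filter fun t => t.1 < t.2.1 ∧ t.2.1 < t.2.2 ∧
    IsEdge T t.1 t.2.1 ∧ IsEdge T t.2.1 t.2.2 ∧ IsEdge T t.1 t.2.2

/-- The three angles of a triangle. -/
def triangleAngles (a b c : Plane) : Multiset ℝ :=
  {EuclideanGeometry.angle b a c, EuclideanGeometry.angle a b c, EuclideanGeometry.angle a c b}

/-- The list of all angles of all triangles, sorted from smallest to largest. -/
def angleList {n : ℕ} (p : Fin n → Plane) (T : Finset (Fin n × Fin n)) : List ℝ :=
  (((triangles T).val.bind fun t => triangleAngles (p t.1) (p t.2.1) (p t.2.2))).sort (· ≤ ·)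

/-- A max-min angle Delaunay triangulation of points in cyclic order on a circle: its sorted list
of angles is maximal in the lexicographic order (the order on `List ℝ`). -/
def IsMaxMinAngleDelaunay {n : ℕ} (p : Fin n → Plane) (T : Finset (Fin n × Fin n)) : Prop :=
  IsTriangulation T ∧ ∀ T', IsTriangulation T' → angleList p T' ≤ angleList p T

/-! ## A real random access machine

The memory consists of arrays of natural numbers and arrays of real numbers, indexed by the
natural numbers; a program can mention finitely many arrays only, while cells inside an array
can be addressed indirectly. Reals are added, subtracted, multiplied and compared exactly, at unit
cost. There is no division, no rounding and no conversion between reals and naturals; natural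
numbers, used for indices and counters, are only incremented, decremented and compared, so that in
`t` steps they never exceed the largest input number or program constant by more than `t`. -/

/-- A memory state: `nat a i` and `real a i` are the contents of cell `i` of array `a`. -/
structure State where
  nat : ℕ → ℕ → ℕ
  real : ℕ → ℕ → ℝ

/-- Store `v` in cell `i` of the natural number array `a`. -/
def State.setNat (s : State) (a i v : ℕ) : State :=
  { s with nat := Function.update s.nat a (Function.update (s.nat a) i v) }

/-- Store `v` in cell `i` of the real array `a`. -/
def State.setReal (s : State) (a i : ℕ) (v : ℝ) : State :=
  { s with real := Function.update s.real a (Function.update (s.real a) i v) }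

/-- Expressions for natural numbers; `get a i` reads cell `i` of array `a`. -/
inductive NExpr : Type
  | const (c : ℕ) : NExpr
  | get (a : ℕ) (i : NExpr) : NExpr
  | succ (e : NExpr) : NExpr
  | pred (e : NExpr) : NExpr

/-- The value of an expression; the predecessor of `0` is `0`. -/
def NExpr.eval (s : State) : NExpr → ℕ
  | .const c => c
  | .get a i => s.nat a (i.eval s)
  | .succ e => e.eval s + 1
  | .pred e => e.eval s - 1

/-- The number of operations in an expression (constants and memory accesses included). -/
def NExpr.cost : NExpr → ℕ
  | .const _ => 1
  | .get _ i => i.cost + 1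
  | .succ e => e.cost + 1
  | .pred e => e.cost + 1

/-- Expressions for real numbers. -/
inductive RExpr : Type
  | const (c : ℕ) : RExpr
  | get (a : ℕ) (i : NExpr) : RExpr
  | add (e f : RExpr) : RExpr
  | sub (e f : RExpr) : RExpr
  | mul (e f : RExpr) : RExpr

/-- The value of an expression. -/
def RExpr.eval (s : State) : RExpr → ℝ
  | .const c => (c : ℝ)
  | .get a i => s.real a (i.eval s)
  | .add e f => e.eval s + f.eval s
  | .sub e f => e.eval s - f.eval s
  | .mul e f => e.eval s * f.eval s

/-- The number of operations in an expression. -/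
def RExpr.cost : RExpr → ℕ
  | .const _ => 1
  | .get _ i => i.cost + 1
  | .add e f => e.cost + f.cost + 1
  | .sub e f => e.cost + f.cost + 1
  | .mul e f => e.cost + f.cost + 1

/-- Conditions. -/
inductive Test : Type
  | natLE (e f : NExpr) : Test
  | realLE (e f : RExpr) : Test
  | not (b : Test) : Test
  | and (b c : Test) : Test

/-- The truth of a condition. -/
def Test.Holds (s : State) : Test → Prop
  | .natLE e f => e.eval s ≤ f.eval s
  | .realLE e f => e.eval s ≤ f.eval s
  | .not b => ¬ b.Holds s
  | .and b c => b.Holds s ∧ c.Holds s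

/-- The number of operations in a condition. -/
def Test.cost : Test → ℕ
  | .natLE e f => e.cost + f.cost + 1
  | .realLE e f => e.cost + f.cost + 1
  | .not b => b.cost + 1
  | .and b c => b.cost + c.cost + 1

/-- Programs. -/
inductive Program : Type
  | skip : Program
  | setNat (a : ℕ) (i e : NExpr) : Program
  | setReal (a : ℕ) (i : NExpr) (e : RExpr) : Program
  | seq (P Q : Program) : Program
  | ite (b : Test) (P Q : Program) : Program
  | while (b : Test) (P : Program) : Program

/-- `Exec P s t s'`: started in state `s`, the program `P` halts in state `s'` after `t` steps,
where every assignment, jump, arithmetic operation, comparison and memory access counts. -/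
inductive Exec : Program → State → ℕ → State → Prop
  | skip (s : State) : Exec .skip s 1 s
  | setNat (s : State) (a : ℕ) (i e : NExpr) :
      Exec (.setNat a i e) s (i.cost + e.cost + 1) (s.setNat a (i.eval s) (e.eval s))
  | setReal (s : State) (a : ℕ) (i : NExpr) (e : RExpr) :
      Exec (.setReal a i e) s (i.cost + e.cost + 1) (s.setReal a (i.eval s) (e.eval s))
  | seq {P Q : Program} {s s' s'' : State} {t t' : ℕ} (hP : Exec P s t s')
      (hQ : Exec Q s' t' s'') : Exec (.seq P Q) s (t + t') s''
  | ite_true {b : Test} {P : Program} (Q : Program) {s s' : State} {t : ℕ} (hb : b.Holds s)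
      (hP : Exec P s t s') : Exec (.ite b P Q) s (b.cost + t + 1) s'
  | ite_false {b : Test} (P : Program) {Q : Program} {s s' : State} {t : ℕ} (hb : ¬ b.Holds s)
      (hQ : Exec Q s t s') : Exec (.ite b P Q) s (b.cost + t + 1) s'
  | while_false {b : Test} (P : Program) {s : State} (hb : ¬ b.Holds s) :
      Exec (.while b P) s (b.cost + 1) s
  | while_true {b : Test} {P : Program} {s s' s'' : State} {t t' : ℕ} (hb : b.Holds s)
      (hP : Exec P s t s') (hW : Exec (.while b P) s' t' s'') :
      Exec (.while b P) s (b.cost + t + t' + 1) s''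

/-- The input: `n` in cell `0` of natural number array `0`, and the two coordinates of the `i`-th
point in cell `i` of the real arrays `0` and `1`, for `i < n`. All other cells contain `0`. -/
def inputState {n : ℕ} (p : Fin n → Plane) : State where
  nat a i := if a = 0 ∧ i = 0 then n else 0
  real a i :=
    if h : i < n then
      if a = 0 then p ⟨i, h⟩ 0 else if a = 1 then p ⟨i, h⟩ 1 else 0
    else 0

/-- The output: the `k`-th pair, for `k` smaller than the number of diagonals in `T`, is in cell
`k` of the natural number arrays `1` and `2`; these pairs are the elements of `T`, in some order
(each of them once, since there are as many pairs as elements). -/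
def Outputs {n : ℕ} (s : State) (T : Finset (Fin n × Fin n)) : Prop :=
  (Finset.range T.card).image (fun k => (s.nat 1 k, s.nat 2 k)) =
    T.image (fun d => (d.1.val, d.2.val))

end ConcyclicDelaunay

end

open ConcyclicDelaunay

/-!
# Max-min angle Delaunay triangulations of points on a circle

By the inscribed angle theorem, a diagonal that cuts off an arc `2a` contributes the two angles `a`
and `π - a` to the angles of a triangulation, while the contribution of the sides is the same for
all triangulations (`IsTriangulation.angles_eq`). So the list of angles is maximal exactly if the
sorted list of the sizes `min a (π - a)` of the diagonals is (`angleList_lt`), and the size is an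
increasing function of the length (`Inscribed.sqDist_le_iff`). Two facts about sizes carry the
proof. If a chord lies between two others, then it is at least as large as the smaller one of them
(`CircSeq.min_le_val`). And without symmetric quadruples, crossing chords have different sizes; so
have the two opposite sides `[i, j]`, `[k, l]` of a quadrilateral, as otherwise it would be a
trapezoid, with diagonals of equal length (`CircSeq.disj_ne`).

A triangulation with three ears is worse than the one whose diagonals all separate its two largest
ears (`TOpt.false_of_three_ears`). Hence an optimal triangulation has just two ears, and its diagonals
form a path: they bound windows `[w 2, w 2 + 2] ⊂ [w 3, w 3 + 3] ⊂ ⋯` of consecutive vertices, each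
with one more vertex than the one before (`TOpt.exists_eq_pathDiags`).

Uniqueness (`POpt.equiv`, `TOpt.eq`) follows by exchange arguments. If two optimal paths with
overlapping last ears part at some size, then the one that takes the smaller chord can be improved
by changing over to the other one, or else it has no chord of the size of the larger chord, while
optimal paths have the same numbers of chords of every size (`POpt.false_of_lt`). If no ears of the
two paths overlap, then three of these four ears have the same size, as otherwise a path between
two other ones would be better (`POpt.min_ear_le`); but ears of the same size have an endpoint in
common, so that three of them leave no room for the fourth (`CircSeq.not_three_ears`).

For the algorithm, suppose that an optimal path is known up to some window and from some larger
window on. There are two ways to extend the lower window and two ways to shrink the upper window,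
and the smallest one of these four chords does not belong to the path: otherwise the part in
between could be replaced by one with larger chords. This determines another chord (`POpt.lower_step`,
`POpt.upper_step`), so that an optimal path between two given ears is found in linear time
(`runs_greedyProgram`). The ears of an optimal path are among the seven largest ones
(`POpt.card_large_ears`), which leaves a bounded number of paths to be compared. The lengths along a
path first increase and then decrease, so that they can be sorted in linear time by merging from
both ends, and then be compared lexicographically (`runs_mergeProgram`, `better_of_sorting`).

The machine program is verified with a Hoare logic for total correctness (`Runs`), in which the
time bound is read off from the text of the program, as its loops are not nested and make at most
`n` iterations each.
-/

noncomputable section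

namespace ConcyclicDelaunay

section

/-! ### Chord sizes of a cyclic sequence of points -/

/-- The size of the chord between the points at angles `θ i` and `θ j` of a circle: the inscribed
angle over the shorter of the two arcs. -/
def chordVal (θ : ℤ → ℝ) (i j : ℤ) : ℝ :=
  min ((θ j - θ i) / 2) (Real.pi - (θ j - θ i) / 2)

/-- The angles of `n` points in counterclockwise order on a circle, indexed periodically by the
integers, such that crossing chords have different sizes. -/
structure CircSeq (n : ℕ) (θ : ℤ → ℝ) : Prop where
  mono : StrictMono θ
  period : ∀ i : ℤ, θ (i + n) = θ i + 2 * Real.pi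
  ne : ∀ i j k l : ℤ, i < j → j < k → k < l → l < i + n → chordVal θ i k ≠ chordVal θ j l

variable {n : ℕ} {θ : ℤ → ℝ}

theorem CircSeq.val_compl (h : CircSeq n θ) (i j : ℤ) :
    chordVal θ j (i + n) = chordVal θ i j := by
  unfold chordVal
  rw [h.period, min_comm]
  congr 1 <;> ring

theorem CircSeq.val_shift (h : CircSeq n θ) (i j : ℤ) :
    chordVal θ (i + n) (j + n) = chordVal θ i j := by
  unfold chordVal
  rw [h.period, h.period]
  congr 1 <;> ring

theorem CircSeq.lt_two_pi (h : CircSeq n θ) {i j : ℤ} (hj : j < i + n) :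
    θ j - θ i < 2 * Real.pi := by
  have := h.mono hj
  rw [h.period] at this
  linarith

theorem CircSeq.val_pos (h : CircSeq n θ) {i j : ℤ} (hi : i < j) (hj : j < i + n) :
    0 < chordVal θ i j := by
  have h1 := h.mono hi
  have h2 := h.lt_two_pi hj
  unfold chordVal
  rw [lt_min_iff]
  constructor <;> linarith

/-- Disjoint chords have different sizes: otherwise they are the legs of an isosceles trapezoid,
whose diagonals have equal length. -/
theorem CircSeq.disj_ne (h : CircSeq n θ) {i j k l : ℤ} (hij : i < j) (hjk : j < k) (hkl : k < l)
    (hl : l < i + n) : chordVal θ i j ≠ chordVal θ k l := by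
  intro he
  apply h.ne i j k l hij hjk hkl hl
  have h1 := h.mono hij
  have h2 := h.mono hjk
  have h3 := h.mono hkl
  have h4 := h.lt_two_pi hl
  have key : θ j - θ i = θ l - θ k := by
    unfold chordVal at he
    rcases min_choice ((θ j - θ i) / 2) (Real.pi - (θ j - θ i) / 2) with e1 | e1 <;>
    rcases min_choice ((θ l - θ k) / 2) (Real.pi - (θ l - θ k) / 2) with e2 | e2 <;>
    rw [e1, e2] at he <;> linarith
  unfold chordVal
  congr 1 <;> linarith

/-- The size of a window lying between two windows is at least the smaller of their sizes. -/
theorem CircSeq.min_le_val (h : CircSeq n θ) {i j i' j' i'' j'' : ℤ} (h1 : i' ≤ i) (h2 : i'' ≤ i')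
    (h3 : j ≤ j') (h4 : j' ≤ j'') :
    min (chordVal θ i j) (chordVal θ i'' j'') ≤ chordVal θ i' j' := by
  have g1 := h.mono.monotone h1
  have g2 := h.mono.monotone h2
  have g3 := h.mono.monotone h3
  have g4 := h.mono.monotone h4
  unfold chordVal
  apply le_min
  · apply (min_le_left _ _).trans ((min_le_left _ _).trans _)
    linarith
  · apply (min_le_right _ _).trans ((min_le_right _ _).trans _)
    linarith

theorem CircSeq.min_lt_val (h : CircSeq n θ) {i j i' j' i'' j'' : ℤ} (h1 : i' ≤ i) (h2 : i'' ≤ i')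
    (h3 : j ≤ j') (h4 : j' ≤ j'') (h5 : j - i < j' - i') (h6 : j' - i' < j'' - i'') :
    min (chordVal θ i j) (chordVal θ i'' j'') < chordVal θ i' j' := by
  have g1 := h.mono.monotone h1
  have g2 := h.mono.monotone h2
  have g3 := h.mono.monotone h3
  have g4 := h.mono.monotone h4
  have g5 : θ j - θ i < θ j' - θ i' := by
    rcases h1.lt_or_eq with e | e
    · have := h.mono e
      linarith
    · have := h.mono (show j < j' by omega)
      linarith
  have g6 : θ j' - θ i' < θ j'' - θ i'' := by
    rcases h2.lt_or_eq with e | e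
    · have := h.mono e
      linarith
    · have := h.mono (show j' < j'' by omega)
      linarith
  unfold chordVal
  apply lt_min
  · apply lt_of_le_of_lt ((min_le_left _ _).trans (min_le_left _ _)) _
    linarith
  · apply lt_of_le_of_lt ((min_le_right _ _).trans (min_le_right _ _)) _
    linarith

/-! ### Paths of nested windows -/

/-- `Better f g`: of two multisets of reals with the counting functions `f` and `g` (the number of
elements that are at most a given bound), the first is lexicographically larger, where smaller
elements come first. -/
def Better (f g : ℝ → ℕ) : Prop :=
  ∃ t, f t < g t ∧ ∀ s < t, f s ≤ g s

/-- A growing sequence of windows `[w k, w k + k]`, `1 ≤ k ≤ n - 1`, in the cyclic sequence of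
vertices. Its windows of sizes `2, …, n - 2` cut out a triangulation with two ears. -/
def IsPath (n : ℕ) (w : ℕ → ℤ) : Prop :=
  ∀ k, 1 ≤ k → k + 2 ≤ n → w (k + 1) = w k ∨ w (k + 1) = w k - 1

/-- The size of the `k`-th chord of a path. -/
def pathVal (θ : ℤ → ℝ) (w : ℕ → ℤ) (k : ℕ) : ℝ := chordVal θ (w k) (w k + k)

/-- The number of chords of a path of size at most `s`. -/
def pathCount (n : ℕ) (θ : ℤ → ℝ) (w : ℕ → ℤ) (s : ℝ) : ℕ :=
  ((Finset.Icc 2 (n - 2)).filter fun k => pathVal θ w k ≤ s).card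

/-- A path whose chord sizes are lexicographically maximal among all paths. -/
def POpt (n : ℕ) (θ : ℤ → ℝ) (w : ℕ → ℤ) : Prop :=
  IsPath n w ∧ ∀ w', IsPath n w' → ¬ Better (pathCount n θ w') (pathCount n θ w)

/-- Monotonicity of the two ends of the windows, on a range where the steps are legal. -/
theorem nested_of_steps {w : ℕ → ℤ} {a b : ℕ}
    (hw : ∀ k, a ≤ k → k < b → w (k + 1) = w k ∨ w (k + 1) = w k - 1)
    {j k : ℕ} (hj : a ≤ j) (hjk : j ≤ k) (hk : k ≤ b) : w k ≤ w j ∧ w j + j ≤ w k + k := by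
  induction k, hjk using Nat.le_induction with
  | base => simp
  | succ k hjk ih =>
    have := ih (by omega)
    rcases hw k (by omega) (by omega) with e | e <;> rw [e] <;> push_cast <;> omega

theorem IsPath.nested {w : ℕ → ℤ} (hw : IsPath n w) {j k : ℕ} (hj : 1 ≤ j) (hjk : j ≤ k)
    (hk : k + 1 ≤ n) : w k ≤ w j ∧ w j + j ≤ w k + k :=
  nested_of_steps (a := 1) (b := n - 1) (fun k h1 h2 => hw k h1 (by omega)) hj hjk (by omega)

/-- A lower part and an upper part of paths can be joined if the last window of the former lies
in the first window of the latter. -/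
theorem exists_splice {u v : ℕ → ℤ} {j m : ℕ} (hjm : j ≤ m)
    (hu : ∀ k, 1 ≤ k → k < j → u (k + 1) = u k ∨ u (k + 1) = u k - 1)
    (hv : ∀ k, m ≤ k → k + 2 ≤ n → v (k + 1) = v k ∨ v (k + 1) = v k - 1)
    (h1 : v m ≤ u j) (h2 : u j + j ≤ v m + m) :
    ∃ w, IsPath n w ∧ (∀ k ≤ j, w k = u k) ∧ (∀ k, m ≤ k → w k = v k) ∧
      ∀ k, j ≤ k → k ≤ m → v m ≤ w k ∧ w k ≤ u j ∧ u j + j ≤ w k + k ∧ w k + k ≤ v m + m := by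
  obtain ⟨w, hw⟩ : ∃ w : ℕ → ℤ, ∀ k, w k =
      if k ≤ j then u k else if k ≤ m then max (v m) (u j - (k - j)) else v k := ⟨_, fun _ => rfl⟩
  have hA : ∀ k ≤ j, w k = u k := by
    intro k hk
    rw [hw, if_pos hk]
  have hB : ∀ k, j ≤ k → k ≤ m → w k = max (v m) (u j - (k - j)) := by
    intro k hk hm
    rw [hw]
    split_ifs with e
    · obtain rfl : k = j := by omega
      rw [max_eq_right] <;> omega
    · rfl
  have hC : ∀ k, m ≤ k → w k = v k := by
    intro k hk
    rcases hk.eq_or_lt with rfl | hk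
    · rw [hB m hjm le_rfl, max_eq_left]
      omega
    · rw [hw, if_neg (by omega), if_neg (by omega)]
  refine ⟨w, ?_, hA, hC, ?_⟩
  · intro k h1 h2
    by_cases e1 : k < j
    · rw [hA k (by omega), hA (k + 1) (by omega)]
      exact hu k h1 e1
    by_cases e2 : k < m
    · rw [hB k (by omega) (by omega), hB (k + 1) (by omega) (by omega)]
      push_cast
      omega
    · rw [hC k (by omega), hC (k + 1) (by omega)]
      exact hv k (by omega) h2
  · intro k hk hm
    rw [hB k hk hm]
    omega

/-- A comparison criterion: apart from chords larger than `t`, the chords of `w'` are matched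
injectively with chords of `w` that are at most as large, and some chord of `w` of size at most
`t` corresponds to one of `w'` that is larger than `t`. -/
theorem better_of_perm {w w' : ℕ → ℤ} (σ : Equiv.Perm ℕ) {t : ℝ} {k₀ : ℕ}
    (hσ : ∀ k, 2 ≤ k → k ≤ n - 2 → 2 ≤ σ k ∧ σ k ≤ n - 2)
    (hk : ∀ k, 2 ≤ k → k ≤ n - 2 → t < pathVal θ w' k ∨ pathVal θ w (σ k) ≤ pathVal θ w' k)
    (h1 : 2 ≤ k₀) (h2 : k₀ ≤ n - 2) (h3 : pathVal θ w (σ k₀) ≤ t) (h4 : t < pathVal θ w' k₀) :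
    Better (pathCount n θ w') (pathCount n θ w) := by
  have key : ∀ s ≤ t, (((Finset.Icc 2 (n - 2)).filter fun k => pathVal θ w' k ≤ s).map
      σ.toEmbedding) ⊆ (Finset.Icc 2 (n - 2)).filter fun k => pathVal θ w k ≤ s := by
    intro s hs k hk'
    simp only [Finset.mem_map, Finset.mem_filter, Finset.mem_Icc, Equiv.coe_toEmbedding] at hk' ⊢
    obtain ⟨a, ⟨⟨h5, h6⟩, h7⟩, rfl⟩ := hk'
    refine ⟨hσ a h5 h6, ?_⟩
    rcases hk a h5 h6 with h | h <;> linarith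
  refine ⟨t, ?_, fun s hs => ?_⟩
  · unfold pathCount
    rw [← Finset.card_map σ.toEmbedding]
    apply Finset.card_lt_card
    refine ⟨key t le_rfl, fun hsub => ?_⟩
    have hm : σ k₀ ∈ (Finset.Icc 2 (n - 2)).filter fun k => pathVal θ w k ≤ t := by
      simp only [Finset.mem_filter, Finset.mem_Icc]
      exact ⟨hσ k₀ h1 h2, h3⟩
    have := hsub hm
    simp only [Finset.mem_map, Finset.mem_filter, Finset.mem_Icc, Equiv.coe_toEmbedding,
      σ.injective.eq_iff, exists_eq_right] at this
    linarith [this.2]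
  · unfold pathCount
    rw [← Finset.card_map σ.toEmbedding]
    exact Finset.card_le_card (key s hs.le)

theorem better_of_le {w w' : ℕ → ℤ} {t : ℝ} {k₀ : ℕ}
    (hk : ∀ k, 2 ≤ k → k ≤ n - 2 → t < pathVal θ w' k ∨ pathVal θ w k ≤ pathVal θ w' k)
    (h1 : 2 ≤ k₀) (h2 : k₀ ≤ n - 2) (h3 : pathVal θ w k₀ ≤ t) (h4 : t < pathVal θ w' k₀) :
    Better (pathCount n θ w') (pathCount n θ w) :=
  better_of_perm (Equiv.refl ℕ) (fun _ h h' => ⟨h, h'⟩) hk h1 h2 h3 h4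

/-- If two counting functions differ, then one of the multisets is lexicographically larger. -/
theorem pathCount_eq_of_not_better {w w' : ℕ → ℤ}
    (h1 : ¬ Better (pathCount n θ w) (pathCount n θ w'))
    (h2 : ¬ Better (pathCount n θ w') (pathCount n θ w)) (s : ℝ) :
    pathCount n θ w s = pathCount n θ w' s := by
  classical
  by_contra hs
  set V := (Finset.Icc 2 (n - 2)).image (pathVal θ w) ∪
    (Finset.Icc 2 (n - 2)).image (pathVal θ w') with hV
  -- the counting functions only change at elements of `V`, so they differ at one of these
  have step : ∀ s, pathCount n θ w s ≠ pathCount n θ w' s →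
      ∃ x ∈ V, x ≤ s ∧ pathCount n θ w x ≠ pathCount n θ w' x := by
    intro s hs
    have hne : (V.filter (· ≤ s)).Nonempty := by
      by_contra he
      rw [Finset.not_nonempty_iff_eq_empty] at he
      apply hs
      unfold pathCount
      rw [Finset.filter_false_of_mem, Finset.filter_false_of_mem]
      · intro k hk hle
        have : pathVal θ w' k ∈ V.filter (· ≤ s) := Finset.mem_filter.2
          ⟨Finset.mem_union_right _ (Finset.mem_image_of_mem _ hk), hle⟩
        simp [he] at this
      · intro k hk hle
        have : pathVal θ w k ∈ V.filter (· ≤ s) := Finset.mem_filter.2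
          ⟨Finset.mem_union_left _ (Finset.mem_image_of_mem _ hk), hle⟩
        simp [he] at this
    have hx := Finset.max'_mem _ hne
    have hmax := fun y hy => Finset.le_max' (V.filter (· ≤ s)) y hy
    set x := (V.filter (· ≤ s)).max' hne
    rw [Finset.mem_filter] at hx
    refine ⟨x, hx.1, hx.2, ?_⟩
    have e1 : pathCount n θ w x = pathCount n θ w s := by
      unfold pathCount
      congr 1
      apply Finset.filter_congr
      intro k hk
      refine ⟨fun h => h.trans hx.2, fun h => hmax _ (Finset.mem_filter.2
        ⟨Finset.mem_union_left _ (Finset.mem_image_of_mem _ hk), h⟩)⟩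
    have e2 : pathCount n θ w' x = pathCount n θ w' s := by
      unfold pathCount
      congr 1
      apply Finset.filter_congr
      intro k hk
      refine ⟨fun h => h.trans hx.2, fun h => hmax _ (Finset.mem_filter.2
        ⟨Finset.mem_union_right _ (Finset.mem_image_of_mem _ hk), h⟩)⟩
    rw [e1, e2]
    exact hs
  obtain ⟨x₀, hx₀, -, hx₀'⟩ := step s hs
  have hne : (V.filter fun x => pathCount n θ w x ≠ pathCount n θ w' x).Nonempty :=
    ⟨x₀, Finset.mem_filter.2 ⟨hx₀, hx₀'⟩⟩
  have hx := Finset.min'_mem _ hne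
  have hmin := fun y hy => Finset.min'_le
    (V.filter fun x => pathCount n θ w x ≠ pathCount n θ w' x) y hy
  set x := (V.filter fun x => pathCount n θ w x ≠ pathCount n θ w' x).min' hne
  rw [Finset.mem_filter] at hx
  have hlow : ∀ y < x, pathCount n θ w y = pathCount n θ w' y := by
    intro y hy
    by_contra hne
    obtain ⟨z, hz, hzy, hz'⟩ := step y hne
    have := hmin z (Finset.mem_filter.2 ⟨hz, hz'⟩)
    linarith
  rcases lt_or_gt_of_ne hx.2 with h | h
  · exact h1 ⟨x, h, fun s hs => (hlow s hs).le⟩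
  · exact h2 ⟨x, h, fun s hs => (hlow s hs).ge⟩

/-- Equal counting functions give equal numbers of chords of any given size. -/
theorem card_eq_of_pathCount_eq {w w' : ℕ → ℤ} (h : ∀ s, pathCount n θ w s = pathCount n θ w' s)
    (x : ℝ) : ((Finset.Icc 2 (n - 2)).filter fun k => pathVal θ w k = x).card =
      ((Finset.Icc 2 (n - 2)).filter fun k => pathVal θ w' k = x).card := by
  classical
  -- a bound below `x` such that no chord has its size strictly between the two
  obtain ⟨s, hs, hs'⟩ : ∃ s < x, ∀ k ∈ Finset.Icc 2 (n - 2),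
      (pathVal θ w k < x → pathVal θ w k ≤ s) ∧ (pathVal θ w' k < x → pathVal θ w' k ≤ s) := by
    set V := insert (x - 1) (((Finset.Icc 2 (n - 2)).image (pathVal θ w) ∪
      (Finset.Icc 2 (n - 2)).image (pathVal θ w')).filter (· < x)) with hV
    have hne : V.Nonempty := ⟨x - 1, Finset.mem_insert_self _ _⟩
    refine ⟨V.max' hne, ?_, fun k hk => ⟨fun h => ?_, fun h => ?_⟩⟩
    · rw [Finset.max'_lt_iff]
      intro y hy
      rw [hV, Finset.mem_insert, Finset.mem_filter] at hy
      rcases hy with rfl | hy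
      · linarith
      · exact hy.2
    · apply Finset.le_max'
      exact Finset.mem_insert_of_mem (Finset.mem_filter.2
        ⟨Finset.mem_union_left _ (Finset.mem_image_of_mem _ hk), h⟩)
    · apply Finset.le_max'
      exact Finset.mem_insert_of_mem (Finset.mem_filter.2
        ⟨Finset.mem_union_right _ (Finset.mem_image_of_mem _ hk), h⟩)
  have split : ∀ u : ℕ → ℤ, (∀ k ∈ Finset.Icc 2 (n - 2), pathVal θ u k < x → pathVal θ u k ≤ s) →
      pathCount n θ u x = pathCount n θ u s +
        ((Finset.Icc 2 (n - 2)).filter fun k => pathVal θ u k = x).card := by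
    intro u hu
    unfold pathCount
    rw [← Finset.card_union_of_disjoint]
    · congr 1
      ext k
      simp only [Finset.mem_filter, Finset.mem_union]
      constructor
      · rintro ⟨hk, hle⟩
        rcases hle.lt_or_eq with h | h
        · exact Or.inl ⟨hk, hu k hk h⟩
        · exact Or.inr ⟨hk, h⟩
      · rintro (⟨hk, hle⟩ | ⟨hk, hle⟩)
        · exact ⟨hk, by linarith⟩
        · exact ⟨hk, hle.le⟩
    · rw [Finset.disjoint_filter]
      intro k _ h1 h2
      linarith
  have e1 := split w fun k hk => (hs' k hk).1
  have e2 := split w' fun k hk => (hs' k hk).2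
  rw [h, h] at e1
  omega

end

section

variable {n : ℕ} {θ : ℤ → ℝ}

/-! ### Uniqueness of the optimal path -/

/-- Two optimal paths cannot part at a single window: suppose that they agree above size `m` and
that the chord of `w'` at `m` is the smaller one, of size `t`. Follow `w'` up to its first chord
larger than `t`. If one can still reach the window of `w` from there, the resulting path beats
`w'`. If not, then all later windows of `w'` up to size `m` cross the chord of `w` at `m`, so
that no chord of `w'` matches its size. -/
theorem POpt.false_of_lt (h : CircSeq n θ) {w w' : ℕ → ℤ} (hw : POpt n θ w) (hw' : POpt n θ w')
    {m : ℕ} (h2 : 2 ≤ m) (hm : m + 2 ≤ n) {y : ℤ}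
    (hd : w m = y ∧ w' m = y + 1 ∨ w m = y + 1 ∧ w' m = y)
    (heq : ∀ k, m < k → k + 2 ≤ n → w k = w' k) (hlt : pathVal θ w' m < pathVal θ w m) :
    False := by
  have hcount := pathCount_eq_of_not_better (hw'.2 w hw.1) (hw.2 w' hw'.1)
  have heqv : ∀ k, m < k → k + 2 ≤ n → pathVal θ w k = pathVal θ w' k := by
    intro k h1 h2
    unfold pathVal
    rw [heq k h1 h2]
  set t := pathVal θ w' m with ht
  have hex : ∃ j, 2 ≤ j ∧ j ≤ m ∧ t < pathVal θ w' j := by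
    by_contra hno
    push Not at hno
    have hc := hcount t
    apply hc.not_lt
    unfold pathCount
    apply Finset.card_lt_card
    refine ⟨fun k hk => ?_, fun hsub => ?_⟩
    · simp only [Finset.mem_filter, Finset.mem_Icc] at hk ⊢
      refine ⟨hk.1, ?_⟩
      by_cases e : k ≤ m
      · exact hno k hk.1.1 e
      · rw [← heqv k (by omega) (by omega)]
        exact hk.2
    · have : m ∈ (Finset.Icc 2 (n - 2)).filter fun k => pathVal θ w' k ≤ t := by
        simp only [Finset.mem_filter, Finset.mem_Icc]
        exact ⟨⟨h2, by omega⟩, le_rfl⟩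
      have := hsub this
      simp only [Finset.mem_filter] at this
      linarith [this.2]
  classical
  set j := Nat.find hex with hj
  obtain ⟨hj2, hjm, hjt⟩ := Nat.find_spec hex
  have hjmin : ∀ k, 2 ≤ k → k < j → pathVal θ w' k ≤ t := by
    intro k h1 h2
    by_contra hk
    push Not at hk
    exact Nat.find_min hex h2 ⟨h1, by omega, hk⟩
  have hnest := fun (k : ℕ) (h1 : j ≤ k) (h2 : k ≤ m) => hw'.1.nested (by omega) h1 (by omega)
  have hnest' := fun (k : ℕ) (h1 : j ≤ k) (h2 : k ≤ m) =>
    hw'.1.nested (show 1 ≤ k by omega) h2 (by omega)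
  by_cases hsub : w m ≤ w' j ∧ w' j + j ≤ w m + m
  · obtain ⟨u, hu, hu1, hu2, hu3⟩ := exists_splice (n := n) (u := w') (v := w) hjm
      (fun k h1 h2 => hw'.1 k h1 (by omega)) (fun k h1 h2 => hw.1 k (by omega) h2) hsub.1 hsub.2
    apply hw'.2 u hu
    have hmid : ∀ k, j ≤ k → k ≤ m → t < pathVal θ u k := by
      intro k h1 h2
      obtain ⟨b1, b2, b3, b4⟩ := hu3 k h1 h2
      have := h.min_le_val b2 b1 b3 b4
      exact lt_of_lt_of_le (lt_min hjt hlt) this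
    refine better_of_le (t := t) (k₀ := m) (fun k h1 h3 => ?_) h2 (by omega) le_rfl
      (hmid m hjm le_rfl)
    by_cases e1 : k < j
    · right
      unfold pathVal
      rw [hu1 k e1.le]
    by_cases e2 : k ≤ m
    · exact Or.inl (hmid k (by omega) e2)
    · right
      rw [← heqv k (by omega) (by omega)]
      unfold pathVal
      rw [hu2 k (by omega)]
  · have hne : ∀ k, 2 ≤ k → k ≤ m → pathVal θ w' k ≠ pathVal θ w m := by
      intro k hk2 hkm
      by_cases e1 : k < j
      · have := hjmin k hk2 e1
        linarith
      have b1 := hnest k (by omega) hkm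
      have b2 := hnest' k (by omega) hkm
      have b3 := hnest m hjm le_rfl
      unfold pathVal
      rcases hd with ⟨d1, d2⟩ | ⟨d1, d2⟩
      · rw [d1] at hsub ⊢
        have e2 : w' k + k = y + m + 1 := by omega
        rw [e2]
        exact (h.ne y (w' k) (y + m) (y + m + 1) (by omega) (by omega) (by omega) (by omega)).symm
      · rw [d1] at hsub ⊢
        have e2 : w' k = y := by omega
        rw [e2]
        exact h.ne y (y + 1) (y + k) (y + 1 + m) (by omega) (by omega) (by omega) (by omega)
    have hc := card_eq_of_pathCount_eq hcount (pathVal θ w m)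
    apply hc.not_gt
    apply Finset.card_lt_card
    refine ⟨fun k hk => ?_, fun hsub => ?_⟩
    · simp only [Finset.mem_filter, Finset.mem_Icc] at hk ⊢
      refine ⟨hk.1, ?_⟩
      by_cases e : k ≤ m
      · exact absurd hk.2 (hne k hk.1.1 e)
      · rw [heqv k (by omega) (by omega)]
        exact hk.2
    · have : m ∈ (Finset.Icc 2 (n - 2)).filter fun k => pathVal θ w k = pathVal θ w m := by
        simp only [Finset.mem_filter, Finset.mem_Icc]
        exact ⟨⟨h2, by omega⟩, trivial⟩
      have := hsub this
      simp only [Finset.mem_filter] at this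
      exact hne m h2 le_rfl this.2

/-- Optimal paths with the same or overlapping final ears are equal. -/
theorem POpt.eq_of_last (h : CircSeq n θ) {w w' : ℕ → ℤ} (hw : POpt n θ w) (hw' : POpt n θ w')
    (hlast : w' (n - 2) = w (n - 2) ∨ w' (n - 2) = w (n - 2) + 1) :
    ∀ k, 2 ≤ k → k + 2 ≤ n → w k = w' k := by
  classical
  by_contra hno
  push Not at hno
  obtain ⟨k₀, a1, a2, a3⟩ := hno
  set F := (Finset.Icc 2 (n - 2)).filter fun k => w k ≠ w' k with hF
  have hne : F.Nonempty := ⟨k₀, by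
    simp only [hF, Finset.mem_filter, Finset.mem_Icc]
    exact ⟨⟨a1, by omega⟩, a3⟩⟩
  have hm := Finset.max'_mem _ hne
  have hmax := fun k hk => Finset.le_max' F k hk
  set m := F.max' hne
  simp only [hF, Finset.mem_filter, Finset.mem_Icc] at hm
  obtain ⟨⟨m1, m2⟩, m3⟩ := hm
  have heq : ∀ k, m < k → k + 2 ≤ n → w k = w' k := by
    intro k h1 h2
    by_contra h3
    have := hmax k (by
      simp only [hF, Finset.mem_filter, Finset.mem_Icc]
      exact ⟨⟨by omega, by omega⟩, h3⟩)
    omega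
  obtain ⟨y, hy⟩ : ∃ y, w m = y ∧ w' m = y + 1 ∨ w m = y + 1 ∧ w' m = y := by
    by_cases e : m = n - 2
    · rw [e] at m3 ⊢
      exact ⟨w (n - 2), by omega⟩
    · have b1 := hw.1 m (by omega) (by omega)
      have b2 := hw'.1 m (by omega) (by omega)
      have b3 := heq (m + 1) (by omega) (by omega)
      exact ⟨w (m + 1), by omega⟩
  have hvne : pathVal θ w m ≠ pathVal θ w' m := by
    unfold pathVal
    rcases hy with ⟨d1, d2⟩ | ⟨d1, d2⟩ <;> rw [d1, d2]
    · exact h.ne y (y + 1) (y + m) (y + 1 + m) (by omega) (by omega) (by omega) (by omega)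
    · exact (h.ne y (y + 1) (y + m) (y + 1 + m)
        (by omega) (by omega) (by omega) (by omega)).symm
  rcases lt_or_gt_of_ne hvne with e | e
  · exact hw'.false_of_lt h hw m1 (by omega) (y := y) (by omega)
      (fun k h1 h2 => (heq k h1 h2).symm) e
  · exact hw.false_of_lt h hw' m1 (by omega) hy heq e

/-- The same path, traversed from its other end. -/
def pathRev (n : ℕ) (w : ℕ → ℤ) (k : ℕ) : ℤ := w (n - k) + ((n - k : ℕ) : ℤ)

theorem IsPath.rev {w : ℕ → ℤ} (hw : IsPath n w) : IsPath n (pathRev n w) := by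
  intro k h1 h2
  have := hw (n - (k + 1)) (by omega) (by omega)
  rw [show n - (k + 1) + 1 = n - k by omega] at this
  unfold pathRev
  omega

theorem CircSeq.pathVal_rev (h : CircSeq n θ) (w : ℕ → ℤ) {k : ℕ} (hk : k ≤ n) :
    pathVal θ (pathRev n w) k = pathVal θ w (n - k) := by
  unfold pathVal pathRev
  rw [← h.val_compl (w (n - k))]
  congr 1
  omega

theorem CircSeq.pathCount_rev (h : CircSeq n θ) (w : ℕ → ℤ) :
    pathCount n θ (pathRev n w) = pathCount n θ w := by
  funext s
  unfold pathCount
  apply Finset.card_bij (fun k _ => n - k)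
  · intro k hk
    simp only [Finset.mem_filter, Finset.mem_Icc] at hk ⊢
    rw [← h.pathVal_rev w (by omega)]
    exact ⟨by omega, hk.2⟩
  · intro a ha b hb hab
    simp only [Finset.mem_filter, Finset.mem_Icc] at ha hb
    omega
  · intro k hk
    simp only [Finset.mem_filter, Finset.mem_Icc] at hk
    refine ⟨n - k, ?_, by omega⟩
    simp only [Finset.mem_filter, Finset.mem_Icc]
    rw [h.pathVal_rev w (by omega), show n - (n - k) = k by omega]
    exact ⟨by omega, hk.2⟩

theorem POpt.rev (h : CircSeq n θ) {w : ℕ → ℤ} (hw : POpt n θ w) : POpt n θ (pathRev n w) :=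
  ⟨hw.1.rev, fun w' hw' => by
    rw [h.pathCount_rev]
    exact hw.2 w' hw'⟩

/-- The same path, with its vertices indexed by a translate. -/
def pathShift (n : ℕ) (q : ℤ) (w : ℕ → ℤ) (k : ℕ) : ℤ := w k + n * q

theorem CircSeq.val_shift_mul (h : CircSeq n θ) (i j q : ℤ) :
    chordVal θ (i + n * q) (j + n * q) = chordVal θ i j := by
  induction q using Int.induction_on with
  | zero => simp
  | succ q ih =>
    rw [← ih, ← h.val_shift (i + n * q)]
    congr 1 <;> ring
  | pred q ih =>
    rw [← ih, ← h.val_shift (i + n * (-q - 1))]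
    congr 1 <;> ring

theorem CircSeq.pathVal_shift (h : CircSeq n θ) (q : ℤ) (w : ℕ → ℤ) :
    pathVal θ (pathShift n q w) = pathVal θ w := by
  funext k
  unfold pathVal pathShift
  rw [← h.val_shift_mul (w k) _ q]
  congr 1
  ring

theorem POpt.shift (h : CircSeq n θ) {w : ℕ → ℤ} (hw : POpt n θ w) (q : ℤ) :
    POpt n θ (pathShift n q w) := by
  refine ⟨fun k h1 h2 => ?_, fun w' hw' => ?_⟩
  · have := hw.1 k h1 h2
    unfold pathShift
    omega
  · have := hw.2 w' hw'
    unfold pathCount at this ⊢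
    rw [h.pathVal_shift]
    exact this

/-- The path that starts with the ear at `p` and ends with the ear at `q` (cutting off the vertices
`p + 1` and `q + 1`), with all chords in between larger than the smaller ear. -/
theorem CircSeq.exists_path (h : CircSeq n θ) {p q : ℤ} (h1 : p + 2 ≤ q) (h2 : q + 2 ≤ p + n) :
    ∃ w, IsPath n w ∧ w 1 = p ∧ w 2 = p ∧ w (n - 2) = q + 2 - n ∧ w (n - 1) = q + 2 - n ∧
      ∀ k, 3 ≤ k → k + 3 ≤ n →
        min (chordVal θ p (p + 2)) (chordVal θ q (q + 2)) < pathVal θ w k := by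
  obtain ⟨w, hw, w1, w2, w3⟩ := exists_splice (n := n) (u := fun _ => p)
    (v := fun _ => q + 2 - n) (j := 2) (m := n - 2) (by omega) (fun _ _ _ => Or.inl rfl)
    (fun _ _ _ => Or.inl rfl) (by omega) (by push_cast [show 2 ≤ n by omega]; omega)
  refine ⟨w, hw, w1 1 (by omega), w1 2 le_rfl, w2 _ le_rfl, w2 _ (by omega), fun k a1 a2 => ?_⟩
  obtain ⟨b1, b2, b3, b4⟩ := w3 k (by omega) (by omega)
  have := h.min_lt_val b2 b1 b3 b4 (by push_cast; omega) (by
    push_cast [show 2 ≤ n by omega]; omega)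
  rw [← h.val_compl q] at *
  rw [← h.val_shift (q + 2 - n)] at this
  have e1 : q + 2 - n + n = q + 2 := by ring
  have e2 : q + 2 - (n : ℤ) + (n - 2 : ℕ) + n = q + n := by
    push_cast [show 2 ≤ n by omega]; ring
  rw [e1, e2] at this
  exact this

end

section

variable {n : ℕ} {θ : ℤ → ℝ}

/-- The size of the ear with apex `x + 1`, that is, of the chord from `x` to `x + 2`. -/
def earVal (θ : ℤ → ℝ) (x : ℤ) : ℝ := chordVal θ x (x + 2)

theorem CircSeq.earVal_shift (h : CircSeq n θ) (x q : ℤ) : earVal θ (x + n * q) = earVal θ x := by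
  unfold earVal
  rw [← h.val_shift_mul x _ q]
  congr 1
  ring

theorem CircSeq.earVal_emod (h : CircSeq n θ) (x : ℤ) : earVal θ (x % n) = earVal θ x := by
  rw [← h.earVal_shift (x % n) (x / n), Int.emod_add_mul_ediv]

/-- The starting point of the last ear of a path. -/
def lastEar (n : ℕ) (w : ℕ → ℤ) : ℤ := w (n - 2) + (n - 2 : ℕ)

theorem CircSeq.pathVal_last (h : CircSeq n θ) (hn : 2 ≤ n) (w : ℕ → ℤ) :
    pathVal θ w (n - 2) = earVal θ (lastEar n w) := by
  unfold pathVal earVal lastEar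
  rw [← h.val_compl]
  congr 1
  push_cast [hn]
  ring

/-- No two disjoint ears are both larger than the smaller ear of an optimal path. -/
theorem POpt.min_ear_le (h : CircSeq n θ) (hn : 4 ≤ n) {w : ℕ → ℤ} (hw : POpt n θ w) {x y : ℤ}
    (h1 : x + 2 ≤ y) (h2 : y + 2 ≤ x + n) :
    min (earVal θ x) (earVal θ y) ≤ min (earVal θ (w 2)) (earVal θ (lastEar n w)) := by
  by_contra hlt
  push Not at hlt
  obtain ⟨u, hu, u1, u2, u3, u4, u5⟩ := h.exists_path h1 h2
  apply hw.2 u hu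
  have hall : ∀ k, 2 ≤ k → k ≤ n - 2 → min (earVal θ x) (earVal θ y) ≤ pathVal θ u k := by
    intro k k1 k2
    by_cases e1 : k = 2
    · subst e1
      apply (min_le_left _ _).trans
      unfold pathVal earVal
      rw [u2]
      rfl
    by_cases e2 : k = n - 2
    · subst e2
      apply (min_le_right _ _).trans
      rw [h.pathVal_last (by omega)]
      unfold lastEar
      rw [u3]
      apply le_of_eq
      congr 1
      push_cast [show 2 ≤ n by omega]
      ring
    · exact (u5 k (by omega) (by omega)).le
  rcases min_choice (earVal θ (w 2)) (earVal θ (lastEar n w)) with e | e <;> rw [e] at hlt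
  · exact better_of_le (t := earVal θ (w 2)) (k₀ := 2)
      (fun k k1 k2 => Or.inl (hlt.trans_le (hall k k1 k2))) le_rfl (by omega) le_rfl
      (hlt.trans_le (hall 2 le_rfl (by omega)))
  · exact better_of_le (t := earVal θ (lastEar n w)) (k₀ := n - 2)
      (fun k k1 k2 => Or.inl (hlt.trans_le (hall k k1 k2))) (by omega) le_rfl
      (h.pathVal_last (by omega) w).le (hlt.trans_le (hall _ (by omega) le_rfl))

/-- The previous lemma for positions reduced modulo `n`. -/
theorem POpt.min_ear_le' (h : CircSeq n θ) (hn : 4 ≤ n) {w : ℕ → ℤ} (hw : POpt n θ w) {x y : ℤ}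
    (h1 : x + 2 ≤ y ∧ y + 2 ≤ x + n ∨ y + 2 ≤ x ∧ x + 2 ≤ y + n) :
    min (earVal θ x) (earVal θ y) ≤ min (earVal θ (w 2)) (earVal θ (lastEar n w)) := by
  rcases h1 with ⟨h1, h2⟩ | ⟨h1, h2⟩
  · exact hw.min_ear_le h hn h1 h2
  · rw [min_comm]
    exact hw.min_ear_le h hn h1 h2

/-- Ears of equal size share exactly an endpoint. -/
theorem CircSeq.ear_ne (h : CircSeq n θ) (hn : 4 ≤ n) {x y : ℤ}
    (hxy : y - x = 1 ∨ y - x = n - 1 ∨ 3 ≤ y - x ∧ y - x + 3 ≤ n) :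
    earVal θ x ≠ earVal θ y := by
  rcases hxy with e | e | ⟨e, e'⟩
  · unfold earVal
    exact h.ne x y (x + 2) (y + 2) (by omega) (by omega) (by omega) (by omega)
  · rw [← h.earVal_shift x 1]
    unfold earVal
    exact (h.ne y (x + n * 1) (y + 2) (x + n * 1 + 2) (by omega) (by omega) (by omega)
      (by omega)).symm
  · unfold earVal
    exact h.disj_ne (by omega) (by omega) (by omega) (by omega)

theorem CircSeq.ear_eq (h : CircSeq n θ) (hn : 4 ≤ n) {x y : ℤ} (hx : 0 ≤ x) (hx' : x < n)
    (hy : 0 ≤ y) (hy' : y < n) (he : earVal θ x = earVal θ y) :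
    y = x ∨ y - x = 2 ∨ x - y = 2 ∨ y - x = n - 2 ∨ x - y = n - 2 := by
  by_contra hno
  rcases le_total x y with hle | hle
  · exact h.ear_ne hn (x := x) (y := y) (by omega) he
  · exact h.ear_ne hn (x := y) (y := x) (by omega) he.symm

theorem CircSeq.not_three_ears (h : CircSeq n θ) (hn : 4 ≤ n) {x y z u : ℤ}
    (hx : 0 ≤ x ∧ x < n) (hy : 0 ≤ y ∧ y < n) (hz : 0 ≤ z ∧ z < n) (hu : 0 ≤ u ∧ u < n)
    (hxu : 2 ≤ |x - u| ∧ |x - u| + 2 ≤ n) (hyu : 2 ≤ |y - u| ∧ |y - u| + 2 ≤ n)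
    (hzu : 2 ≤ |z - u| ∧ |z - u| + 2 ≤ n) (hxy : x ≠ y) (hxz : x ≠ z) (hyz : y ≠ z)
    (e1 : earVal θ x = earVal θ y) (e2 : earVal θ x = earVal θ z) : False := by
  have a1 := h.ear_eq hn hx.1 hx.2 hy.1 hy.2 e1
  have a2 := h.ear_eq hn hx.1 hx.2 hz.1 hz.2 e2
  have a3 := h.ear_eq hn hy.1 hy.2 hz.1 hz.2 (e1.symm.trans e2)
  rcases abs_cases (x - u) with ⟨b1, b1'⟩ | ⟨b1, b1'⟩ <;>
  rcases abs_cases (y - u) with ⟨b2, b2'⟩ | ⟨b2, b2'⟩ <;>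
  rcases abs_cases (z - u) with ⟨b3, b3'⟩ | ⟨b3, b3'⟩ <;>
  rw [b1] at hxu <;> rw [b2] at hyu <;> rw [b3] at hzu <;> omega

/-- There are less than seven ears that are at least as large as the smaller ear of an optimal
path: at most two are larger, since these overlap pairwise, and at most two are equal to it. -/
theorem POpt.card_large_ears (h : CircSeq n θ) {w : ℕ → ℤ} (hw : POpt n θ w) (S : Finset ℤ)
    (hS : ∀ x ∈ S, 0 ≤ x ∧ x < n) (hcard : S.card = 7)
    (hle : ∀ x ∈ S, min (earVal θ (w 2)) (earVal θ (lastEar n w)) ≤ earVal θ x) : False := by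
  classical
  set e := min (earVal θ (w 2)) (earVal θ (lastEar n w)) with he
  have hn : 7 ≤ n := by
    have : S ⊆ Finset.Ico 0 (n : ℤ) := fun x hx => Finset.mem_Ico.2 (hS x hx)
    have := Finset.card_le_card this
    simp at this
    omega
  have hH : (S.filter fun x => e < earVal θ x).card ≤ 2 := by
    by_contra hc
    push Not at hc
    rw [Finset.two_lt_card] at hc
    obtain ⟨a, ha, b, hb, c, hc, hab, hac, hbc⟩ := hc
    rw [Finset.mem_filter] at ha hb hc
    have key : ∀ x y, x ∈ S → y ∈ S → e < earVal θ x → e < earVal θ y →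
        ¬ (x + 2 ≤ y ∧ y + 2 ≤ x + n ∨ y + 2 ≤ x ∧ x + 2 ≤ y + n) := by
      intro x y hx hy hx' hy' hd
      have := hw.min_ear_le' h (by omega) hd
      rw [← he] at this
      exact absurd (lt_min hx' hy') (not_lt.2 this)
    have k1 := key a b ha.1 hb.1 ha.2 hb.2
    have k2 := key a c ha.1 hc.1 ha.2 hc.2
    have k3 := key b c hb.1 hc.1 hb.2 hc.2
    have := hS a ha.1
    have := hS b hb.1
    have := hS c hc.1
    omega
  have hE : (S.filter fun x => earVal θ x ≤ e).card ≤ 2 := by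
    by_contra hc
    push Not at hc
    rw [Finset.two_lt_card] at hc
    obtain ⟨a, ha, b, hb, c, hc, hab, hac, hbc⟩ := hc
    rw [Finset.mem_filter] at ha hb hc
    have ea := le_antisymm (hle a ha.1) ha.2
    have eb := le_antisymm (hle b hb.1) hb.2
    have ec := le_antisymm (hle c hc.1) hc.2
    obtain ⟨a1, a2⟩ := hS a ha.1
    obtain ⟨b1, b2⟩ := hS b hb.1
    obtain ⟨c1, c2⟩ := hS c hc.1
    have k1 := h.ear_eq (by omega) a1 a2 b1 b2 (ea.symm.trans eb)
    have k2 := h.ear_eq (by omega) a1 a2 c1 c2 (ea.symm.trans ec)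
    have k3 := h.ear_eq (by omega) b1 b2 c1 c2 (eb.symm.trans ec)
    omega
  have := Finset.card_filter_add_card_filter_not (s := S) (fun x => e < earVal θ x)
  simp only [not_lt] at this
  omega

/-- `w` and `w'` are the same up to the choice of the starting end and of the indexing. -/
def PathEquiv (n : ℕ) (w w' : ℕ → ℤ) : Prop :=
  ∃ v v', (v = w ∨ v = pathRev n w) ∧ (v' = w' ∨ v' = pathRev n w') ∧
    ∃ q : ℤ, ∀ k, 2 ≤ k → k + 2 ≤ n → v k = v' k + n * q

theorem POpt.eq_shift_of_last (h : CircSeq n θ) (hn : 4 ≤ n) {w w' : ℕ → ℤ} (hw : POpt n θ w)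
    (hw' : POpt n θ w') {x x' : ℤ} (hx : x = lastEar n w % n) (hx' : x' = lastEar n w' % n)
    (hlast : ¬ (2 ≤ |x - x'| ∧ |x - x'| + 2 ≤ n)) :
    ∃ q : ℤ, ∀ k, 2 ≤ k → k + 2 ≤ n → w k = w' k + n * q := by
  have x0 := Int.emod_nonneg (lastEar n w) (show (n : ℤ) ≠ 0 by omega)
  have x1 := Int.emod_lt_of_pos (lastEar n w) (show 0 < (n : ℤ) by omega)
  have x0' := Int.emod_nonneg (lastEar n w') (show (n : ℤ) ≠ 0 by omega)
  have x1' := Int.emod_lt_of_pos (lastEar n w') (show 0 < (n : ℤ) by omega)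
  have d := Int.emod_add_mul_ediv (lastEar n w) n
  have d' := Int.emod_add_mul_ediv (lastEar n w') n
  set a := lastEar n w / n
  set a' := lastEar n w' / n
  rw [← hx] at x0 x1 d
  rw [← hx'] at x0' x1' d'
  have main : ∀ q : ℤ, (w (n - 2) + n * q = w' (n - 2) ∨ w (n - 2) + n * q = w' (n - 2) + 1 ∨
      w (n - 2) + n * q = w' (n - 2) - 1) → ∃ q : ℤ, ∀ k, 2 ≤ k → k + 2 ≤ n →
        w k = w' k + n * q := by
    intro q hq
    refine ⟨-q, fun k k1 k2 => ?_⟩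
    have hs := hw.shift h q
    have : pathShift n q w k = w' k := by
      by_cases e : w (n - 2) + n * q = w' (n - 2) - 1
      · exact hs.eq_of_last h hw' (Or.inr (by unfold pathShift; omega)) k k1 k2
      · exact (hw'.eq_of_last h hs (by unfold pathShift; omega) k k1 k2).symm
    unfold pathShift at this
    linarith
  unfold lastEar at d d'
  have hc : x = x' ∨ x = x' + 1 ∨ x = x' - 1 ∨ x - x' = n - 1 ∨ x' - x = n - 1 := by
    rcases abs_cases (x - x') with ⟨b, b'⟩ | ⟨b, b'⟩ <;> rw [b] at hlast <;> omega
  rcases hc with e | e | e | e | e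
  · exact main (a' - a) (by left; linarith)
  · exact main (a' - a) (by right; left; linarith)
  · exact main (a' - a) (by right; right; linarith)
  · exact main (a' - a - 1) (by right; right; linarith)
  · exact main (a' - a + 1) (by right; left; linarith)

theorem lastEar_rev (hn : 2 ≤ n) (w : ℕ → ℤ) : lastEar n (pathRev n w) = w 2 + n * 1 := by
  unfold lastEar pathRev
  rw [show n - (n - 2) = 2 by omega]
  push_cast [hn]
  ring

theorem IsPath.ears_disjoint (hn : 4 ≤ n) {w : ℕ → ℤ} (hw : IsPath n w) :
    w 2 + 2 ≤ lastEar n w ∧ lastEar n w + 2 ≤ w 2 + n := by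
  have := hw.nested (j := 2) (k := n - 2) (by omega) (by omega) (by omega)
  unfold lastEar
  push_cast [show 2 ≤ n by omega] at this ⊢
  omega

/-- Any two optimal paths have the same chords. -/
theorem POpt.equiv (h : CircSeq n θ) (hn : 4 ≤ n) {w w' : ℕ → ℤ} (hw : POpt n θ w)
    (hw' : POpt n θ w') : PathEquiv n w w' := by
  by_contra hno
  obtain ⟨a, ha⟩ : ∃ a, a = w 2 % n := ⟨_, rfl⟩
  obtain ⟨b, hb⟩ : ∃ b, b = lastEar n w % n := ⟨_, rfl⟩
  obtain ⟨a', ha'⟩ : ∃ a, a = w' 2 % n := ⟨_, rfl⟩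
  obtain ⟨b', hb'⟩ : ∃ b, b = lastEar n w' % n := ⟨_, rfl⟩
  have bound : ∀ x : ℤ, 0 ≤ x % n ∧ x % n < n := fun x =>
    ⟨Int.emod_nonneg _ (by omega), Int.emod_lt_of_pos _ (by omega)⟩
  have rva : a = lastEar n (pathRev n w) % n := by
    rw [lastEar_rev (by omega), Int.add_mul_emod_self_left, ha]
  have rva' : a' = lastEar n (pathRev n w') % n := by
    rw [lastEar_rev (by omega), Int.add_mul_emod_self_left, ha']
  have d1 : 2 ≤ |b - b'| ∧ |b - b'| + 2 ≤ n := by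
    by_contra hc
    exact hno ⟨w, w', Or.inl rfl, Or.inl rfl, hw.eq_shift_of_last h hn hw' hb hb' hc⟩
  have d2 : 2 ≤ |a - b'| ∧ |a - b'| + 2 ≤ n := by
    by_contra hc
    exact hno ⟨_, w', Or.inr rfl, Or.inl rfl, (hw.rev h).eq_shift_of_last h hn hw' rva hb' hc⟩
  have d3 : 2 ≤ |b - a'| ∧ |b - a'| + 2 ≤ n := by
    by_contra hc
    exact hno ⟨w, _, Or.inl rfl, Or.inr rfl, hw.eq_shift_of_last h hn (hw'.rev h) hb rva' hc⟩
  have d4 : 2 ≤ |a - a'| ∧ |a - a'| + 2 ≤ n := by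
    by_contra hc
    exact hno ⟨_, _, Or.inr rfl, Or.inr rfl,
      (hw.rev h).eq_shift_of_last h hn (hw'.rev h) rva rva' hc⟩
  have ea : earVal θ a = earVal θ (w 2) := by rw [ha, h.earVal_emod]
  have eb : earVal θ b = earVal θ (lastEar n w) := by rw [hb, h.earVal_emod]
  have ea' : earVal θ a' = earVal θ (w' 2) := by rw [ha', h.earVal_emod]
  have eb' : earVal θ b' = earVal θ (lastEar n w') := by rw [hb', h.earVal_emod]
  have hdisj : ∀ w : ℕ → ℤ, IsPath n w →
      2 ≤ |w 2 % n - lastEar n w % n| ∧ |w 2 % n - lastEar n w % n| + 2 ≤ n := by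
    intro w hw
    have e1 := hw.ears_disjoint hn
    have e2 := bound (w 2)
    have e3 := bound (lastEar n w)
    have e4 := Int.emod_add_mul_ediv (w 2) n
    have e5 := Int.emod_add_mul_ediv (lastEar n w) n
    set x := w 2 % n
    set y := lastEar n w % n
    set p := w 2 / n
    set q := lastEar n w / n
    have e6 : q = p ∨ q = p + 1 := by
      have f1 : (n : ℤ) * (q - p) < n * 2 := by linarith
      have f2 : (n : ℤ) * (-1) < n * (q - p) := by linarith
      have f3 := lt_of_mul_lt_mul_left f1 (by omega)
      have f4 := lt_of_mul_lt_mul_left f2 (by omega)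
      omega
    rcases e6 with e6 | e6 <;> rw [e6] at e5
    · rcases abs_cases (x - y) with ⟨f, g⟩ | ⟨f, g⟩ <;> rw [f] <;> constructor <;> linarith
    · rcases abs_cases (x - y) with ⟨f, g⟩ | ⟨f, g⟩ <;> rw [f] <;> constructor <;> linarith
  have d5 := hdisj w hw.1
  have d6 := hdisj w' hw'.1
  rw [← ha, ← hb] at d5
  rw [← ha', ← hb'] at d6
  have ba := bound (w 2)
  have bb := bound (lastEar n w)
  have ba' := bound (w' 2)
  have bb' := bound (lastEar n w')
  rw [← ha] at ba
  rw [← hb] at bb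
  rw [← ha'] at ba'
  rw [← hb'] at bb'
  have hle : ∀ x y : ℤ, 2 ≤ |x - y| ∧ |x - y| + 2 ≤ n →
      min (earVal θ x) (earVal θ y) ≤ min (earVal θ a) (earVal θ b) ∧
      min (earVal θ x) (earVal θ y) ≤ min (earVal θ a') (earVal θ b') := by
    intro x y hxy
    have : x + 2 ≤ y ∧ y + 2 ≤ x + n ∨ y + 2 ≤ x ∧ x + 2 ≤ y + n := by
      rcases abs_cases (x - y) with ⟨f, -⟩ | ⟨f, -⟩ <;> rw [f] at hxy <;> omega
    rw [ea, eb, ea', eb']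
    exact ⟨hw.min_ear_le' h hn this, hw'.min_ear_le' h hn this⟩
  have i1 := (hle a b d5).2
  have i2 := (hle a' b' d6).1
  have i3 := (hle b b' d1).1
  have i4 := (hle a b' d2).1
  have i5 := (hle b a' d3).1
  have i6 := (hle a a' d4).1
  have sym : ∀ {x y : ℤ}, 2 ≤ |x - y| ∧ |x - y| + 2 ≤ n → 2 ≤ |y - x| ∧ |y - x| + 2 ≤ n := by
    intro x y hxy
    rwa [abs_sub_comm]
  have nee : ∀ {x y : ℤ}, 2 ≤ |x - y| ∧ |x - y| + 2 ≤ n → x ≠ y := by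
    rintro x y hxy rfl
    simp at hxy
  have n1 : ¬ (earVal θ a = earVal θ b ∧ earVal θ a = earVal θ a') := fun e =>
    h.not_three_ears hn ba bb ba' bb' d2 d1 d6 (nee d5) (nee d4) (nee d3) e.1 e.2
  have n2 : ¬ (earVal θ a = earVal θ b ∧ earVal θ a = earVal θ b') := fun e =>
    h.not_three_ears hn ba bb bb' ba' d4 d3 (sym d6) (nee d5) (nee d2) (nee d1) e.1 e.2
  have n3 : ¬ (earVal θ a = earVal θ a' ∧ earVal θ a = earVal θ b') := fun e =>
    h.not_three_ears hn ba ba' bb' bb d5 (sym d3) (sym d1) (nee d4) (nee d2) (nee d6) e.1 e.2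
  have n4 : ¬ (earVal θ b = earVal θ a' ∧ earVal θ b = earVal θ b') := fun e =>
    h.not_three_ears hn bb ba' bb' ba (sym d5) (sym d4) (sym d2) (nee d3) (nee d1) (nee d6)
      e.1 e.2
  generalize earVal θ a = A at *
  generalize earVal θ b = B at *
  generalize earVal θ a' = A' at *
  generalize earVal θ b' = B' at *
  have e0 := le_antisymm i1 i2
  rcases le_total A B with l1 | l1 <;> rcases le_total A' B' with l2 | l2 <;>
    simp only [min_eq_left l1, min_eq_right l1, min_eq_left l2, min_eq_right l2] at e0 i3 i4 i5 i6
  · rcases min_le_iff.1 i3 with c | c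
    · exact n1 ⟨by linarith, by linarith⟩
    · exact n3 ⟨by linarith, by linarith⟩
  · rcases min_le_iff.1 i5 with c | c
    · exact n2 ⟨by linarith, by linarith⟩
    · exact n3 ⟨by linarith, by linarith⟩
  · rcases min_le_iff.1 i4 with c | c
    · exact n1 ⟨by linarith, by linarith⟩
    · exact n4 ⟨by linarith, by linarith⟩
  · rcases min_le_iff.1 i6 with c | c
    · exact n2 ⟨by linarith, by linarith⟩
    · exact n4 ⟨by linarith, by linarith⟩

end

section

variable {n : ℕ} {θ : ℤ → ℝ}

/-! ### The greedy rule -/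

/-- All windows of an optimal path strictly between sizes `a` and `b` are at least as large as the
smaller one of any compatible pair of next windows `[x, x + a + 1]` and `[y, y + b - 1]`. -/
theorem POpt.min_le_of_compat (h : CircSeq n θ) {w : ℕ → ℤ} (hw : POpt n θ w) {a b : ℕ}
    (ha : 1 ≤ a) (hab : a + 2 ≤ b) (hb : b + 1 ≤ n) {x y : ℤ} (hx : x = w a ∨ x = w a - 1)
    (hy : y = w b ∨ y = w b + 1) (h1 : y ≤ x) (h2 : x + a + 1 ≤ y + b - 1) {k : ℕ} (hak : a < k)
    (hkb : k < b) :
    min (chordVal θ x (x + a + 1)) (chordVal θ y (y + b - 1)) ≤ pathVal θ w k := by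
  by_contra hlt
  push Not at hlt
  obtain ⟨u, hu, u1, u2, u3⟩ := exists_splice (n := n) (u := Function.update w (a + 1) x)
    (v := Function.update w (b - 1) y) (j := a + 1) (m := b - 1) (by omega)
    (fun k k1 k2 => by
      by_cases e : k = a
      · subst e
        rw [Function.update_self, Function.update_of_ne (by omega)]
        exact hx
      · rw [Function.update_of_ne (by omega), Function.update_of_ne (by omega)]
        exact hw.1 k k1 (by omega))
    (fun k k1 k2 => by
      by_cases e : k = b - 1
      · subst e
        rw [Function.update_self, Function.update_of_ne (by omega),
          show b - 1 + 1 = b by omega]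
        omega
      · rw [Function.update_of_ne (by omega), Function.update_of_ne (by omega)]
        exact hw.1 k (by omega) (by omega))
    (by rw [Function.update_self, Function.update_self]; exact h1)
    (by
      rw [Function.update_self, Function.update_self]
      push_cast [show 1 ≤ b by omega]
      omega)
  rw [Function.update_self, Function.update_self] at u3
  have hmid : ∀ i, a < i → i < b → pathVal θ w k < pathVal θ u i := by
    intro i i1 i2
    obtain ⟨b1, b2, b3, b4⟩ := u3 i (by omega) (by omega)
    refine hlt.trans_le ?_
    have := h.min_le_val b2 b1 b3 b4
    push_cast [show 1 ≤ b by omega] at this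
    rw [show y + ((b : ℤ) - 1) = y + b - 1 by ring,
      show x + ((a : ℤ) + 1) = x + a + 1 by ring] at this
    exact this
  apply hw.2 u hu
  refine better_of_le (t := pathVal θ w k) (k₀ := k) (fun i i1 i2 => ?_) (by omega) (by omega)
    le_rfl (hmid k hak hkb)
  by_cases e1 : i ≤ a
  · right
    unfold pathVal
    rw [u1 i (by omega), Function.update_of_ne (by omega)]
  by_cases e2 : i < b
  · exact Or.inl (hmid i (by omega) e2)
  · right
    unfold pathVal
    rw [u2 i (by omega), Function.update_of_ne (by omega)]

/-- If just three vertices remain between the lower part of an optimal path up to size `a` and its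
upper part from size `a + 3`, then among two ways to fill the gap whose smaller chords are equal
it takes the one with the larger other chord. -/
theorem POpt.false_of_swap {w : ℕ → ℤ} (hw : POpt n θ w) {a : ℕ}
    (ha : 1 ≤ a) (hb : a + 4 ≤ n) {x y : ℤ} (hx : x = w a ∨ x = w a - 1)
    (hxy : y = x ∨ y = x - 1) (hy : y = w (a + 3) ∨ y = w (a + 3) + 1)
    (h1 : pathVal θ w (a + 1) = chordVal θ y (y + a + 2))
    (h2 : pathVal θ w (a + 2) < chordVal θ x (x + a + 1)) : False := by
  obtain ⟨u, hu, u1, u2, u3⟩ := exists_splice (n := n) (u := Function.update w (a + 1) x)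
    (v := Function.update w (a + 2) y) (j := a + 1) (m := a + 2) (by omega)
    (fun k k1 k2 => by
      by_cases e : k = a
      · subst e
        rw [Function.update_self, Function.update_of_ne (by omega)]
        exact hx
      · rw [Function.update_of_ne (by omega), Function.update_of_ne (by omega)]
        exact hw.1 k k1 (by omega))
    (fun k k1 k2 => by
      by_cases e : k = a + 2
      · subst e
        rw [Function.update_self, Function.update_of_ne (by omega),
          show a + 2 + 1 = a + 3 by ring]
        omega
      · rw [Function.update_of_ne (by omega), Function.update_of_ne (by omega)]
        exact hw.1 k (by omega) (by omega))
    (by rw [Function.update_self, Function.update_self]; omega)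
    (by
      rw [Function.update_self, Function.update_self]
      push_cast
      omega)
  have e1 : pathVal θ u (a + 1) = chordVal θ x (x + a + 1) := by
    unfold pathVal
    rw [u1 _ le_rfl, Function.update_self]
    congr 1
    push_cast
    ring
  have e2 : pathVal θ u (a + 2) = chordVal θ y (y + a + 2) := by
    unfold pathVal
    rw [u2 _ le_rfl, Function.update_self]
    congr 1
    push_cast
    ring
  apply hw.2 u hu
  refine better_of_perm (Equiv.swap (a + 1) (a + 2)) (t := pathVal θ w (a + 2)) (k₀ := a + 1)
    (fun k k1 k2 => ?_) (fun k k1 k2 => ?_) (by omega) (by omega) ?_ ?_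
  · rw [Equiv.swap_apply_def]
    split_ifs <;> omega
  · by_cases f1 : k = a + 1
    · left
      rw [f1, e1]
      exact h2
    right
    by_cases f2 : k = a + 2
    · rw [f2, Equiv.swap_apply_right, e2, h1]
    rw [Equiv.swap_apply_of_ne_of_ne f1 f2]
    apply le_of_eq
    unfold pathVal
    by_cases f3 : k ≤ a
    · rw [u1 k (by omega), Function.update_of_ne (by omega)]
    · rw [u2 k (by omega), Function.update_of_ne (by omega)]
  · rw [Equiv.swap_apply_left]
  · rw [e1]
    exact h2

/-- The condition under which the lower window `[l, r]` is extended, rather than the upper window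
`[l', r']` being shrunk: of the four candidates for the next chord, the smallest one is an
extension of the lower window; ties are broken by the siblings of the smallest candidates. -/
def ExtendLower (θ : ℤ → ℝ) (l r l' r' : ℤ) : Prop :=
  min (chordVal θ (l - 1) r) (chordVal θ l (r + 1)) <
      min (chordVal θ (l' + 1) r') (chordVal θ l' (r' - 1)) ∨
    min (chordVal θ (l - 1) r) (chordVal θ l (r + 1)) =
      min (chordVal θ (l' + 1) r') (chordVal θ l' (r' - 1)) ∧
    max (chordVal θ (l' + 1) r') (chordVal θ l' (r' - 1)) ≤
      max (chordVal θ (l - 1) r) (chordVal θ l (r + 1))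

/-- The greedy rule for the lower end: an optimal path avoids the smallest candidate. -/
theorem POpt.lower_step (h : CircSeq n θ) {w : ℕ → ℤ} (hw : POpt n θ w) {a b : ℕ}
    (ha : 1 ≤ a) (hab : a + 2 ≤ b) (hb : b + 1 ≤ n) (hl : w b < w a)
    (hr : w a + a < w b + b) (hc : ExtendLower θ (w a) (w a + a) (w b) (w b + b)) :
    (chordVal θ (w a - 1) (w a + a) ≤ chordVal θ (w a) (w a + a + 1) → w (a + 1) = w a) ∧
    (chordVal θ (w a) (w a + a + 1) ≤ chordVal θ (w a - 1) (w a + a) → w (a + 1) = w a - 1) := by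
  have hstep := hw.1 a ha (by omega)
  have hne : chordVal θ (w a - 1) (w a + a) ≠ chordVal θ (w a) (w a + a + 1) :=
    h.ne _ _ _ _ (by omega) (by omega) (by omega) (by omega)
  have hne' : chordVal θ (w b) (w b + b - 1) ≠ chordVal θ (w b + 1) (w b + b) :=
    h.ne _ _ _ _ (by omega) (by omega) (by omega) (by omega)
  have core := fun (x y : ℤ) hx hy h1 h2 => hw.min_le_of_compat h ha hab hb (x := x) (y := y)
    hx hy h1 h2 (k := a + 1) (by omega) (by omega)
  unfold ExtendLower at hc
  obtain ⟨l, hwl⟩ : ∃ l, w a = l := ⟨_, rfl⟩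
  obtain ⟨m, hwm⟩ : ∃ m, w b = m := ⟨_, rfl⟩
  rw [hwl, hwm] at hl
  simp only [hwl, hwm] at hr hc hstep hne hne' core ⊢
  constructor
  · intro hle
    have hlt := hle.lt_of_ne hne
    by_contra hcon
    have hwa : w (a + 1) = l - 1 := by omega
    have hv : pathVal θ w (a + 1) = chordVal θ (l - 1) (l + a) := by
      unfold pathVal
      rw [hwa]
      congr 1
      push_cast
      ring
    rw [hv] at core
    rw [min_eq_left hle, max_eq_right hle] at hc
    have c1 := core l (m + 1) (by omega) (by omega) (by omega) (by omega)
    rw [show m + 1 + (b : ℤ) - 1 = m + b by ring, min_le_iff] at c1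
    have c2 := c1.resolve_left (by linarith)
    obtain ⟨t1, t2⟩ := hc.resolve_left (by
      have := min_le_left (chordVal θ (m + 1) (m + b)) (chordVal θ m (m + b - 1))
      linarith)
    have t3 : chordVal θ (m + 1) (m + b) = chordVal θ (l - 1) (l + a) := by
      apply le_antisymm c2
      rw [t1]
      exact min_le_left _ _
    have t4 : chordVal θ (m + 1) (m + b) < chordVal θ m (m + b - 1) := by
      apply lt_of_le_of_ne _ hne'.symm
      rw [t3, t1]
      exact min_le_right _ _
    rw [max_eq_right t4.le] at t2
    have hR : m + b = l + a + 1 := by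
      by_contra hR
      have c3 := core l m (by omega) (by omega) (by omega) (by omega)
      rw [min_le_iff] at c3
      rcases c3 with c3 | c3 <;> linarith
    rcases (show l = m + 1 ∨ l = m + 2 ∨ m + 2 < l by omega) with e | e | e
    · rw [hR, e] at t3
      rw [e] at hlt
      linarith
    · -- the only possible tie: the two smallest candidates share an endpoint
      obtain rfl : b = a + 3 := by omega
      have hs2 := hw.1 (a + 1) (by omega) (by omega)
      have hs3 := hw.1 (a + 2) (by omega) (by omega)
      apply hw.false_of_swap ha (by omega) (x := l) (y := m + 1) (by omega) (by omega)
        (by omega)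
      · rw [hv, ← t3]
        congr 1
        push_cast
        ring
      · rw [show a + 1 + 1 = a + 2 by ring, hwa] at hs2
        unfold pathVal
        rcases hs2 with f | f <;> rw [f]
        · have : chordVal θ (l - 1) (l - 1 + (a + 2 : ℕ)) = chordVal θ (m + 1) (m + (a + 3 : ℕ)) := by
            congr 1
            · omega
            · push_cast
              omega
          linarith
        · have e1 : chordVal θ (l - 1 - 1) (l - 1 - 1 + (a + 2 : ℕ)) =
              chordVal θ m (m + (a + 3 : ℕ) - 1) := by
            congr 1
            · omega
            · push_cast
              omega
          rw [e1]
          apply lt_of_le_of_ne t2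
          exact h.ne _ _ _ _ (by omega) (by omega) (by push_cast; omega) (by omega)
    · refine h.disj_ne (i := l - 1) (j := l + a) (k := m + b) (l := m + 1 + n) (by omega)
        (by omega) (by omega) (by omega) ?_
      rw [h.val_compl, t3]
  · intro hle
    have hlt := hle.lt_of_ne hne.symm
    by_contra hcon
    have hwa : w (a + 1) = l := by omega
    have hv : pathVal θ w (a + 1) = chordVal θ l (l + a + 1) := by
      unfold pathVal
      rw [hwa]
      congr 1
      push_cast
      ring
    rw [hv] at core
    rw [min_eq_right hle, max_eq_left hle] at hc
    have c1 := core (l - 1) m (by omega) (by omega) (by omega) (by omega)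
    rw [show l - 1 + (a : ℤ) + 1 = l + a by ring, min_le_iff] at c1
    have c2 := c1.resolve_left (by linarith)
    obtain ⟨t1, t2⟩ := hc.resolve_left (by
      have := min_le_right (chordVal θ (m + 1) (m + b)) (chordVal θ m (m + b - 1))
      linarith)
    have t3 : chordVal θ m (m + b - 1) = chordVal θ l (l + a + 1) := by
      apply le_antisymm c2
      rw [t1]
      exact min_le_right _ _
    have t4 : chordVal θ m (m + b - 1) < chordVal θ (m + 1) (m + b) := by
      apply lt_of_le_of_ne _ hne'
      rw [t3, t1]
      exact min_le_left _ _
    rw [max_eq_left t4.le] at t2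
    have hL : m + 1 = l := by
      by_contra hL
      have c3 := core (l - 1) (m + 1) (by omega) (by omega) (by omega) (by omega)
      rw [show l - 1 + (a : ℤ) + 1 = l + a by ring, show m + 1 + (b : ℤ) - 1 = m + b by ring,
        min_le_iff] at c3
      rcases c3 with c3 | c3 <;> linarith
    rcases (show m + b = l + a + 1 ∨ m + b = l + a + 2 ∨ l + a + 2 < m + b by omega)
      with e | e | e
    · rw [← hL, e] at t3
      rw [← hL] at hlt
      rw [show m + 1 + (a : ℤ) = l + a + 1 - 1 by omega] at hlt
      rw [show m + 1 + (a : ℤ) + 1 = l + a + 1 by omega] at t3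
      rw [show m + 1 - 1 = m by ring, show l + (a : ℤ) + 1 - 1 + 1 = l + a + 1 by ring] at hlt
      linarith
    · obtain rfl : b = a + 3 := by omega
      have hs2 := hw.1 (a + 1) (by omega) (by omega)
      have hs3 := hw.1 (a + 2) (by omega) (by omega)
      apply hw.false_of_swap ha (by omega) (x := l - 1) (y := m) (by omega) (by omega)
        (by omega)
      · rw [hv, ← t3]
        congr 1
        push_cast
        ring
      · rw [show a + 1 + 1 = a + 2 by ring, hwa] at hs2
        rw [show l - 1 + (a : ℤ) + 1 = l + a by ring]
        unfold pathVal
        rcases hs2 with f | f <;> rw [f]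
        · have e1 : chordVal θ l (l + (a + 2 : ℕ)) = chordVal θ (m + 1) (m + (a + 3 : ℕ)) := by
            congr 1
            · omega
            · push_cast
              omega
          rw [e1]
          apply lt_of_le_of_ne t2
          exact (h.ne _ _ _ _ (by omega) (by omega) (by push_cast; omega) (by omega)).symm
        · have e1 : chordVal θ (l - 1) (l - 1 + (a + 2 : ℕ)) =
              chordVal θ m (m + (a + 3 : ℕ) - 1) := by
            congr 1
            · omega
            · push_cast
              omega
          linarith
    · refine h.disj_ne (i := l) (j := l + a + 1) (k := m + b - 1) (l := m + n) (by omega)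
        (by omega) (by omega) (by omega) ?_
      rw [h.val_compl, t3]

/-- The greedy rule for the upper end. -/
theorem POpt.upper_step (h : CircSeq n θ) {w : ℕ → ℤ} (hw : POpt n θ w) {a b : ℕ}
    (ha : 1 ≤ a) (hab : a + 2 ≤ b) (hb : b + 1 ≤ n) (hl : w b < w a)
    (hr : w a + a < w b + b) (hc : ¬ ExtendLower θ (w a) (w a + a) (w b) (w b + b)) :
    (chordVal θ (w b + 1) (w b + b) ≤ chordVal θ (w b) (w b + b - 1) → w (b - 1) = w b) ∧
    (chordVal θ (w b) (w b + b - 1) ≤ chordVal θ (w b + 1) (w b + b) →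
      w (b - 1) = w b + 1) := by
  have e1 : pathRev n w (n - b) = w b + b := by
    unfold pathRev
    rw [show n - (n - b) = b by omega]
  have e2 : pathRev n w (n - a) = w a + a := by
    unfold pathRev
    rw [show n - (n - a) = a by omega]
  have e3 : pathRev n w (n - b + 1) = w (b - 1) + b - 1 := by
    unfold pathRev
    rw [show n - (n - b + 1) = b - 1 by omega]
    push_cast [show 1 ≤ b by omega]
    ring
  have f1 : chordVal θ (w b + b - 1) (w b + n) = chordVal θ (w b) (w b + b - 1) := h.val_compl _ _
  have f2 : chordVal θ (w b + b) (w b + n + 1) = chordVal θ (w b + 1) (w b + b) := by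
    rw [← h.val_compl (w b + 1)]
    congr 1
    ring
  have f3 : chordVal θ (w a + a + 1) (w a + n) = chordVal θ (w a) (w a + a + 1) := h.val_compl _ _
  have f4 : chordVal θ (w a + a) (w a + n - 1) = chordVal θ (w a - 1) (w a + a) := by
    rw [← h.val_compl (w a - 1)]
    congr 1
    ring
  have g1 : w b + b + ((n - b : ℕ) : ℤ) = w b + n := by omega
  have g2 : w a + a + ((n - a : ℕ) : ℤ) = w a + n := by omega
  have := (hw.rev h).lower_step h (a := n - b) (b := n - a) (by omega) (by omega) (by omega)
    (by rw [e1, e2]; omega) (by rw [e1, e2]; omega) (by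
      rw [e1, e2, g1, g2]
      unfold ExtendLower at hc ⊢
      rw [f1, f2, f3, f4]
      rw [min_comm (chordVal θ (w b) (w b + b - 1)), min_comm (chordVal θ (w a) (w a + a + 1)),
        max_comm (chordVal θ (w b) (w b + b - 1)), max_comm (chordVal θ (w a) (w a + a + 1))]
      push Not at hc
      rcases hc.1.lt_or_eq with c | c
      · exact Or.inl c
      · exact Or.inr ⟨c, (hc.2 c.symm).le⟩)
  rw [e1, g1, e3, f1, f2] at this
  constructor
  · intro hle
    have := this.2 hle
    omega
  · intro hle
    have := this.1 hle
    omega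

end

section

/-! ### Chords with endpoints indexed modulo `n` -/

variable {n : ℕ}

theorem emod_ne_of_lt {x y : ℤ} (h1 : x < y) (h2 : y < x + n) : x % n ≠ y % n := by
  intro he
  have e1 := Int.emod_add_mul_ediv x n
  have e2 := Int.emod_add_mul_ediv y n
  have e3 : y - x = n * (y / n - x / n) := by linarith
  have e4 : (n : ℤ) * 0 < n * (y / n - x / n) := by linarith
  have e5 : (n : ℤ) * (y / n - x / n) < n * 1 := by linarith
  have e6 := lt_of_mul_lt_mul_left e4 (by omega)
  have e7 := lt_of_mul_lt_mul_left e5 (by omega)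
  omega

theorem cross_comm {d e : Fin n × Fin n} : Cross d e ↔ Cross e d := Or.comm

variable [NeZero n]

theorem coe_pos_of_neZero (n : ℕ) [NeZero n] : 0 < (n : ℤ) := by
  have := NeZero.ne n
  omega

/-- The vertex with the index `x` modulo `n`. -/
def vtx (n : ℕ) [NeZero n] (x : ℤ) : Fin n :=
  ⟨(x % n).toNat, by
    have := Int.emod_lt_of_pos x (coe_pos_of_neZero n)
    have := Int.emod_nonneg x (coe_pos_of_neZero n).ne'
    omega⟩

/-- The chord between the vertices with the indices `x` and `y` modulo `n`, written with the
smaller vertex first. -/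
def chord (n : ℕ) [NeZero n] (x y : ℤ) : Fin n × Fin n :=
  (min (vtx n x) (vtx n y), max (vtx n x) (vtx n y))

theorem vtx_coe (x : ℤ) : ((vtx n x : ℕ) : ℤ) = x % n := by
  have := Int.emod_nonneg x (coe_pos_of_neZero n).ne'
  simp only [vtx]
  omega

theorem vtx_eq_iff {x y : ℤ} : vtx n x = vtx n y ↔ x % n = y % n := by
  rw [← vtx_coe, ← vtx_coe, Nat.cast_inj, Fin.val_inj]

theorem vtx_shift (x q : ℤ) : vtx n (x + n * q) = vtx n x := by
  rw [vtx_eq_iff, Int.add_mul_emod_self_left]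

theorem vtx_add (x : ℤ) : vtx n (x + n) = vtx n x := by
  rw [vtx_eq_iff, Int.add_emod_right]

theorem vtx_fin (i : Fin n) : vtx n (i : ℕ) = i := by
  apply Fin.ext
  have := vtx_coe (n := n) ((i : ℕ) : ℤ)
  rw [Int.emod_eq_of_lt (by omega) (by omega)] at this
  exact_mod_cast this

theorem vtx_coe_of_lt {x : ℤ} (h0 : 0 ≤ x) (h1 : x < n) : ((vtx n x : ℕ) : ℤ) = x := by
  rw [vtx_coe, Int.emod_eq_of_lt h0 h1]

theorem chord_comm (x y : ℤ) : chord n x y = chord n y x := by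
  unfold chord
  rw [min_comm, max_comm]

theorem chord_shift (x y q : ℤ) : chord n (x + n * q) (y + n * q) = chord n x y := by
  unfold chord
  rw [vtx_shift, vtx_shift]

theorem chord_compl (x y : ℤ) : chord n y (x + n) = chord n x y := by
  rw [chord_comm]
  unfold chord
  rw [vtx_add]

theorem chord_of_lt {x y : ℤ} (h0 : 0 ≤ x) (h1 : x < y) (h2 : y < n) :
    chord n x y = (vtx n x, vtx n y) := by
  have e1 := vtx_coe_of_lt (n := n) h0 (by omega)
  have e2 := vtx_coe_of_lt (n := n) (x := y) (by omega) h2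
  have : vtx n x ≤ vtx n y := by
    rw [Fin.le_def]
    omega
  unfold chord
  rw [min_eq_left this, max_eq_right this]

theorem chord_fin {i j : Fin n} (h : i < j) : chord n (i : ℕ) (j : ℕ) = (i, j) := by
  rw [chord_of_lt (by omega) (by exact_mod_cast h) (by omega), vtx_fin, vtx_fin]

theorem eq_of_chord_eq {x y x' y' : ℤ} (h : chord n x y = chord n x' y') :
    x % n = x' % n ∧ y % n = y' % n ∨ x % n = y' % n ∧ y % n = x' % n := by
  unfold chord at h
  rw [Prod.mk.injEq] at h
  simp only [← vtx_eq_iff]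
  rcases le_total (vtx n x) (vtx n y) with h1 | h1 <;>
  rcases le_total (vtx n x') (vtx n y') with h2 | h2 <;>
  simp only [min_eq_left h1, min_eq_right h1, max_eq_left h1, max_eq_right h1, min_eq_left h2,
    min_eq_right h2, max_eq_left h2, max_eq_right h2] at h <;> tauto

/-- A window is a translate of a pair `x' < y'` of indices below `n`, or of its complement. -/
theorem exists_lift {x y : ℤ} (h1 : x < y) (h2 : y < x + n) :
    ∃ x' y' q : ℤ, 0 ≤ x' ∧ x' < y' ∧ y' < n ∧
      (x = x' + n * q ∧ y = y' + n * q ∨ x = y' + n * q ∧ y = x' + n * q + n) := by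
  have e1 := Int.emod_add_mul_ediv x n
  have e2 := Int.emod_nonneg x (coe_pos_of_neZero n).ne'
  have e3 := Int.emod_lt_of_pos x (coe_pos_of_neZero n)
  set q := x / n
  by_cases h : y - n * q < n
  · exact ⟨x % n, y - n * q, q, e2, by omega, h, Or.inl ⟨by omega, by omega⟩⟩
  · exact ⟨y - n * q - n, x % n, q, by omega, by omega, e3, Or.inr ⟨by omega, by omega⟩⟩

/-- A property of four indices in cyclic order that is invariant under translation and rotation
only has to be checked for indices below `n`. -/
theorem cyclic_induction {P : ℤ → ℤ → ℤ → ℤ → Prop}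
    (h0 : ∀ i j k l : ℤ, 0 ≤ i → i < j → j < k → k < l → l < n → P i j k l)
    (hs : ∀ q i j k l, P i j k l → P (i + n * q) (j + n * q) (k + n * q) (l + n * q))
    (hr : ∀ i j k l, P i j k l → P j k l (i + n)) {i j k l : ℤ}
    (h1 : i < j) (h2 : j < k) (h3 : k < l) (h4 : l < i + n) : P i j k l := by
  have main : ∀ i j k l : ℤ, 0 ≤ i → i < n → i < j → j < k → k < l → l < i + n → P i j k l := by
    intro i j k l hi hi' h1 h2 h3 h4
    by_cases hl : l < n
    · exact h0 i j k l hi h1 h2 h3 hl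
    by_cases hk : k < n
    · have := hr _ _ _ _ (h0 (l - n) i j k (by omega) (by omega) h1 h2 hk)
      rwa [sub_add_cancel] at this
    by_cases hj : j < n
    · have := hr _ _ _ _ (hr _ _ _ _ (h0 (k - n) (l - n) i j (by omega) (by omega) (by omega)
        h1 hj))
      rwa [sub_add_cancel, sub_add_cancel] at this
    · have := hr _ _ _ _ (hr _ _ _ _ (hr _ _ _ _ (h0 (j - n) (k - n) (l - n) i (by omega)
        (by omega) (by omega) (by omega) hi')))
      rwa [sub_add_cancel, sub_add_cancel, sub_add_cancel] at this
  have e1 := Int.emod_add_mul_ediv i n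
  have e2 := Int.emod_nonneg i (coe_pos_of_neZero n).ne'
  have e3 := Int.emod_lt_of_pos i (coe_pos_of_neZero n)
  have := hs (i / n) _ _ _ _ (main (i - n * (i / n)) (j - n * (i / n)) (k - n * (i / n))
    (l - n * (i / n)) (by omega) (by omega) (by omega) (by omega) (by omega) (by omega))
  simpa only [sub_add_cancel] using this

/-- Chords whose endpoints alternate cross. -/
theorem cross_chord {i j k l : ℤ} (h1 : i < j) (h2 : j < k) (h3 : k < l) (h4 : l < i + n) :
    Cross (chord n i k) (chord n j l) := by
  refine cyclic_induction (P := fun i j k l => Cross (chord n i k) (chord n j l)) ?_ ?_ ?_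
    h1 h2 h3 h4
  · intro i j k l h0 h1 h2 h3 h4
    rw [chord_of_lt h0 (by omega) (by omega), chord_of_lt (by omega) (by omega) h4]
    left
    have e1 := vtx_coe_of_lt (n := n) h0 (by omega)
    have e2 := vtx_coe_of_lt (n := n) (x := j) (by omega) (by omega)
    have e3 := vtx_coe_of_lt (n := n) (x := k) (by omega) (by omega)
    have e4 := vtx_coe_of_lt (n := n) (x := l) (by omega) (by omega)
    simp only [Fin.lt_def]
    omega
  · intro q i j k l h
    simpa only [chord_shift] using h
  · intro i j k l h
    rw [chord_compl, cross_comm]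
    exact h

/-- Any chord crossing the chord from `i` to `j` has its endpoints on both sides. -/
theorem exists_of_cross {i j : ℤ} (h1 : i < j) (h2 : j < i + n) {e : Fin n × Fin n}
    (he : Cross (chord n i j) e) :
    ∃ k l, i < k ∧ k < j ∧ j < l ∧ l < i + n ∧ chord n k l = e := by
  obtain ⟨x, y, q, hx, hxy, hy, hd⟩ := exists_lift h1 h2
  have hc : chord n i j = (vtx n x, vtx n y) := by
    rw [← chord_of_lt hx hxy hy, ← chord_shift x y q]
    rcases hd with ⟨rfl, rfl⟩ | ⟨rfl, rfl⟩
    · rfl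
    · rw [chord_compl]
  have ex := vtx_coe_of_lt (n := n) hx (by omega)
  have ey := vtx_coe_of_lt (n := n) (x := y) (by omega) hy
  have hlt : e.1 < e.2 := by
    rcases he with h | h
    · exact h.2.1.trans h.2.2
    · exact h.1.trans h.2.1
  have hce : chord n (e.1 : ℕ) (e.2 : ℕ) = e := chord_fin hlt
  have b1 := e.1.isLt
  have b2 := e.2.isLt
  rw [hc] at he
  unfold Cross at he
  simp only [Fin.lt_def] at he
  generalize hm : (n : ℤ) * q = m at hd
  rcases hd with ⟨rfl, rfl⟩ | ⟨rfl, rfl⟩ <;> rcases he with he | he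
  · refine ⟨(e.1 : ℕ) + m, (e.2 : ℕ) + m, by omega, by omega, by omega, by omega, ?_⟩
    rw [← hm, chord_shift, hce]
  · refine ⟨(e.2 : ℕ) + m, (e.1 : ℕ) + m + n, by omega, by omega, by omega, by omega, ?_⟩
    rw [← hm, chord_compl, chord_shift, hce]
  · refine ⟨(e.2 : ℕ) + m, (e.1 : ℕ) + m + n, by omega, by omega, by omega, by omega, ?_⟩
    rw [← hm, chord_compl, chord_shift, hce]
  · refine ⟨(e.1 : ℕ) + m + n, (e.2 : ℕ) + m + n, by omega, by omega, by omega, by omega, ?_⟩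
    refine Eq.trans ?_ ((chord_shift _ _ (q + 1)).trans hce)
    rw [← hm]
    congr 1 <;> ring

/-- Nested windows have noncrossing chords. -/
theorem not_cross_of_nested {i j k l : ℤ} (hj : j < i + n) (h1 : i ≤ k) (h2 : k < l) (h3 : l ≤ j) :
    ¬ Cross (chord n i j) (chord n k l) := by
  intro hc
  obtain ⟨k', l', a1, a2, a3, a4, a5⟩ := exists_of_cross (by omega) hj hc
  rcases eq_of_chord_eq a5 with ⟨b1, b2⟩ | ⟨b1, b2⟩
  · exact emod_ne_of_lt (n := n) (x := l) (y := l') (by omega) (by omega) b2.symm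
  · exact emod_ne_of_lt (n := n) (x := k) (y := l') (by omega) (by omega) b2.symm

theorem isDiagonal_chord {i j : ℤ} (h1 : i + 2 ≤ j) (h2 : j + 2 ≤ i + n) :
    IsDiagonal (chord n i j) := by
  obtain ⟨x, y, q, hx, hxy, hy, hd⟩ := exists_lift (n := n) (x := i) (y := j) (by omega) (by omega)
  have hc : chord n i j = (vtx n x, vtx n y) := by
    rw [← chord_of_lt hx hxy hy, ← chord_shift x y q]
    rcases hd with ⟨rfl, rfl⟩ | ⟨rfl, rfl⟩
    · rfl
    · rw [chord_compl]
  have ex := vtx_coe_of_lt (n := n) hx (by omega)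
  have ey := vtx_coe_of_lt (n := n) (x := y) (by omega) hy
  rw [hc]
  unfold IsDiagonal IsSide
  simp only [Fin.lt_def]
  omega

theorem exists_of_isDiagonal {d : Fin n × Fin n} (hd : IsDiagonal d) :
    chord n (d.1 : ℕ) (d.2 : ℕ) = d ∧ (d.1 : ℤ) + 2 ≤ (d.2 : ℕ) ∧ ((d.2 : ℕ) : ℤ) + 2 ≤ d.1 + n := by
  obtain ⟨h1, h2⟩ := hd
  refine ⟨chord_fin h1, ?_⟩
  unfold IsSide at h2
  have := d.2.isLt
  rw [Fin.lt_def] at h1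
  omega

end

section

variable {n : ℕ} [NeZero n] {T : Finset (Fin n × Fin n)} {θ : ℤ → ℝ}

/-! ### Triangulations -/

theorem IsTriangulation.false_of_cross (hT : IsTriangulation T) {i j k l : ℤ} (h1 : i < j)
    (h2 : j < k) (h3 : k < l) (h4 : l < i + n) (hik : chord n i k ∈ T) (hjl : chord n j l ∈ T) :
    False :=
  hT.noncrossing _ hik _ hjl (cross_chord h1 h2 h3 h4)

theorem IsTriangulation.mem_of_not_cross (hT : IsTriangulation T) {i j : ℤ} (h1 : i + 2 ≤ j)
    (h2 : j + 2 ≤ i + n)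
    (h : ∀ k l, i < k → k < j → j < l → l < i + n → chord n k l ∉ T) : chord n i j ∈ T := by
  refine hT.maximal _ (isDiagonal_chord h1 h2) fun e he hc => ?_
  obtain ⟨k, l, a1, a2, a3, a4, rfl⟩ := exists_of_cross (by omega) (by omega) hc
  exact h k l a1 a2 a3 a4 he

/-- The chord of the window `[x, y]` is a side of the polygon or a diagonal in `T`. -/
def Joined (T : Finset (Fin n × Fin n)) (x y : ℤ) : Prop :=
  y = x + 1 ∨ y + 1 = x + n ∨ chord n x y ∈ T

/-- Every edge has a triangle on each side. -/
theorem IsTriangulation.exists_apex (hT : IsTriangulation T) {i j : ℤ} (h1 : i + 2 ≤ j)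
    (h2 : j + 1 ≤ i + n) (h : Joined T i j) :
    ∃ z, i < z ∧ z < j ∧ Joined T i z ∧ Joined T z j := by
  obtain ⟨z, ⟨hz1, hz2, hz3⟩, hmax⟩ := Int.exists_greatest_of_bdd
    (P := fun z => i < z ∧ z < j ∧ Joined T i z) ⟨j, fun z hz => hz.2.1.le⟩
    ⟨i + 1, by omega, by omega, Or.inl rfl⟩
  refine ⟨z, hz1, hz2, hz3, ?_⟩
  by_cases e : j = z + 1
  · exact Or.inl e
  refine Or.inr (Or.inr (hT.mem_of_not_cross (by omega) (by omega) fun k l a1 a2 a3 a4 hkl => ?_))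
  rcases lt_trichotomy l (i + n) with hl | hl | hl
  · rcases h with h | h | h
    · omega
    · omega
    · exact hT.false_of_cross (by omega) a2 a3 hl h hkl
  · rw [hl, chord_compl] at hkl
    have := hmax k ⟨by omega, a2, Or.inr (Or.inr hkl)⟩
    omega
  · rcases hz3 with h | h | h
    · omega
    · omega
    · refine hT.false_of_cross (i := i) (j := l - n) (k := z) (l := k) (by omega) (by omega) a1
        (by omega) h ?_
      rw [← chord_compl, sub_add_cancel]
      exact hkl

/-- On each side of an edge there is an ear. -/
theorem IsTriangulation.exists_ear (hT : IsTriangulation T) (hn : 4 ≤ n) {i j : ℤ}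
    (h1 : i + 2 ≤ j) (h2 : j + 1 ≤ i + n) (h : Joined T i j) :
    ∃ p, i ≤ p ∧ p + 2 ≤ j ∧ chord n p (p + 2) ∈ T := by
  obtain ⟨m, hm⟩ : ∃ m : ℕ, (m : ℤ) = j - i := ⟨(j - i).toNat, by omega⟩
  induction m using Nat.strong_induction_on generalizing i j with
  | _ m ih =>
    by_cases e : j = i + 2
    · subst e
      refine ⟨i, le_rfl, le_rfl, ?_⟩
      rcases h with h | h | h
      · omega
      · omega
      · exact h
    obtain ⟨z, z1, z2, z3, z4⟩ := hT.exists_apex h1 h2 h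
    by_cases hz : i + 2 ≤ z
    · obtain ⟨p, p1, p2, p3⟩ := ih (z - i).toNat (by omega) hz (by omega) z3 (by omega)
      exact ⟨p, p1, by omega, p3⟩
    · obtain ⟨p, p1, p2, p3⟩ := ih (j - z).toNat (by omega) (by omega) (by omega) z4 (by omega)
      exact ⟨p, by omega, p2, p3⟩

/-- The size of a diagonal. -/
def diagVal (θ : ℤ → ℝ) (d : Fin n × Fin n) : ℝ := chordVal θ (d.1 : ℕ) (d.2 : ℕ)

/-- The number of diagonals of `T` of size at most `s`. -/
def triCount (θ : ℤ → ℝ) (T : Finset (Fin n × Fin n)) (s : ℝ) : ℕ :=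
  (T.filter fun d => diagVal θ d ≤ s).card

/-- A triangulation whose diagonal sizes are lexicographically maximal. -/
def TOpt (θ : ℤ → ℝ) (T : Finset (Fin n × Fin n)) : Prop :=
  IsTriangulation T ∧ ∀ T' : Finset (Fin n × Fin n), IsTriangulation T' → ¬ Better (triCount θ T') (triCount θ T)

/-- The diagonals of a path. -/
def pathDiags (n : ℕ) [NeZero n] (w : ℕ → ℤ) : Finset (Fin n × Fin n) :=
  (Finset.Icc 2 (n - 2)).image fun k => chord n (w k) (w k + k)

theorem CircSeq.diagVal_chord (h : CircSeq n θ) {x y : ℤ} (h1 : x < y) (h2 : y < x + n) :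
    diagVal θ (chord n x y) = chordVal θ x y := by
  obtain ⟨x', y', q, hx, hxy, hy, hd⟩ := exists_lift h1 h2
  have hc : chord n x y = (vtx n x', vtx n y') := by
    rw [← chord_of_lt hx hxy hy, ← chord_shift x' y' q]
    rcases hd with ⟨rfl, rfl⟩ | ⟨rfl, rfl⟩
    · rfl
    · rw [chord_compl]
  unfold diagVal
  rw [hc]
  simp only
  rw [vtx_coe_of_lt hx (by omega), vtx_coe_of_lt (by omega) hy, ← h.val_shift_mul x' y' q]
  rcases hd with ⟨rfl, rfl⟩ | ⟨rfl, rfl⟩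
  · rfl
  · rw [h.val_compl]

theorem IsPath.chord_inj {w : ℕ → ℤ} (hw : IsPath n w) {k k' : ℕ} (hk : 2 ≤ k)
    (hk' : k' + 2 ≤ n) (hlt : k < k') :
    chord n (w k) (w k + k) ≠ chord n (w k') (w k' + k') := by
  intro he
  have := hw.nested (by omega) hlt.le (by omega)
  rcases eq_of_chord_eq he with ⟨a1, a2⟩ | ⟨a1, a2⟩
  · rcases this.1.lt_or_eq with b | b
    · exact emod_ne_of_lt b (by omega) a1.symm
    · exact emod_ne_of_lt (x := w k + k) (y := w k' + k') (by omega) (by omega) a2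
  · exact emod_ne_of_lt (x := w k) (y := w k' + k') (by omega) (by omega) a1

theorem IsPath.injOn_chord {w : ℕ → ℤ} (hw : IsPath n w) :
    Set.InjOn (fun k : ℕ => chord n (w k) (w k + k)) (Finset.Icc 2 (n - 2)) := by
  intro k hk k' hk' he
  simp only [Finset.coe_Icc, Set.mem_Icc] at hk hk'
  rcases lt_trichotomy k k' with e | e | e
  · exact absurd he (hw.chord_inj (by omega) (by omega) e)
  · exact e
  · exact absurd he.symm (hw.chord_inj (by omega) (by omega) e)

theorem IsPath.card_pathDiags {w : ℕ → ℤ} (hw : IsPath n w) : (pathDiags n w).card = n - 3 := by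
  unfold pathDiags
  rw [Finset.card_image_of_injOn hw.injOn_chord, Nat.card_Icc]
  omega

theorem IsPath.triCount_pathDiags (h : CircSeq n θ) {w : ℕ → ℤ} (hw : IsPath n w) :
    triCount θ (pathDiags n w) = pathCount n θ w := by
  funext s
  unfold triCount pathCount pathDiags
  rw [Finset.filter_image, Finset.card_image_of_injOn]
  · congr 1
    apply Finset.filter_congr
    intro k hk
    rw [Finset.mem_Icc] at hk
    rw [h.diagVal_chord (by omega) (by omega)]
    rfl
  · apply hw.injOn_chord.mono
    intro k hk
    simp only [Finset.coe_filter, Set.mem_ofPred_eq] at hk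
    exact hk.1

/-- The diagonals of a path form a triangulation. -/
theorem IsPath.isTriangulation {w : ℕ → ℤ} (hw : IsPath n w) (hn : 3 ≤ n) :
    IsTriangulation (pathDiags n w) := by
  constructor
  · intro d hd
    simp only [pathDiags, Finset.mem_image, Finset.mem_Icc] at hd
    obtain ⟨k, hk, rfl⟩ := hd
    exact isDiagonal_chord (by omega) (by omega)
  · intro d hd e he
    simp only [pathDiags, Finset.mem_image, Finset.mem_Icc] at hd he
    obtain ⟨k, hk, rfl⟩ := hd
    obtain ⟨k', hk', rfl⟩ := he
    rcases le_total k k' with hle | hle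
    · have := hw.nested (by omega) hle (by omega)
      rw [cross_comm]
      exact not_cross_of_nested (by omega) (by omega) (by omega) (by omega)
    · have := hw.nested (by omega) hle (by omega)
      exact not_cross_of_nested (by omega) (by omega) (by omega) (by omega)
  · intro d hd hnc
    -- a window with the chord `d` that contains the first window of the path
    obtain ⟨i, j, hd', h1, h2, h3, h4⟩ : ∃ i j : ℤ, chord n i j = d ∧ i + 2 ≤ j ∧ j + 2 ≤ i + n ∧
        i ≤ w 1 ∧ w 1 + 1 ≤ j := by
      obtain ⟨b1, b2, b3⟩ := exists_of_isDiagonal hd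
      have e1 := Int.emod_add_mul_ediv (w 1 - d.1) n
      have e2 := Int.emod_nonneg (w 1 - d.1) (coe_pos_of_neZero n).ne'
      have e3 := Int.emod_lt_of_pos (w 1 - d.1) (coe_pos_of_neZero n)
      set q := (w 1 - d.1) / n
      set r := (w 1 - d.1) % n
      by_cases hr : w 1 + 1 ≤ (d.2 : ℕ) + n * q
      · exact ⟨(d.1 : ℕ) + n * q, (d.2 : ℕ) + n * q, by rw [chord_shift, b1], by omega, by omega,
          by omega, hr⟩
      · exact ⟨(d.2 : ℕ) + n * q, (d.1 : ℕ) + n * q + n, by rw [chord_compl, chord_shift, b1],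
          by omega, by omega, by omega, by omega⟩
    classical
    set P : ℕ → Prop := fun k => 1 ≤ k ∧ i ≤ w k ∧ w k + k ≤ j with hP
    set m := Nat.findGreatest P (n - 1) with hm
    have hPm : P m := Nat.findGreatest_spec (P := P) (m := 1) (by omega) ⟨le_rfl, h3, by simpa using h4⟩
    have hmn : m ≤ n - 1 := Nat.findGreatest_le _
    have hnext : ∀ k, m < k → k ≤ n - 1 → ¬ P k := fun k a b => Nat.findGreatest_is_greatest a b
    obtain ⟨c1, c2, c3⟩ := hPm
    have hm2 : m + 2 ≤ n := by omega
    have hn1 := hnext (m + 1) (by omega) (by omega)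
    have hstep := hw m c1 hm2
    have hcr : ∀ k, 2 ≤ k → k + 2 ≤ n → ¬ Cross d (chord n (w k) (w k + k)) := by
      intro k k1 k2
      apply hnc
      simp only [pathDiags, Finset.mem_image, Finset.mem_Icc]
      exact ⟨k, by omega, rfl⟩
    by_cases hfull : w m = i ∧ w m + m = j
    · rw [← hd', pathDiags, Finset.mem_image]
      refine ⟨m, ?_, ?_⟩
      · rw [Finset.mem_Icc]
        omega
      · rw [hfull.2, hfull.1]
    · exfalso
      have hn1' : ¬ (i ≤ w (m + 1) ∧ w (m + 1) + (m + 1) ≤ j) := by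
        rintro ⟨f1, f2⟩
        exact hn1 ⟨by omega, f1, by push_cast; exact f2⟩
      have hcr' := hcr (m + 1) (by omega) (by omega)
      rw [← hd'] at hcr'
      rcases hstep with hs | hs
      · apply hcr'
        apply cross_chord <;> push_cast <;> omega
      · apply hcr'
        rw [cross_comm]
        apply cross_chord <;> push_cast <;> omega

/-- A triangulation with three ears is beaten by a path between its two largest ears. -/
theorem TOpt.false_of_three_ears (h : CircSeq n θ) (hT : TOpt θ T) (hn : 4 ≤ n) {p q s : ℤ}
    (h1 : p + 2 ≤ q) (h2 : q + 2 ≤ s) (h3 : s + 2 ≤ p + n) (hp : chord n p (p + 2) ∈ T)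
    (hq : chord n q (q + 2) ∈ T) (hs : chord n s (s + 2) ∈ T) : False := by
  -- by rotation, the ear at `s` may be assumed to be the smallest one
  have main : ∀ p q s : ℤ, p + 2 ≤ q → q + 2 ≤ s → s + 2 ≤ p + n → chord n p (p + 2) ∈ T →
      chord n q (q + 2) ∈ T → chord n s (s + 2) ∈ T → earVal θ s ≤ earVal θ p →
      earVal θ s ≤ earVal θ q → False := by
    intro p q s h1 h2 h3 hp hq hs le1 le2
    obtain ⟨w, hw, w1, w2, w3, w4, w5⟩ := h.exists_path h1 (show q + 2 ≤ p + n by omega)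
    apply hT.2 _ (hw.isTriangulation (by omega))
    have hval : ∀ d ∈ pathDiags n w, d = chord n p (p + 2) ∨ d = chord n q (q + 2) ∨
        earVal θ s < diagVal θ d := by
      intro d hd
      simp only [pathDiags, Finset.mem_image, Finset.mem_Icc] at hd
      obtain ⟨k, hk, rfl⟩ := hd
      by_cases e1 : k = 2
      · left
        rw [e1, w2]
        rfl
      by_cases e2 : k = n - 2
      · right; left
        rw [e2, w3, ← chord_compl q]
        have e3 : q + 2 - (n : ℤ) + n = q + 2 := by ring
        have e4 : q + 2 - (n : ℤ) + ((n - 2 : ℕ) : ℤ) + n = q + n := by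
          push_cast [show 2 ≤ n by omega]
          ring
        rw [← chord_shift (q + 2 - (n : ℤ)) _ 1, mul_one, e3, e4]
      · right; right
        rw [h.diagVal_chord (by omega) (by omega)]
        exact (le_min le1 le2).trans_lt (w5 k (by omega) (by omega))
    have vp : diagVal θ (chord n p (p + 2)) = earVal θ p := h.diagVal_chord (by omega) (by omega)
    have vq : diagVal θ (chord n q (q + 2)) = earVal θ q := h.diagVal_chord (by omega) (by omega)
    have vs : diagVal θ (chord n s (s + 2)) = earVal θ s := h.diagVal_chord (by omega) (by omega)
    have hsnot : ∀ x : ℤ, x + 2 ≤ s → s + 2 ≤ x + n → x + 4 ≤ s ∨ s + 4 ≤ x + n →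
         chord n s (s + 2) ≠ chord n x (x + 2) := by
      intro x x1 x2 x3 he
      rcases eq_of_chord_eq he with ⟨a1, a2⟩ | ⟨a1, a2⟩
      · exact emod_ne_of_lt (x := x) (y := s) (by omega) (by omega) a1.symm
      · rcases x3 with x3 | x3
        · exact emod_ne_of_lt (x := x + 2) (y := s) (by omega) (by omega) a1.symm
        · exact emod_ne_of_lt (x := x) (y := s + 2) (by omega) (by omega) a2.symm
    refine ⟨earVal θ s, ?_, fun t ht => ?_⟩
    · unfold triCount
      apply Finset.card_lt_card
      refine ⟨fun d hd => ?_, fun hsub => ?_⟩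
      · rw [Finset.mem_filter] at hd ⊢
        refine ⟨?_, hd.2⟩
        rcases hval d hd.1 with rfl | rfl | hlt
        · exact hp
        · exact hq
        · linarith [hd.2]
      · have := hsub (Finset.mem_filter.2 ⟨hs, vs.le⟩)
        rw [Finset.mem_filter] at this
        rcases hval _ this.1 with he | he | hlt
        · exact hsnot p (by omega) (by omega) (by omega) he
        · exact hsnot q (by omega) (by omega) (by omega) he
        · linarith
    · unfold triCount
      rw [Finset.filter_false_of_mem]
      · simp
      · intro d hd hle
        rcases hval d hd with rfl | rfl | hlt <;> linarith
  have r1 : ∀ x : ℤ, chord n (x + n) (x + n + 2) = chord n x (x + 2) := by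
    intro x
    rw [← chord_shift x _ 1]
    congr 1 <;> ring
  have r2 : ∀ x : ℤ, earVal θ (x + n) = earVal θ x := by
    intro x
    have := h.earVal_shift x 1
    rwa [mul_one] at this
  by_cases c1 : earVal θ s ≤ earVal θ p ∧ earVal θ s ≤ earVal θ q
  · exact main p q s h1 h2 h3 hp hq hs c1.1 c1.2
  by_cases c2 : earVal θ p ≤ earVal θ q
  · exact main q s (p + n) h2 (by omega) (by omega) hq hs (by rwa [r1]) (by rwa [r2])
      (by
        rw [r2]
        by_contra c3
        exact c1 ⟨by linarith, by linarith⟩)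
  · exact main s (p + n) (q + n) (by omega) (by omega) (by omega) hs (by rwa [r1]) (by rwa [r1])
      (by
        rw [r2]
        by_contra c3
        exact c1 ⟨by linarith, by linarith⟩) (by rw [r2, r2]; linarith)

end

section

variable {n : ℕ} [NeZero n] {T : Finset (Fin n × Fin n)} {θ : ℤ → ℝ}

/-- An optimal triangulation has exactly two ears. -/
theorem TOpt.exists_two_ears (h : CircSeq n θ) (hT : TOpt θ T) (hn : 4 ≤ n) :
    ∃ p q : ℤ, p + 2 ≤ q ∧ q + 2 ≤ p + n ∧ chord n p (p + 2) ∈ T ∧ chord n q (q + 2) ∈ T ∧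
      ∀ x, chord n x (x + 2) ∈ T → x % n = p % n ∨ x % n = q % n := by
  obtain ⟨p, -, p2, p3⟩ := hT.1.exists_ear hn (i := 0) (j := n - 1) (by omega) (by omega)
    (Or.inr (Or.inl (by ring)))
  obtain ⟨q, q1, q2, q3⟩ := hT.1.exists_ear hn (i := p + 2) (j := p + n) (by omega) (by omega)
    (Or.inr (Or.inr (by rw [chord_compl]; exact p3)))
  refine ⟨p, q, q1, q2, p3, q3, fun x hx => ?_⟩
  by_contra hno
  push Not at hno
  obtain ⟨y, y1, y2, y3⟩ : ∃ y : ℤ, y % n = x % n ∧ p ≤ y ∧ y < p + n := by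
    have e1 := Int.emod_add_mul_ediv (x - p) n
    have e2 := Int.emod_nonneg (x - p) (coe_pos_of_neZero n).ne'
    have e3 := Int.emod_lt_of_pos (x - p) (coe_pos_of_neZero n)
    refine ⟨x - n * ((x - p) / n), ?_, by omega, by omega⟩
    rw [sub_eq_add_neg, ← mul_neg, Int.add_mul_emod_self_left]
  have hy : chord n y (y + 2) ∈ T := by
    have : chord n y (y + 2) = chord n x (x + 2) := by
      unfold chord
      rw [vtx_eq_iff.2 y1, vtx_eq_iff.2 (show (y + 2) % n = (x + 2) % n by
        rw [Int.add_emod, y1, ← Int.add_emod])]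
    rwa [this]
  rw [← y1] at hno
  have n1 : y ≠ p := fun e => hno.1 (by rw [e])
  have n2 : y ≠ q := fun e => hno.2 (by rw [e])
  have n3 : y ≠ p + 1 := by
    rintro rfl
    exact hT.1.false_of_cross (i := p) (j := p + 1) (k := p + 2) (l := p + 1 + 2) (by omega)
      (by omega) (by omega) (by omega) p3 hy
  have n4 : y ≠ q + 1 := by
    rintro rfl
    exact hT.1.false_of_cross (i := q) (j := q + 1) (k := q + 2) (l := q + 1 + 2) (by omega)
      (by omega) (by omega) (by omega) q3 hy
  have n5 : y ≠ q - 1 := by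
    rintro rfl
    exact hT.1.false_of_cross (i := q - 1) (j := q) (k := q - 1 + 2) (l := q + 2) (by omega)
      (by omega) (by omega) (by omega) hy q3
  have n6 : y ≠ p + n - 1 := by
    rintro rfl
    refine hT.1.false_of_cross (i := p + n - 1) (j := p + n) (k := p + n - 1 + 2) (l := p + 2 + n)
      (by omega) (by omega) (by omega) (by omega) hy ?_
    have := chord_shift (n := n) p (p + 2) 1
    rw [mul_one] at this
    rwa [this]
  rcases lt_or_gt_of_ne n2 with e | e
  · exact hT.false_of_three_ears h hn (p := p) (q := y) (s := q) (by omega) (by omega) (by omega)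
      p3 hy q3
  · exact hT.false_of_three_ears h hn (p := p) (q := q) (s := y) (by omega) (by omega) (by omega)
      p3 q3 hy

/-- An optimal triangulation is a path: as it has only two ears, it can be followed from one ear
to the other, one triangle at a time. -/
theorem TOpt.exists_eq_pathDiags (h : CircSeq n θ) (hT : TOpt θ T) (hn : 4 ≤ n) :
    ∃ w, POpt n θ w ∧ T = pathDiags n w ∧ w 1 = w 2 ∧ w (n - 1) = w (n - 2) - 1 := by
  obtain ⟨p, q, hpq, hqp, hp, hq, hears⟩ := hT.exists_two_ears h hn
  obtain ⟨Inv, hInv⟩ : ∃ Inv : ℕ → ℤ → Prop, ∀ k l, Inv k l ↔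
      chord n l (l + k) ∈ T ∧ q + 2 - n ≤ l ∧ l ≤ p ∧ p + 2 ≤ l + k ∧ l + k ≤ q :=
    ⟨_, fun _ _ => Iff.rfl⟩
  have hstep : ∀ k l, ∃ l', 2 ≤ k → k + 3 ≤ n → Inv k l →
      (l' = l ∨ l' = l - 1) ∧ Inv (k + 1) l' := by
    intro k l
    by_cases hk : 2 ≤ k ∧ k + 3 ≤ n ∧ Inv k l
    swap
    · exact ⟨l, fun a b c => absurd ⟨a, b, c⟩ hk⟩
    obtain ⟨k1, k2, hi⟩ := hk
    obtain ⟨i1, i2, i3, i4, i5⟩ := (hInv _ _).1 hi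
    have hear : ∀ x : ℤ, l + k ≤ x → x + 2 ≤ l + n → chord n x (x + 2) ∈ T → x = q := by
      intro x x1 x2 hx
      rcases hears x hx with e | e
      · exact absurd e.symm (emod_ne_of_lt (by omega) (by omega))
      · rcases lt_trichotomy x q with f | f | f
        · exact absurd e (emod_ne_of_lt (by omega) (by omega))
        · exact f
        · exact absurd e.symm (emod_ne_of_lt (by omega) (by omega))
    obtain ⟨z, z1, z2, z3, z4⟩ := hT.1.exists_apex (i := l + k) (j := l + n) (by omega) (by omega)
      (Or.inr (Or.inr (by rw [chord_compl]; exact i1)))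
    by_cases c1 : z = l + k + 1
    · obtain ⟨x, x1, x2, x3⟩ := hT.1.exists_ear hn (by omega) (by omega) z4
      have := hear x (by omega) x2 x3
      refine ⟨l, fun _ _ _ => ⟨Or.inl rfl, (hInv _ _).2 ⟨?_, i2, i3, by push_cast; omega,
        by push_cast; omega⟩⟩⟩
      rcases z4 with f | f | f
      · omega
      · omega
      · rw [chord_compl, c1] at f
        push_cast
        rwa [← add_assoc]
    by_cases c2 : z = l + n - 1
    · obtain ⟨x, x1, x2, x3⟩ := hT.1.exists_ear hn (by omega) (by omega) z3
      have := hear x x1 (by omega) x3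
      refine ⟨l - 1, fun _ _ _ => ⟨Or.inr rfl, (hInv _ _).2 ⟨?_, by omega, by omega,
        by push_cast; omega, by push_cast; omega⟩⟩⟩
      rcases z3 with f | f | f
      · omega
      · omega
      · rw [c2, show l + (n : ℤ) - 1 = l - 1 + n by ring, chord_compl] at f
        rw [show l - 1 + ((k + 1 : ℕ) : ℤ) = l + k by push_cast; ring]
        exact f
    · obtain ⟨x, x1, x2, x3⟩ := hT.1.exists_ear hn (by omega) (by omega) z3
      obtain ⟨y, y1, y2, y3⟩ := hT.1.exists_ear hn (by omega) (by omega) z4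
      have := hear x x1 (by omega) x3
      have := hear y (by omega) y2 y3
      omega
  choose f hf using hstep
  obtain ⟨g, g0, g1⟩ : ∃ g : ℕ → ℤ, g 0 = p ∧ ∀ j, g (j + 1) = f (j + 2) (g j) :=
    ⟨fun j => Nat.rec p (fun j x => f (j + 2) x) j, rfl, fun _ => rfl⟩
  have hg : ∀ j, j + 4 ≤ n → Inv (j + 2) (g j) := by
    intro j
    induction j with
    | zero =>
      intro _
      rw [hInv, g0]
      exact ⟨hp, by omega, by omega, by push_cast; omega, by push_cast; omega⟩
    | succ j ih =>
      intro hj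
      rw [g1]
      exact (hf (j + 2) (g j) (by omega) (by omega) (ih (by omega))).2
  obtain ⟨w, hw⟩ : ∃ w : ℕ → ℤ, ∀ k, w k =
      if k < 2 then p else if k + 2 ≤ n then g (k - 2) else q + 1 - n := ⟨_, fun _ => rfl⟩
  have w1 : w 1 = p := by rw [hw, if_pos (by omega)]
  have w2 : ∀ j, j + 4 ≤ n → w (j + 2) = g j := by
    intro j hj
    rw [hw, if_neg (by omega), if_pos (by omega), Nat.add_sub_cancel]
  have w3 : w (n - 1) = q + 1 - n := by rw [hw, if_neg (by omega), if_neg (by omega)]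
  have w4 : w (n - 2) = q + 2 - n := by
    have := w2 (n - 4) (by omega)
    rw [show n - 4 + 2 = n - 2 by omega] at this
    rw [this]
    have := (hInv _ _).1 (hg (n - 4) (by omega))
    omega
  have hpath : IsPath n w := by
    intro k k1 k2
    by_cases e1 : k = 1
    · subst e1
      rw [w2 0 (by omega), w1, g0]
      exact Or.inl rfl
    by_cases e2 : k = n - 2
    · subst e2
      rw [show n - 2 + 1 = n - 1 by omega, w3, w4]
      omega
    obtain ⟨j, rfl⟩ : ∃ j, k = j + 2 := ⟨k - 2, by omega⟩
    have := (hf (j + 2) (g j) (by omega) (by omega) (hg j (by omega))).1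
    rw [w2 j (by omega), show j + 2 + 1 = j + 1 + 2 by ring, w2 (j + 1) (by omega), g1]
    exact this
  have hsub : pathDiags n w ⊆ T := by
    intro d hd
    simp only [pathDiags, Finset.mem_image, Finset.mem_Icc] at hd
    obtain ⟨k, hk, rfl⟩ := hd
    obtain ⟨j, rfl⟩ : ∃ j, k = j + 2 := ⟨k - 2, by omega⟩
    rw [w2 j (by omega)]
    exact ((hInv _ _).1 (hg j (by omega))).1
  have heq : T = pathDiags n w := by
    refine Finset.Subset.antisymm (fun d hd => ?_) hsub
    have ht := hpath.isTriangulation (by omega)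
    exact ht.maximal d (hT.1.isDiagonal d hd) fun e he => hT.1.noncrossing d hd e (hsub he)
  refine ⟨w, ⟨hpath, fun w' hw' hb => ?_⟩, heq, ?_, ?_⟩
  · apply hT.2 _ (hw'.isTriangulation (by omega))
    rw [heq, hw'.triCount_pathDiags h, hpath.triCount_pathDiags h]
    exact hb
  · rw [w1, w2 0 (by omega), g0]
  · rw [w3, w4]
    ring

theorem pathDiags_rev (w : ℕ → ℤ) : pathDiags n (pathRev n w) = pathDiags n w := by
  have sub : ∀ u : ℕ → ℤ, pathDiags n (pathRev n u) ⊆ pathDiags n u := by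
    intro u d hd
    simp only [pathDiags, Finset.mem_image, Finset.mem_Icc] at hd ⊢
    obtain ⟨k, hk, rfl⟩ := hd
    refine ⟨n - k, by omega, ?_⟩
    rw [← chord_compl]
    unfold pathRev
    congr 1
    omega
  refine Finset.Subset.antisymm (sub w) ?_
  have := sub (pathRev n w)
  refine subset_trans ?_ this
  intro d hd
  simp only [pathDiags, Finset.mem_image, Finset.mem_Icc] at hd ⊢
  obtain ⟨k, hk, rfl⟩ := hd
  refine ⟨k, hk, ?_⟩
  have e1 : pathRev n (pathRev n w) k = w k + n * 1 := by
    unfold pathRev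
    rw [show n - (n - k) = k by omega]
    omega
  rw [e1, show w k + (n : ℤ) * 1 + k = w k + k + n * 1 by ring, chord_shift]

theorem PathEquiv.pathDiags_eq {w w' : ℕ → ℤ} (h : PathEquiv n w w') :
    pathDiags n w = pathDiags n w' := by
  obtain ⟨v, v', hv, hv', q, hq⟩ := h
  have e1 : pathDiags n v = pathDiags n w := by
    rcases hv with rfl | rfl
    · rfl
    · exact pathDiags_rev w
  have e2 : pathDiags n v' = pathDiags n w' := by
    rcases hv' with rfl | rfl
    · rfl
    · exact pathDiags_rev w'
  rw [← e1, ← e2]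
  unfold pathDiags
  apply Finset.image_congr
  intro k hk
  simp only [Finset.coe_Icc, Set.mem_Icc] at hk
  simp only
  rw [hq k (by omega) (by omega), show v' k + (n : ℤ) * q + k = v' k + k + n * q by ring,
    chord_shift]

/-- All optimal triangulations are equal. -/
theorem TOpt.eq (h : CircSeq n θ) (hn : 4 ≤ n) {T' : Finset (Fin n × Fin n)} (hT : TOpt θ T)
    (hT' : TOpt θ T') : T = T' := by
  obtain ⟨w, hw, rfl, -⟩ := hT.exists_eq_pathDiags h hn
  obtain ⟨w', hw', rfl, -⟩ := hT'.exists_eq_pathDiags h hn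
  exact (hw.equiv h hn hw').pathDiags_eq

end

section

variable {n : ℕ} [NeZero n] {p : Fin n → Plane} {θ : ℤ → ℝ} {r : ℝ}

/-! ### Chord lengths and inscribed angles -/

/-- The points `p` lie on a circle of radius `r`, and `θ` lists their angles, periodically indexed
by the integers. -/
def Inscribed (p : Fin n → Plane) (r : ℝ) (θ : ℤ → ℝ) : Prop :=
  0 < r ∧ ∃ c : Plane, ∀ x : ℤ, p (vtx n x) = c + r • !₂[Real.cos (θ x), Real.sin (θ x)]

/-- The square of the distance of two points. -/
def sqDist (x y : Plane) : ℝ := (x 0 - y 0) * (x 0 - y 0) + (x 1 - y 1) * (x 1 - y 1)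

theorem dist_sq_eq (x y : Plane) : dist x y ^ 2 = sqDist x y := by
  rw [EuclideanSpace.dist_eq, Real.sq_sqrt (Finset.sum_nonneg fun i _ => sq_nonneg _)]
  simp only [Fin.sum_univ_two, Real.dist_eq, sq_abs, sqDist]
  ring

/-- The extension of the angles of the points to a sequence indexed by the integers, which
increases by `2π` with every turn. -/
def periodicLift (φ : Fin n → ℝ) (x : ℤ) : ℝ := φ (vtx n x) + 2 * Real.pi * (x / n : ℤ)

theorem periodicLift_add (φ : Fin n → ℝ) (x : ℤ) :
    periodicLift φ (x + n) = periodicLift φ x + 2 * Real.pi := by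
  have := coe_pos_of_neZero n
  unfold periodicLift
  rw [vtx_add, Int.add_ediv_of_dvd_right (dvd_refl _), Int.ediv_self (by omega)]
  push_cast
  ring

theorem strictMono_periodicLift {φ : Fin n → ℝ} (h : StrictMono φ)
    (h' : ∀ i j, φ j < φ i + 2 * Real.pi) : StrictMono (periodicLift φ) := by
  apply strictMono_int_of_lt_succ
  intro x
  have e0 := coe_pos_of_neZero n
  have e1 := Int.emod_add_mul_ediv x n
  have e2 := Int.emod_nonneg x e0.ne'
  have e3 := Int.emod_lt_of_pos x e0
  set q := x / n with hq
  set s := x % n with hs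
  have hx : periodicLift φ x = φ (vtx n x) + 2 * Real.pi * q := rfl
  have hvx := vtx_coe (n := n) x
  rw [← hs] at hvx
  by_cases hlt : s + 1 < n
  · have hd : (x + 1) / n = q := by
      rw [← e1, show s + n * q + 1 = s + 1 + n * q by ring, Int.add_mul_ediv_left _ _ e0.ne',
        Int.ediv_eq_zero_of_lt (by omega) hlt, zero_add]
    have hm : (x + 1) % n = s + 1 := by
      rw [← e1, show s + n * q + 1 = s + 1 + n * q by ring, Int.add_mul_emod_self_left,
        Int.emod_eq_of_lt (by omega) hlt]
    have hvy := vtx_coe (n := n) (x + 1)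
    rw [hm] at hvy
    have : φ (vtx n x) < φ (vtx n (x + 1)) := h (by rw [Fin.lt_def]; omega)
    rw [hx, periodicLift, hd]
    linarith
  · have hd : (x + 1) / n = q + 1 := by
      rw [← e1, show s + n * q + 1 = n * (q + 1) by linarith [show s + 1 = n by omega],
        Int.mul_ediv_cancel_left _ e0.ne']
    rw [hx, periodicLift, hd]
    push_cast
    linarith [h' (vtx n (x + 1)) (vtx n x)]

theorem Inscribed.sqDist_eq (h : Inscribed p r θ) (x y : ℤ) :
    sqDist (p (vtx n x)) (p (vtx n y)) = 4 * r ^ 2 * Real.sin ((θ y - θ x) / 2) ^ 2 := by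
  obtain ⟨-, c, hc⟩ := h
  have h0 : Real.cos (θ y - θ x) = 1 - 2 * Real.sin ((θ y - θ x) / 2) ^ 2 := by
    have := Real.cos_two_mul ((θ y - θ x) / 2)
    rw [Real.cos_sq', show 2 * ((θ y - θ x) / 2) = θ y - θ x by ring] at this
    linarith
  rw [Real.cos_sub] at h0
  rw [hc, hc]
  unfold sqDist
  simp only [PiLp.add_apply, PiLp.smul_apply, smul_eq_mul, Matrix.cons_val_zero,
    Matrix.cons_val_one]
  linear_combination (-2 * r ^ 2) * h0 + r ^ 2 * Real.sin_sq_add_cos_sq (θ x) +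
    r ^ 2 * Real.sin_sq_add_cos_sq (θ y)

theorem sin_chordVal (x y : ℤ) : Real.sin (chordVal θ x y) = Real.sin ((θ y - θ x) / 2) := by
  unfold chordVal
  rcases min_choice ((θ y - θ x) / 2) (Real.pi - (θ y - θ x) / 2) with h | h
  · rw [h]
  · rw [h, Real.sin_pi_sub]

theorem chordVal_le (x y : ℤ) : chordVal θ x y ≤ Real.pi / 2 := by
  unfold chordVal
  rcases le_total ((θ y - θ x) / 2) (Real.pi / 2) with h | h
  · exact (min_le_left _ _).trans h
  · exact (min_le_right _ _).trans (by linarith)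

/-- Sizes and lengths of chords are in the same order. -/
theorem Inscribed.sqDist_le_iff (h : Inscribed p r θ) {x y x' y' : ℤ}
    (h1 : 0 < chordVal θ x y) (h2 : 0 < chordVal θ x' y') :
    sqDist (p (vtx n x)) (p (vtx n y)) ≤ sqDist (p (vtx n x')) (p (vtx n y')) ↔
      chordVal θ x y ≤ chordVal θ x' y' := by
  have e1 := chordVal_le (θ := θ) x y
  have e2 := chordVal_le (θ := θ) x' y'
  have hr := h.1
  have hpi := Real.pi_pos
  rw [h.sqDist_eq, h.sqDist_eq, ← sin_chordVal, ← sin_chordVal,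
    mul_le_mul_iff_right₀ (by positivity), sq_le_sq₀
      (Real.sin_nonneg_of_nonneg_of_le_pi h1.le (by linarith))
      (Real.sin_nonneg_of_nonneg_of_le_pi h2.le (by linarith)),
    Real.strictMonoOn_sin.le_iff_le ⟨by linarith, e1⟩ ⟨by linarith, e2⟩]

theorem Inscribed.sqDist_pos (h : Inscribed p r θ) {x y : ℤ} (h1 : 0 < chordVal θ x y) :
    0 < sqDist (p (vtx n x)) (p (vtx n y)) := by
  have e1 := chordVal_le (θ := θ) x y
  have hr := h.1
  have := Real.sin_pos_of_pos_of_lt_pi h1 (by linarith [Real.pi_pos])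
  rw [h.sqDist_eq, ← sin_chordVal]
  positivity

theorem exists_circSeq (h : OnCircle p) (h' : NoSymmetricQuadruple p) :
    ∃ r θ, Inscribed p r θ ∧ CircSeq n θ := by
  obtain ⟨c, r, φ, hr, hφ, hφ', hp⟩ := h
  have hins : Inscribed p r (periodicLift φ) := by
    refine ⟨hr, c, fun x => ?_⟩
    rw [hp, periodicLift, show 2 * Real.pi * ((x / n : ℤ) : ℝ) = (x / n : ℤ) * (2 * Real.pi) by ring,
      Real.cos_add_int_mul_two_pi, Real.sin_add_int_mul_two_pi]
  have hmono := strictMono_periodicLift hφ hφ'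
  have hper := periodicLift_add φ
  refine ⟨r, periodicLift φ, hins, hmono, hper, ?_⟩
  have hcompl : ∀ x y : ℤ, chordVal (periodicLift φ) y (x + n) = chordVal (periodicLift φ) x y := by
    intro x y
    unfold chordVal
    rw [hper, min_comm]
    congr 1 <;> ring
  have hshift : ∀ x y q : ℤ,
      chordVal (periodicLift φ) (x + n * q) (y + n * q) = chordVal (periodicLift φ) x y := by
    intro x y q
    have : ∀ x : ℤ, periodicLift φ (x + n * q) = periodicLift φ x + 2 * Real.pi * q := by
      intro x
      have := coe_pos_of_neZero n
      unfold periodicLift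
      rw [vtx_shift, Int.add_mul_ediv_left _ _ (by omega)]
      push_cast
      ring
    unfold chordVal
    rw [this, this]
    congr 1 <;> ring
  intro i j k l h1 h2 h3 h4
  refine cyclic_induction (n := n) (P := fun i j k l =>
    chordVal (periodicLift φ) i k ≠ chordVal (periodicLift φ) j l) ?_ ?_ ?_ h1 h2 h3 h4
  · intro i j k l h0 h1 h2 h3 h4 he
    apply h' (vtx n i) (vtx n j) (vtx n k) (vtx n l)
    · rw [Fin.lt_def, ← Nat.cast_lt (α := ℤ), vtx_coe_of_lt h0 (by omega),
        vtx_coe_of_lt (by omega) (by omega)]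
      exact h1
    · rw [Fin.lt_def, ← Nat.cast_lt (α := ℤ), vtx_coe_of_lt (by omega) (by omega),
        vtx_coe_of_lt (by omega) (by omega)]
      exact h2
    · rw [Fin.lt_def, ← Nat.cast_lt (α := ℤ), vtx_coe_of_lt (by omega) (by omega),
        vtx_coe_of_lt (by omega) (by omega)]
      exact h3
    · rw [← sq_eq_sq₀ dist_nonneg dist_nonneg, dist_sq_eq, dist_sq_eq, hins.sqDist_eq,
        hins.sqDist_eq, ← sin_chordVal, ← sin_chordVal, he]
  · intro q i j k l hP
    rw [hshift, hshift]
    exact hP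
  · intro i j k l hP
    rw [hcompl]
    exact hP.symm

/-- The inscribed angle theorem, for the angle at the middle one of three points. -/
theorem angle_of_circle (c : Plane) (hr : 0 < r) {x y z : ℝ} (h1 : x < y) (h2 : y < z)
    (h3 : z < x + 2 * Real.pi) :
    EuclideanGeometry.angle (c + r • !₂[Real.cos x, Real.sin x] : Plane)
      (c + r • !₂[Real.cos y, Real.sin y]) (c + r • !₂[Real.cos z, Real.sin z]) =
      Real.pi - (z - x) / 2 := by
  have hu : (c + r • !₂[Real.cos x, Real.sin x] : Plane) - (c + r • !₂[Real.cos y, Real.sin y]) =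
      (2 * r * Real.sin ((y - x) / 2)) • !₂[Real.sin ((x + y) / 2), -Real.cos ((x + y) / 2)] := by
    have e1 := Real.cos_sub_cos x y
    have e2 := Real.sin_sub_sin x y
    rw [show (x - y) / 2 = -((y - x) / 2) by ring, Real.sin_neg] at e1 e2
    ext i
    fin_cases i
    · simp
      linear_combination r * e1
    · simp
      linear_combination r * e2
  have hv : (c + r • !₂[Real.cos z, Real.sin z] : Plane) - (c + r • !₂[Real.cos y, Real.sin y]) =
      (2 * r * Real.sin ((z - y) / 2)) • !₂[-Real.sin ((z + y) / 2), Real.cos ((z + y) / 2)] := by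
    have e1 := Real.cos_sub_cos z y
    have e2 := Real.sin_sub_sin z y
    ext i
    fin_cases i
    · simp
      linear_combination r * e1
    · simp
      linear_combination r * e2
  have s1 : 0 < Real.sin ((y - x) / 2) := Real.sin_pos_of_pos_of_lt_pi (by linarith) (by linarith)
  have s2 : 0 < Real.sin ((z - y) / 2) := Real.sin_pos_of_pos_of_lt_pi (by linarith) (by linarith)
  have hcos : Real.cos (Real.pi - (z - x) / 2) =
      -(Real.sin ((x + y) / 2) * Real.sin ((z + y) / 2) +
        Real.cos ((x + y) / 2) * Real.cos ((z + y) / 2)) := by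
    rw [Real.cos_pi_sub, show (z - x) / 2 = (z + y) / 2 - (x + y) / 2 by ring, Real.cos_sub]
    ring
  rw [EuclideanGeometry.angle, vsub_eq_sub, vsub_eq_sub, hu, hv,
    InnerProductGeometry.angle_smul_left_of_pos _ _ (by positivity),
    InnerProductGeometry.angle_smul_right_of_pos _ _ (by positivity), InnerProductGeometry.angle]
  have n1 : ‖(!₂[Real.sin ((x + y) / 2), -Real.cos ((x + y) / 2)] : Plane)‖ = 1 := by
    rw [EuclideanSpace.norm_eq]
    simp
  have n2 : ‖(!₂[-Real.sin ((z + y) / 2), Real.cos ((z + y) / 2)] : Plane)‖ = 1 := by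
    rw [EuclideanSpace.norm_eq]
    simp
  rw [n1, n2, EuclideanSpace.inner_eq_star_dotProduct]
  have : (-(Real.sin ((x + y) / 2) * Real.sin ((z + y) / 2) +
        Real.cos ((x + y) / 2) * Real.cos ((z + y) / 2))) = Real.cos (Real.pi - (z - x) / 2) :=
    hcos.symm
  rw [← Real.arccos_cos (x := Real.pi - (z - x) / 2) (by linarith) (by linarith), hcos]
  congr 1
  simp [dotProduct, Fin.sum_univ_two]
  ring

end

section

variable {n : ℕ} [NeZero n] {p : Fin n → Plane} {θ : ℤ → ℝ} {r : ℝ} {T : Finset (Fin n × Fin n)}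

/-! ### The angles of a triangulation -/

/-- Half of the arc from the first to the second point of a pair. -/
def halfArc (θ : ℤ → ℝ) (d : Fin n × Fin n) : ℝ := (θ (d.2 : ℕ) - θ (d.1 : ℕ)) / 2

theorem triangleAngles_eq (hp : Inscribed p r θ) (h : CircSeq n θ) {i j k : Fin n} (hij : i < j)
    (hjk : j < k) : triangleAngles (p i) (p j) (p k) =
      {halfArc θ (j, k)} + {halfArc θ (i, j)} + {Real.pi - halfArc θ (i, k)} := by
  obtain ⟨hr, c, hc⟩ := hp
  have e1 : θ (i : ℕ) < θ (j : ℕ) := h.mono (by exact_mod_cast hij)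
  have e2 : θ (j : ℕ) < θ (k : ℕ) := h.mono (by exact_mod_cast hjk)
  have e3 : θ (k : ℕ) < θ (i : ℕ) + 2 * Real.pi := by
    rw [← h.period]
    exact h.mono (by omega)
  have hq : ∀ i : Fin n, p i = c + r • !₂[Real.cos (θ (i : ℕ)), Real.sin (θ (i : ℕ))] := by
    intro i
    rw [← hc, vtx_fin]
  have hq1 : p k = c + r • !₂[Real.cos (θ (k : ℕ) - 2 * Real.pi), Real.sin (θ (k : ℕ) - 2 * Real.pi)] := by
    rw [hq, Real.cos_sub_two_pi, Real.sin_sub_two_pi]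
  have hq2 : p i = c + r • !₂[Real.cos (θ (i : ℕ) + 2 * Real.pi), Real.sin (θ (i : ℕ) + 2 * Real.pi)] := by
    rw [hq, Real.cos_add_two_pi, Real.sin_add_two_pi]
  -- each vertex becomes the middle one of the three after a turn of the first or the last one
  have a1 : EuclideanGeometry.angle (p j) (p i) (p k) = halfArc θ (j, k) := by
    rw [EuclideanGeometry.angle_comm, hq1, hq i, hq j,
      angle_of_circle c hr (by linarith) (by linarith) (by linarith)]
    unfold halfArc
    ring
  have a2 : EuclideanGeometry.angle (p i) (p j) (p k) = Real.pi - halfArc θ (i, k) := by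
    rw [hq i, hq j, hq k, angle_of_circle c hr e1 e2 e3]
    rfl
  have a3 : EuclideanGeometry.angle (p i) (p k) (p j) = halfArc θ (i, j) := by
    rw [EuclideanGeometry.angle_comm, hq2, hq j, hq k,
      angle_of_circle c hr (by linarith) (by linarith) (by linarith)]
    unfold halfArc
    ring
  unfold triangleAngles
  rw [a1, a2, a3]
  simp only [Multiset.insert_eq_cons, ← Multiset.singleton_add]
  abel

theorem isEdge_iff_joined {i j : Fin n} (h : i < j) :
    IsEdge T i j ↔ Joined T (i : ℕ) (j : ℕ) := by
  have := i.isLt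
  have := j.isLt
  unfold IsEdge Joined IsSide
  rw [chord_fin h, or_assoc]
  refine or_congr ⟨fun _ => by omega, fun _ => by omega⟩
    (or_congr ⟨fun _ => by omega, fun _ => by omega⟩ Iff.rfl)

theorem Joined.compl {x y : ℤ} (h : Joined T x y) : Joined T y (x + n) := by
  rcases h with h | h | h
  · exact Or.inr (Or.inl (by omega))
  · exact Or.inl (by omega)
  · exact Or.inr (Or.inr (by rwa [chord_compl]))

theorem joined_sub {x y : ℤ} (h : Joined T (x + n) (y + n)) : Joined T x y := by
  rcases h with h | h | h
  · exact Or.inl (by omega)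
  · exact Or.inr (Or.inl (by omega))
  · exact Or.inr (Or.inr (by rwa [← chord_shift x y 1, mul_one]))

omit [NeZero n] in
theorem IsTriangulation.edges_not_cross (hT : IsTriangulation T) {i j k l : Fin n} (h1 : i < j)
    (h2 : j < k) (h3 : k < l) (hik : IsEdge T i k) (hjl : IsEdge T j l) : False := by
  rcases hik with hik | hik
  · unfold IsSide at hik
    omega
  rcases hjl with hjl | hjl
  · unfold IsSide at hjl
    omega
  exact hT.noncrossing _ hik _ hjl (Or.inl ⟨h1, h2, h3⟩)

/-- The sides of the polygon joining consecutive indices. -/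
def shortSides (n : ℕ) : Finset (Fin n × Fin n) := Finset.univ.filter fun d => d.1.val + 1 = d.2.val

/-- The side joining the first and the last vertex. -/
def lastSide (n : ℕ) [NeZero n] : Fin n × Fin n := (vtx n 0, vtx n (n - 1))

theorem lastSide_val : (lastSide n).1.val = 0 ∧ (lastSide n).2.val + 1 = n := by
  have e0 := coe_pos_of_neZero n
  have e1 := vtx_coe_of_lt (n := n) (x := 0) le_rfl e0
  have e2 := vtx_coe_of_lt (n := n) (x := n - 1) (by omega) (by omega)
  unfold lastSide
  simp only
  omega

theorem eq_lastSide_iff {d : Fin n × Fin n} : d = lastSide n ↔ d.1.val = 0 ∧ d.2.val + 1 = n := by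
  have h := lastSide_val (n := n)
  constructor
  · rintro rfl
    exact h
  · intro hd
    apply Prod.ext <;> apply Fin.ext <;> omega

theorem IsTriangulation.lastSide_notMem (hT : IsTriangulation T) : lastSide n ∉ T := fun h =>
  (hT.isDiagonal _ h).2 (Or.inr lastSide_val)

omit [NeZero n] in
theorem IsTriangulation.disjoint_shortSides (hT : IsTriangulation T) : Disjoint T (shortSides n) := by
  rw [Finset.disjoint_left]
  intro d hd hs
  simp only [shortSides, Finset.mem_filter] at hs
  exact (hT.isDiagonal _ hd).2 (Or.inl hs.2)

omit [NeZero n] in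
theorem mem_triangles {t : Fin n × Fin n × Fin n} : t ∈ triangles T ↔ t.1 < t.2.1 ∧ t.2.1 < t.2.2 ∧
    IsEdge T t.1 t.2.1 ∧ IsEdge T t.2.1 t.2.2 ∧ IsEdge T t.1 t.2.2 := by
  simp [triangles]

/-- Every triangle has one edge with the other vertex between its endpoints; these edges are the
diagonals and the side from the first to the last vertex. -/
theorem IsTriangulation.sum_outer (hT : IsTriangulation T) (hn : 3 ≤ n) {M : Type*}
    [AddCommMonoid M] (f : Fin n × Fin n → M) :
    ∑ t ∈ triangles T, f (t.1, t.2.2) = f (lastSide n) + ∑ d ∈ T, f d := by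
  rw [← Finset.sum_insert hT.lastSide_notMem]
  refine Finset.sum_nbij (fun t => (t.1, t.2.2)) ?_ ?_ ?_ fun _ _ => rfl
  · rintro ⟨i, j, k⟩ ht
    obtain ⟨h1, h2, -, -, h3⟩ := mem_triangles.1 ht
    simp only at h1 h2 h3 ⊢
    rw [Finset.mem_insert, eq_lastSide_iff]
    rcases h3 with h3 | h3
    · unfold IsSide at h3
      left
      simp only
      omega
    · exact Or.inr h3
  · rintro ⟨i, j, k⟩ ht ⟨i', j', k'⟩ ht' he
    obtain ⟨h1, h2, h3, h4, h5⟩ := mem_triangles.1 ht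
    obtain ⟨h1', h2', h3', h4', h5'⟩ := mem_triangles.1 ht'
    simp only [Prod.mk.injEq] at he h1 h2 h3 h4 h5 h1' h2' h3' h4' h5'
    obtain ⟨rfl, rfl⟩ := he
    rcases lt_trichotomy j j' with hj | rfl | hj
    · exact (hT.edges_not_cross h1 hj h2' h3' h4).elim
    · rfl
    · exact (hT.edges_not_cross h1' hj h2 h3 h4').elim
  · rintro ⟨i, k⟩ hd
    rw [Finset.mem_coe, Finset.mem_insert, eq_lastSide_iff] at hd
    simp only at hd
    have hik : (i : ℕ) + 2 ≤ k ∧ IsEdge T i k := by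
      rcases hd with hd | hd
      · exact ⟨by omega, Or.inl (Or.inr hd)⟩
      · have := hT.isDiagonal _ hd
        unfold IsDiagonal IsSide at this
        exact ⟨by simp only at this; omega, Or.inr hd⟩
    have hlt : i < k := by omega
    obtain ⟨z, z1, z2, z3, z4⟩ := hT.exists_apex (i := (i : ℕ)) (j := (k : ℕ)) (by omega)
      (by omega) ((isEdge_iff_joined hlt).1 hik.2)
    have hz := vtx_coe_of_lt (n := n) (x := z) (by omega) (by omega)
    rw [← hz] at z1 z2 z3 z4
    refine ⟨(i, vtx n z, k), Finset.mem_coe.2 (mem_triangles.2 ?_), rfl⟩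
    have l1 : i < vtx n z := by omega
    have l2 : vtx n z < k := by omega
    exact ⟨l1, l2, (isEdge_iff_joined l1).2 z3, (isEdge_iff_joined l2).2 z4, hik.2⟩

/-- The edges of the triangles whose other vertex is not between their endpoints are the diagonals
and the sides joining consecutive indices. -/
theorem IsTriangulation.sum_inner (hT : IsTriangulation T) (hn : 3 ≤ n) {M : Type*}
    [AddCommMonoid M] (f : Fin n × Fin n → M) :
    ∑ t ∈ triangles T, (f (t.2.1, t.2.2) + f (t.1, t.2.1)) =
      ∑ d ∈ shortSides n, f d + ∑ d ∈ T, f d := by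
  classical
  rw [Finset.sum_add_distrib, add_comm (∑ d ∈ shortSides n, f d),
    ← Finset.sum_union hT.disjoint_shortSides]
  have inj1 : Set.InjOn (fun t : Fin n × Fin n × Fin n => (t.2.1, t.2.2)) (triangles T) := by
    rintro ⟨i, j, k⟩ ht ⟨i', j', k'⟩ ht' he
    obtain ⟨h1, h2, h3, h4, h5⟩ := mem_triangles.1 ht
    obtain ⟨h1', h2', h3', h4', h5'⟩ := mem_triangles.1 ht'
    simp only [Prod.mk.injEq] at he h1 h2 h3 h4 h5 h1' h2' h3' h4' h5'
    obtain ⟨rfl, rfl⟩ := he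
    rcases lt_trichotomy i i' with hj | rfl | hj
    · exact (hT.edges_not_cross hj h1' h2 h3 h5').elim
    · rfl
    · exact (hT.edges_not_cross hj h1 h2' h3' h5).elim
  have inj2 : Set.InjOn (fun t : Fin n × Fin n × Fin n => (t.1, t.2.1)) (triangles T) := by
    rintro ⟨i, j, k⟩ ht ⟨i', j', k'⟩ ht' he
    obtain ⟨h1, h2, h3, h4, h5⟩ := mem_triangles.1 ht
    obtain ⟨h1', h2', h3', h4', h5'⟩ := mem_triangles.1 ht'
    simp only [Prod.mk.injEq] at he h1 h2 h3 h4 h5 h1' h2' h3' h4' h5'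
    obtain ⟨rfl, rfl⟩ := he
    rcases lt_trichotomy k k' with hj | rfl | hj
    · exact (hT.edges_not_cross h1 h2 hj h5 h4').elim
    · rfl
    · exact (hT.edges_not_cross h1 h2' hj h5' h4).elim
  rw [← Finset.sum_image (f := f) inj1, ← Finset.sum_image (f := f) inj2, ← Finset.sum_union]
  · apply Finset.sum_congr _ fun _ _ => rfl
    ext ⟨i, j⟩
    simp only [Finset.mem_union, Finset.mem_image, Prod.exists, Prod.mk.injEq, shortSides,
      Finset.mem_filter, Finset.mem_univ, true_and]
    constructor
    · rintro (⟨a, b, c, ht, rfl, rfl⟩ | ⟨a, b, c, ht, rfl, rfl⟩)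
      · obtain ⟨h1, h2, h3, h4, h5⟩ := mem_triangles.1 ht
        rcases h4 with h4 | h4
        · unfold IsSide at h4
          simp only at h1 h2 h4 ⊢
          omega
        · exact Or.inl h4
      · obtain ⟨h1, h2, h3, h4, h5⟩ := mem_triangles.1 ht
        rcases h3 with h3 | h3
        · unfold IsSide at h3
          simp only at h1 h2 h3 ⊢
          omega
        · exact Or.inl h3
    · intro hd
      have hij : i < j ∧ IsEdge T i j ∧ (j : ℕ) + 2 ≤ i + n := by
        rcases hd with hd | hd
        · have := hT.isDiagonal _ hd
          unfold IsDiagonal IsSide at this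
          exact ⟨this.1, Or.inr hd, by simp only at this; omega⟩
        · exact ⟨by omega, Or.inl (Or.inl hd), by omega⟩
      obtain ⟨hlt, he, hn2⟩ := hij
      obtain ⟨z, z1, z2, z3, z4⟩ := hT.exists_apex (i := (j : ℕ)) (j := (i : ℕ) + n) (by omega)
        (by omega) ((isEdge_iff_joined hlt).1 he).compl
      rcases lt_or_ge z n with hz | hz
      · have hv := vtx_coe_of_lt (n := n) (x := z) (by omega) hz
        rw [← hv] at z1 z2 z3 z4
        have l1 : j < vtx n z := by omega
        have l2 : i < vtx n z := by omega
        exact Or.inr ⟨i, j, vtx n z, mem_triangles.2 ⟨hlt, l1, he, (isEdge_iff_joined l1).2 z3,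
          (isEdge_iff_joined l2).2 (joined_sub z4.compl)⟩, rfl, rfl⟩
      · obtain ⟨y, rfl⟩ : ∃ y, z = y + n := ⟨z - n, by ring⟩
        have hv := vtx_coe_of_lt (n := n) (x := y) (by omega) (by omega)
        rw [← hv] at z1 z2 z3 z4
        have l1 : vtx n y < i := by omega
        have l2 : vtx n y < j := by omega
        exact Or.inl ⟨vtx n y, i, j, mem_triangles.2 ⟨l1, hlt,
          (isEdge_iff_joined l1).2 (joined_sub z4), he,
          (isEdge_iff_joined l2).2 (joined_sub z3.compl)⟩, rfl, rfl⟩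
  · rw [Finset.disjoint_left]
    intro d hd hd'
    simp only [Finset.mem_image, Prod.exists] at hd hd'
    obtain ⟨a, b, c, ht, rfl⟩ := hd
    obtain ⟨a', b', c', ht', he⟩ := hd'
    obtain ⟨h1, h2, h3, h4, h5⟩ := mem_triangles.1 ht
    obtain ⟨h1', h2', h3', h4', h5'⟩ := mem_triangles.1 ht'
    simp only [Prod.mk.injEq] at he h1 h2 h3 h4 h5 h1' h2' h3' h4' h5'
    obtain ⟨rfl, rfl⟩ := he
    exact hT.edges_not_cross h1 h1' h2' h5 h5'

omit [NeZero n] in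
theorem card_shortSides (hn : 1 ≤ n) : (shortSides n).card = n - 1 := by
  have hinj : Function.Injective fun i : Fin (n - 1) =>
      ((⟨i, by omega⟩, ⟨i + 1, by omega⟩) : Fin n × Fin n) := by
    intro i j hij
    simp only [Prod.mk.injEq, Fin.mk.injEq] at hij
    omega
  have : shortSides n = Finset.univ.image fun i : Fin (n - 1) =>
      ((⟨i, by omega⟩, ⟨i + 1, by omega⟩) : Fin n × Fin n) := by
    ext ⟨a, b⟩
    simp only [shortSides, Finset.mem_filter, Finset.mem_univ, true_and, Finset.mem_image,
      Prod.mk.injEq]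
    constructor
    · intro h
      exact ⟨⟨a, by omega⟩, rfl, Fin.ext h⟩
    · rintro ⟨i, rfl, rfl⟩
      rfl
  rw [this, Finset.card_image_of_injective _ hinj, Finset.card_univ, Fintype.card_fin]

/-- Counting the edges of the triangles gives the number of diagonals. -/
theorem IsTriangulation.card (hT : IsTriangulation T) (hn : 3 ≤ n) : T.card = n - 3 := by
  have h1 := hT.sum_outer hn fun _ => 1
  have h2 := hT.sum_inner hn fun _ => 1
  have h3 := card_shortSides (n := n) (by omega)
  simp only [Finset.sum_const, smul_eq_mul, mul_one] at h1 h2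
  omega

/-- The angles of a triangulation: each side contributes one angle, which does not depend on the
triangulation, and each diagonal contributes two supplementary ones. -/
theorem IsTriangulation.angles_eq (hp : Inscribed p r θ) (h : CircSeq n θ) (hT : IsTriangulation T)
    (hn : 3 ≤ n) :
    ((triangles T).val.bind fun t => triangleAngles (p t.1) (p t.2.1) (p t.2.2)) =
      ({Real.pi - halfArc θ (lastSide n)} + ∑ d ∈ shortSides n, {halfArc θ d}) +
        ∑ d ∈ T, ({halfArc θ d} + {Real.pi - halfArc θ d} : Multiset ℝ) := by
  have e : ((triangles T).val.bind fun t => triangleAngles (p t.1) (p t.2.1) (p t.2.2)) =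
      ∑ t ∈ triangles T, triangleAngles (p t.1) (p t.2.1) (p t.2.2) := rfl
  rw [e, Finset.sum_congr rfl fun t ht => triangleAngles_eq hp h (mem_triangles.1 ht).1
    (mem_triangles.1 ht).2.1, Finset.sum_add_distrib,
    hT.sum_inner hn fun d => ({halfArc θ d} : Multiset ℝ),
    hT.sum_outer hn fun d => ({Real.pi - halfArc θ d} : Multiset ℝ), Finset.sum_add_distrib]
  abel

end

section

/-! ### Lexicographic order of sorted lists -/

/-- A sorted list is smaller if it has more small entries. -/
theorem lt_of_countP {l l' : List ℝ} (hl : l.Pairwise (· ≤ ·)) (hl' : l'.Pairwise (· ≤ ·))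
    (hlen : l.length = l'.length) {t : ℝ} (ht : l'.countP (· ≤ t) < l.countP (· ≤ t))
    (hs : ∀ s < t, l'.countP (· ≤ s) ≤ l.countP (· ≤ s)) : l < l' := by
  induction l generalizing l' with
  | nil => simp at ht
  | cons a m ih =>
    cases l' with
    | nil => simp at hlen
    | cons b m' =>
      rw [List.pairwise_cons] at hl hl'
      have hzero : ∀ s, ∀ a : ℝ, ∀ m : List ℝ, s < a → (∀ x ∈ m, a ≤ x) →
          (a :: m).countP (· ≤ s) = 0 := by
        intro s a m hsa hm
        rw [List.countP_eq_zero]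
        intro x hx
        rcases List.mem_cons.1 hx with rfl | hx
        · simpa using hsa
        · simpa using hsa.trans_le (hm x hx)
      rw [List.cons_lt_cons_iff]
      rcases lt_trichotomy a b with hab | rfl | hab
      · exact Or.inl hab
      · refine Or.inr ⟨rfl, ih hl.2 hl'.2 (by simpa using hlen) ?_ fun s hst => ?_⟩
        · rw [List.countP_cons, List.countP_cons] at ht
          omega
        · have := hs s hst
          rw [List.countP_cons, List.countP_cons] at this
          omega
      · exfalso
        rcases lt_or_ge b t with hbt | hbt
        · have := hs b hbt
          rw [hzero b a m hab hl.1, List.countP_cons] at this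
          simp at this
        · rw [hzero t a m (by linarith) hl.1] at ht
          omega

variable {n : ℕ} [NeZero n] {p : Fin n → Plane} {θ : ℤ → ℝ} {r : ℝ} {T T' : Finset (Fin n × Fin n)}

omit [NeZero n] in
/-- Of two supplementary angles, at most one is smaller than a right angle. -/
theorem countP_sum_pairs (T : Finset (Fin n × Fin n)) {s : ℝ} (hs : s < Real.pi / 2) :
    (∑ d ∈ T, ({halfArc θ d} + {Real.pi - halfArc θ d} : Multiset ℝ)).countP (· ≤ s) =
      triCount θ T s := by
  have : ∀ d ∈ T, ({halfArc θ d} + {Real.pi - halfArc θ d} : Multiset ℝ).countP (· ≤ s) =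
      if diagVal θ d ≤ s then 1 else 0 := by
    intro d _
    have e : diagVal θ d = min (halfArc θ d) (Real.pi - halfArc θ d) := rfl
    simp only [e, min_le_iff]
    rw [Multiset.countP_add, ← Multiset.cons_zero, ← Multiset.cons_zero,
      Multiset.countP_cons, Multiset.countP_cons, Multiset.countP_zero]
    by_cases h1 : halfArc θ d ≤ s
    · have h2 : ¬ Real.pi - halfArc θ d ≤ s := by linarith
      simp [h1, h2]
    · simp [h1]
  rw [← Multiset.coe_countPAddMonoidHom, map_sum]
  simp only [Multiset.coe_countPAddMonoidHom]
  rw [Finset.sum_congr rfl this, triCount, Finset.card_filter]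

theorem IsTriangulation.countP_angleList (hp : Inscribed p r θ) (h : CircSeq n θ)
    (hT : IsTriangulation T) (hn : 3 ≤ n) {s : ℝ} (hs : s < Real.pi / 2) :
    (angleList p T).countP (· ≤ s) =
      ({Real.pi - halfArc θ (lastSide n)} +
        ∑ d ∈ shortSides n, {halfArc θ d} : Multiset ℝ).countP (· ≤ s) + triCount θ T s := by
  rw [← Multiset.coe_countP, angleList, Multiset.sort_eq, hT.angles_eq hp h hn,
    Multiset.countP_add, countP_sum_pairs _ hs]

theorem IsTriangulation.length_angleList (hp : Inscribed p r θ) (h : CircSeq n θ)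
    (hT : IsTriangulation T) (hT' : IsTriangulation T') (hn : 3 ≤ n) :
    (angleList p T).length = (angleList p T').length := by
  unfold angleList
  rw [Multiset.length_sort, Multiset.length_sort, hT.angles_eq hp h hn, hT'.angles_eq hp h hn]
  simp [hT.card hn, hT'.card hn]

theorem triCount_of_pi_div_two_le (hT : IsTriangulation T) (hn : 3 ≤ n) {s : ℝ}
    (hs : Real.pi / 2 ≤ s) : triCount θ T s = n - 3 := by
  rw [triCount, Finset.filter_true_of_mem, hT.card hn]
  intro d _
  exact (chordVal_le _ _).trans hs

/-- A triangulation with fewer short diagonals has a larger list of angles. -/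
theorem angleList_lt (hp : Inscribed p r θ) (h : CircSeq n θ) (hT : IsTriangulation T)
    (hT' : IsTriangulation T') (hn : 3 ≤ n) (hb : Better (triCount θ T') (triCount θ T)) :
    angleList p T < angleList p T' := by
  obtain ⟨t, ht, hs⟩ := hb
  -- a right angle or more is an upper bound for the sizes of all diagonals
  have htpi : t < Real.pi / 2 := by
    by_contra hge
    rw [triCount_of_pi_div_two_le hT hn (by linarith),
      triCount_of_pi_div_two_le hT' hn (by linarith)] at ht
    exact lt_irrefl _ ht
  refine lt_of_countP (Multiset.pairwise_sort _ _) (Multiset.pairwise_sort _ _)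
    (hT.length_angleList hp h hT' hn) (t := t) ?_ fun s hst => ?_
  · rw [hT.countP_angleList hp h hn htpi, hT'.countP_angleList hp h hn htpi]
    omega
  · rw [hT.countP_angleList hp h hn (hst.trans htpi), hT'.countP_angleList hp h hn (hst.trans htpi)]
    have := hs s hst
    omega

theorem IsMaxMinAngleDelaunay.tOpt (hp : Inscribed p r θ) (h : CircSeq n θ) (hn : 3 ≤ n)
    (hT : IsMaxMinAngleDelaunay p T) : TOpt θ T :=
  ⟨hT.1, fun T' hT' hb => not_le_of_gt (angleList_lt hp h hT.1 hT' hn hb) (hT.2 T' hT')⟩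

theorem exists_isMaxMinAngleDelaunay (hn : 3 ≤ n) (p : Fin n → Plane) :
    ∃ T, IsMaxMinAngleDelaunay p T := by
  classical
  have hne : (Finset.univ.filter fun T : Finset (Fin n × Fin n) => IsTriangulation T).Nonempty := by
    refine ⟨pathDiags n fun _ => 0, ?_⟩
    rw [Finset.mem_filter]
    exact ⟨Finset.mem_univ _, IsPath.isTriangulation (fun k _ _ => Or.inl rfl) hn⟩
  obtain ⟨T, hT, hmax⟩ := Finset.exists_max_image _ (angleList p) hne
  rw [Finset.mem_filter] at hT
  exact ⟨T, hT.2, fun T' hT' => hmax T' (Finset.mem_filter.2 ⟨Finset.mem_univ _, hT'⟩)⟩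

end

section

/-! ### Reasoning about programs -/

/-- A bound for the running time of a program, per unit of `N`, if each of its loops makes at most
`N` iterations and contains no further loops. -/
def Program.rate : Program → ℕ
  | .skip => 1
  | .setNat _ i e => i.cost + e.cost + 1
  | .setReal _ i e => i.cost + e.cost + 1
  | .seq P Q => P.rate + Q.rate
  | .ite b P Q => b.cost + P.rate + Q.rate + 1
  | .while b P => 2 * (b.cost + P.rate + 1)

/-- `P.KeepsNat a` says that `P` contains no assignment to the natural number array `a`. -/
def Program.KeepsNat (a : ℕ) : Program → Prop
  | .skip => True
  | .setNat a' _ _ => a' ≠ a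
  | .setReal _ _ _ => True
  | .seq P Q => P.KeepsNat a ∧ Q.KeepsNat a
  | .ite _ P Q => P.KeepsNat a ∧ Q.KeepsNat a
  | .while _ P => P.KeepsNat a

/-- `P.KeepsReal a` says that `P` contains no assignment to the real array `a`. -/
def Program.KeepsReal (a : ℕ) : Program → Prop
  | .skip => True
  | .setNat _ _ _ => True
  | .setReal a' _ _ => a' ≠ a
  | .seq P Q => P.KeepsReal a ∧ Q.KeepsReal a
  | .ite _ P Q => P.KeepsReal a ∧ Q.KeepsReal a
  | .while _ P => P.KeepsReal a

theorem Exec.nat_eq {P : Program} {s s' : State} {t a : ℕ} (h : Exec P s t s')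
    (ha : P.KeepsNat a) : s'.nat a = s.nat a := by
  induction h with
  | skip | setReal | while_false => rfl
  | setNat s b i e => exact Function.update_of_ne (Ne.symm ha) _ _
  | seq _ _ ih1 ih2 => rw [ih2 ha.2, ih1 ha.1]
  | ite_true _ _ _ ih => exact ih ha.1
  | ite_false _ _ _ ih => exact ih ha.2
  | while_true _ _ _ ih1 ih2 => rw [ih2 ha, ih1 ha]

theorem Exec.real_eq {P : Program} {s s' : State} {t a : ℕ} (h : Exec P s t s')
    (ha : P.KeepsReal a) : s'.real a = s.real a := by
  induction h with
  | skip | setNat | while_false => rfl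
  | setReal s b i e => exact Function.update_of_ne (Ne.symm ha) _ _
  | seq _ _ ih1 ih2 => rw [ih2 ha.2, ih1 ha.1]
  | ite_true _ _ _ ih => exact ih ha.1
  | ite_false _ _ _ ih => exact ih ha.2
  | while_true _ _ _ ih1 ih2 => rw [ih2 ha, ih1 ha]

/-- Total correctness with a time bound: started in the state `s`, the program `P` halts after at
most `P.rate * N` steps, in a state with the property `Q`. -/
def Runs (N : ℕ) (P : Program) (s : State) (Q : State → Prop) : Prop :=
  ∃ t s', Exec P s t s' ∧ t ≤ P.rate * N ∧ Q s'

variable {N : ℕ} {P P' : Program} {s : State} {Q R : State → Prop}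

theorem Runs.mono (h : Runs N P s Q) (hQ : ∀ s', Q s' → R s') : Runs N P s R := by
  obtain ⟨t, s', h1, h2, h3⟩ := h
  exact ⟨t, s', h1, h2, hQ s' h3⟩

/-- Arrays without assignments in the program keep their contents. -/
theorem Runs.frame (h : Runs N P s Q) : Runs N P s fun s' => Q s' ∧
    (∀ a, P.KeepsNat a → s'.nat a = s.nat a) ∧ ∀ a, P.KeepsReal a → s'.real a = s.real a := by
  obtain ⟨t, s', h1, h2, h3⟩ := h
  exact ⟨t, s', h1, h2, h3, fun a => h1.nat_eq, fun a => h1.real_eq⟩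

theorem Runs.seq (h : Runs N P s Q) (h' : ∀ s', Q s' → Runs N P' s' R) :
    Runs N (P.seq P') s R := by
  obtain ⟨t, s', h1, h2, h3⟩ := h
  obtain ⟨t', s'', h1', h2', h3'⟩ := h' s' h3
  refine ⟨_, s'', h1.seq h1', ?_, h3'⟩
  rw [Program.rate, add_mul]
  exact add_le_add h2 h2'

theorem Runs.ite {b : Test} (hN : 1 ≤ N) (h1 : b.Holds s → Runs N P s Q)
    (h2 : ¬ b.Holds s → Runs N P' s Q) : Runs N (.ite b P P') s Q := by
  by_cases hb : b.Holds s
  · obtain ⟨t, s', a1, a2, a3⟩ := h1 hb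
    refine ⟨_, s', .ite_true P' hb a1, ?_, a3⟩
    rw [Program.rate]
    nlinarith [Nat.zero_le (P'.rate * N), Nat.zero_le b.cost]
  · obtain ⟨t, s', a1, a2, a3⟩ := h2 hb
    refine ⟨_, s', .ite_false P hb a1, ?_, a3⟩
    rw [Program.rate]
    nlinarith [Nat.zero_le (P.rate * N), Nat.zero_le b.cost]

/-- The weakest precondition of a program without loops. -/
def Program.wp : Program → (State → Prop) → State → Prop
  | .skip, Q, s => Q s
  | .setNat a i e, Q, s => Q (s.setNat a (i.eval s) (e.eval s))
  | .setReal a i e, Q, s => Q (s.setReal a (i.eval s) (e.eval s))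
  | .seq P P', Q, s => P.wp (P'.wp Q) s
  | .ite b P P', Q, s => (b.Holds s → P.wp Q s) ∧ (¬ b.Holds s → P'.wp Q s)
  | .while _ _, _, _ => False

theorem Program.wp_mono (h : P.wp Q s) (hQ : ∀ s', Q s' → R s') : P.wp R s := by
  induction P generalizing s Q R with
  | skip | setNat | setReal => exact hQ _ h
  | seq P P' ih1 ih2 => exact ih1 h fun s' hs' => ih2 hs' hQ
  | ite b P P' ih1 ih2 => exact ⟨fun hb => ih1 (h.1 hb) hQ, fun hb => ih2 (h.2 hb) hQ⟩
  | _ => exact h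

theorem Runs.of_wp (hN : 1 ≤ N) (h : P.wp Q s) : Runs N P s Q := by
  induction P generalizing s Q with
  | skip => exact ⟨_, _, .skip s, by simpa [Program.rate] using hN, h⟩
  | setNat a i e => exact ⟨_, _, .setNat s a i e, Nat.le_mul_of_pos_right _ hN, h⟩
  | setReal a i e => exact ⟨_, _, .setReal s a i e, Nat.le_mul_of_pos_right _ hN, h⟩
  | seq P P' ih1 ih2 => exact (ih1 h).seq fun s' hs' => ih2 hs'
  | ite b P P' ih1 ih2 => exact .ite hN (fun hb => ih1 (h.1 hb)) fun hb => ih2 (h.2 hb)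
  | _ => exact h.elim

/-- A loop with the invariant `I`, whose first argument counts the remaining iterations. -/
theorem Runs.while {b : Test} {I : ℕ → State → Prop} {k : ℕ} (hk : k ≤ N) (hN : 1 ≤ N)
    (hs : I k s) (h0 : ∀ s, I 0 s → ¬ b.Holds s)
    (hb : ∀ k s, I (k + 1) s → b.Holds s ∧ Runs 1 P s (I k)) : Runs N (.while b P) s (I 0) := by
  have main : ∀ k s, I k s → ∃ t s', Exec (.while b P) s t s' ∧
      t ≤ (k + 1) * (b.cost + P.rate + 1) ∧ I 0 s' := by
    intro k
    induction k with
    | zero =>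
      intro s hs
      exact ⟨_, s, .while_false P (h0 s hs), by nlinarith, hs⟩
    | succ k ih =>
      intro s hs
      obtain ⟨a1, t, s', a2, a3, a4⟩ := hb k s hs
      obtain ⟨t', s'', b1, b2, b3⟩ := ih s' a4
      refine ⟨_, s'', .while_true a1 a2 b1, ?_, b3⟩
      rw [mul_one] at a3
      nlinarith
  obtain ⟨t, s', h1, h2, h3⟩ := main k s hs
  refine ⟨t, s', h1, h2.trans ?_, h3⟩
  rw [Program.rate, mul_assoc, mul_comm _ N, ← mul_assoc]
  exact Nat.mul_le_mul_right _ (by omega)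

@[simp] theorem State.setNat_nat (s : State) (a i v b j : ℕ) :
    (s.setNat a i v).nat b j = if b = a ∧ j = i then v else s.nat b j := by
  simp only [State.setNat, Function.update_apply]
  split_ifs <;> simp_all

@[simp] theorem State.setNat_nat_of_ne (s : State) {a b : ℕ} (h : b ≠ a) (i v : ℕ) :
    (s.setNat a i v).nat b = s.nat b := Function.update_of_ne h _ _

@[simp] theorem State.setReal_real_of_ne (s : State) {a b : ℕ} (h : b ≠ a) (i : ℕ) (v : ℝ) :
    (s.setReal a i v).real b = s.real b := Function.update_of_ne h _ _

@[simp] theorem State.setNat_real (s : State) (a i v : ℕ) : (s.setNat a i v).real = s.real := rfl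

@[simp] theorem State.setReal_nat (s : State) (a i : ℕ) (v : ℝ) :
    (s.setReal a i v).nat = s.nat := rfl

@[simp] theorem State.setReal_real (s : State) (a i : ℕ) (v : ℝ) (b j : ℕ) :
    (s.setReal a i v).real b j = if b = a ∧ j = i then v else s.real b j := by
  simp only [State.setReal, Function.update_apply]
  split_ifs <;> simp_all

/-- The programs of a list, one after the other. -/
def Program.seqList : List Program → Program
  | [] => .skip
  | P :: L => .seq P (Program.seqList L)

/-- If every program of a list preserves `I` and establishes a property which the later ones
preserve, then all these properties hold in the end. -/
theorem Runs.seqList {ι : Type*} {I : State → Prop} {J : ι → State → Prop} {f : ι → Program}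
    (hN : 1 ≤ N) (L : List ι)
    (h : ∀ i, ∀ s, I s → Runs N (f i) s fun s' => I s' ∧ J i s' ∧ ∀ j, J j s → J j s') :
    ∀ s, I s → Runs N (.seqList (L.map f)) s
      fun s' => I s' ∧ (∀ i ∈ L, J i s') ∧ ∀ j, J j s → J j s' := by
  induction L with
  | nil =>
    intro s hs
    exact .of_wp hN ⟨hs, by simp, fun _ => id⟩
  | cons i L ih =>
    intro s hs
    refine (h i s hs).seq fun s' hs' => (ih s' hs'.1).mono fun s'' hs'' => ?_
    refine ⟨hs''.1, fun j hj => ?_, fun j hj => hs''.2.2 j (hs'.2.2 j hj)⟩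
    rcases List.mem_cons.1 hj with rfl | hj
    · exact hs''.2.2 j hs'.2.1
    · exact hs''.2.1 j hj

end

section

variable {n : ℕ} [NeZero n] {p : Fin n → Plane} {s : State}

/-! ### Arithmetic of vertices on the machine

The natural number arrays `0`, `1`, `2` are for input and output, `3` holds the largest ears, `4`
marks them, and `5`, `6` hold the endpoints of the chords of a path. The real arrays `0`, `1` hold
the coordinates, `2` the sizes of the ears, `3` the squared lengths of the chords of a path, `4` the
same in increasing order, and `5` those of the best path so far. Higher arrays hold one variable
each, in cell `0`. -/

/-- The natural number variable that is kept in cell `0` of array `a`. -/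
def natVar (a : ℕ) : NExpr := .get a (.const 0)

/-- The real variable that is kept in cell `0` of array `a`. -/
def realVar (a : ℕ) : RExpr := .get a (.const 0)

/-- Assignment to a natural number variable. -/
def setVar (a : ℕ) (e : NExpr) : Program := .setNat a (.const 0) e

/-- Assignment to a real variable. -/
def setRealVar (a : ℕ) (e : RExpr) : Program := .setReal a (.const 0) e

/-- The condition `e < f`. -/
def Test.lt (e f : NExpr) : Test := .not (.natLE f e)

/-- The condition `e = f`. -/
def Test.eq (e f : NExpr) : Test := .and (.natLE e f) (.natLE f e)

@[simp] theorem natVar_eval (a : ℕ) : (natVar a).eval s = s.nat a 0 := rfl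

@[simp] theorem realVar_eval (a : ℕ) : (realVar a).eval s = s.real a 0 := rfl

@[simp] theorem setVar_wp (a : ℕ) (e : NExpr) (Q : State → Prop) :
    (setVar a e).wp Q s ↔ Q (s.setNat a 0 (e.eval s)) := Iff.rfl

@[simp] theorem setRealVar_wp (a : ℕ) (e : RExpr) (Q : State → Prop) :
    (setRealVar a e).wp Q s ↔ Q (s.setReal a 0 (e.eval s)) := Iff.rfl

@[simp] theorem Test.holds_lt (e f : NExpr) : (Test.lt e f).Holds s ↔ e.eval s < f.eval s :=
  not_le

@[simp] theorem Test.holds_eq (e f : NExpr) : (Test.eq e f).Holds s ↔ e.eval s = f.eval s :=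
  le_antisymm_iff.symm

attribute [simp] NExpr.eval RExpr.eval Test.Holds Program.wp

/-- The state holds the input `p`. -/
def HasInput (p : Fin n → Plane) (s : State) : Prop :=
  s.nat 0 0 = n ∧ ∀ i : Fin n, s.real 0 i = p i 0 ∧ s.real 1 i = p i 1

omit [NeZero n] in
theorem HasInput.congr {s' : State} (h : HasInput p s) (h0 : s'.nat 0 = s.nat 0)
    (h1 : s'.real 0 = s.real 0) (h2 : s'.real 1 = s.real 1) : HasInput p s' := by
  unfold HasInput
  rw [h0, h1, h2]
  exact h

/-- An expression for the square of the distance of the points with the indices `e` and `f`. -/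
def sqDistExpr (e f : NExpr) : RExpr :=
  .add (.mul (.sub (.get 0 e) (.get 0 f)) (.sub (.get 0 e) (.get 0 f)))
    (.mul (.sub (.get 1 e) (.get 1 f)) (.sub (.get 1 e) (.get 1 f)))

theorem HasInput.sqDistExpr_eval (h : HasInput p s) {e f : NExpr} {x y : ℤ}
    (he : e.eval s = vtx n x) (hf : f.eval s = vtx n y) :
    (sqDistExpr e f).eval s = sqDist (p (vtx n x)) (p (vtx n y)) := by
  simp [sqDistExpr, sqDist, he, hf, h.2]

theorem vtx_add_one (x : ℤ) :
    (vtx n (x + 1) : ℕ) = if n ≤ (vtx n x : ℕ) + 1 then 0 else (vtx n x : ℕ) + 1 := by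
  have e0 := coe_pos_of_neZero n
  have e1 := vtx_coe (n := n) x
  have e2 := vtx_coe (n := n) (x + 1)
  have e3 := Int.emod_add_mul_ediv x n
  have e4 := (vtx n x).isLt
  have e5 : (x + 1) % n = ((vtx n x : ℕ) + 1) % n := by
    rw [e1, Int.emod_add_emod]
  split_ifs with h
  · rw [show ((vtx n x : ℕ) : ℤ) + 1 = n by omega, Int.emod_self] at e5
    omega
  · rw [Int.emod_eq_of_lt (a := (vtx n x : ℕ) + 1) (by omega) (by omega)] at e5
    omega

theorem vtx_sub_one (x : ℤ) :
    (vtx n (x - 1) : ℕ) = if (vtx n x : ℕ) ≤ 0 then n - 1 else (vtx n x : ℕ) - 1 := by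
  have h := vtx_add_one (n := n) (x - 1)
  rw [sub_add_cancel] at h
  have := (vtx n (x - 1)).isLt
  split_ifs at h ⊢ <;> omega

/-- The variable `a` becomes the successor of the vertex `b`. -/
def nextVertex (a b : ℕ) : Program :=
  .ite (.natLE (natVar 0) (.succ (natVar b))) (setVar a (.const 0)) (setVar a (.succ (natVar b)))

/-- The variable `a` becomes the predecessor of the vertex `b`. -/
def prevVertex (a b : ℕ) : Program :=
  .ite (.natLE (natVar b) (.const 0)) (setVar a (.pred (natVar 0))) (setVar a (.pred (natVar b)))

theorem wp_nextVertex {a b : ℕ} {x : ℤ} {Q : State → Prop} (h0 : s.nat 0 0 = n)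
    (hb : s.nat b 0 = vtx n x) (hQ : Q (s.setNat a 0 (vtx n (x + 1)))) :
    (nextVertex a b).wp Q s := by
  rw [vtx_add_one] at hQ
  refine ⟨fun h => ?_, fun h => ?_⟩
  · simp only [Test.Holds, NExpr.eval, natVar_eval, h0, hb] at h
    rw [if_pos h] at hQ
    exact hQ
  · simp only [Test.Holds, NExpr.eval, natVar_eval, h0, hb] at h
    rw [if_neg h] at hQ
    simpa [hb] using hQ

theorem wp_prevVertex {a b : ℕ} {x : ℤ} {Q : State → Prop} (h0 : s.nat 0 0 = n)
    (hb : s.nat b 0 = vtx n x) (hQ : Q (s.setNat a 0 (vtx n (x - 1)))) :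
    (prevVertex a b).wp Q s := by
  rw [vtx_sub_one] at hQ
  refine ⟨fun h => ?_, fun h => ?_⟩
  · simp only [Test.Holds, NExpr.eval, natVar_eval, hb] at h
    rw [if_pos h] at hQ
    simpa [h0] using hQ
  · simp only [Test.Holds, NExpr.eval, natVar_eval, hb] at h
    rw [if_neg h] at hQ
    simpa [hb] using hQ

/-! ### Computing the ears -/

/-- The squared length of the diagonal that cuts off the vertex after `i`. -/
def earSq (p : Fin n → Plane) (i : ℕ) : ℝ := sqDist (p (vtx n i)) (p (vtx n (i + 2)))

/-- Store the values `earSq` in the real array `2`. -/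
def earProgram : Program :=
  .seq (setVar 10 (.const 0)) (.while (.lt (natVar 10) (natVar 0))
    (.seq (nextVertex 11 10) (.seq (nextVertex 11 11)
      (.seq (.setReal 2 (natVar 10) (sqDistExpr (natVar 10) (natVar 11)))
        (setVar 10 (.succ (natVar 10)))))))

theorem runs_earProgram (h : HasInput p s) :
    Runs n earProgram s fun s' => ∀ i < n, s'.real 2 i = earSq p i := by
  have hn : 1 ≤ n := NeZero.one_le
  refine Runs.seq (Q := fun s' => HasInput p s' ∧ s'.nat 10 0 = 0) (.of_wp hn ?_) fun s' hs' => ?_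
  · simpa [HasInput] using h
  · refine (Runs.while (k := n) (I := fun k s => HasInput p s ∧ k ≤ n ∧ s.nat 10 0 = n - k ∧
      ∀ i < n - k, s.real 2 i = earSq p i) le_rfl hn ?_ ?_ ?_).mono fun s'' hs'' => ?_
    · simpa using hs'
    · rintro s ⟨h1, -, h2, -⟩
      simp [h1.1, h2]
    · rintro k s ⟨h1, h2, h3, h4⟩
      refine ⟨by simp [h1.1, h3]; omega, .of_wp le_rfl ?_⟩
      have hv : s.nat 10 0 = vtx n (n - k - 1 : ℕ) := by
        have := vtx_coe_of_lt (n := n) (x := (n - k - 1 : ℕ)) (by omega) (by omega)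
        omega
      refine wp_nextVertex h1.1 hv (wp_nextVertex (x := (n - k - 1 : ℕ) + 1) (by simpa using h1.1)
        (by simp) ?_)
      set s₁ := (s.setNat 11 0 (vtx n ((n - k - 1 : ℕ) + 1))).setNat 11 0
        (vtx n ((n - k - 1 : ℕ) + 1 + 1)) with hs₁
      have hi : HasInput p s₁ := by simpa [hs₁, HasInput] using h1
      have he := hi.sqDistExpr_eval (e := natVar 10) (f := natVar 11) (x := (n - k - 1 : ℕ))
        (y := (n - k - 1 : ℕ) + 2) (by simpa [hs₁] using hv) (by simp [hs₁]; congr 2)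
      have h10 : s₁.nat 10 0 = n - k - 1 := by
        simp [hs₁, h3]
        omega
      have h2' : s₁.real 2 = s.real 2 := by simp [hs₁]
      simp only [Program.wp, setVar_wp]
      rw [he]
      refine ⟨by simpa [HasInput] using hi, by omega, by simp [h10]; omega, fun i hi => ?_⟩
      simp only [natVar_eval, h10, State.setNat_real, State.setReal_real]
      by_cases e : i = n - k - 1
      · simp [e, earSq]
      · simp only [e, and_false, if_false, h2']
        exact h4 i (by omega)
    · simpa using hs''.2.2.2

/-- Store the index of the largest ear without a mark in cell `q` of array `3`, and mark it. -/
def topEarProgram (q : ℕ) : Program :=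
  .seq (.seq (setVar 10 (.const 0)) (.seq (setVar 12 (.const 0)) (setRealVar 10 (.const 0))))
    (.seq (.while (.lt (natVar 10) (natVar 0))
      (.seq (.ite (.and (.natLE (.get 4 (natVar 10)) (.const 0))
          (.not (.realLE (.get 2 (natVar 10)) (realVar 10))))
        (.seq (setVar 12 (natVar 10)) (setRealVar 10 (.get 2 (natVar 10)))) .skip)
        (setVar 10 (.succ (natVar 10)))))
    (.seq (.setNat 3 (.const q) (natVar 12)) (.setNat 4 (natVar 12) (.const 1))))

/-- The first `q` cells of array `3` hold the indices of the `q` largest of the values `E i`,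
`i < n`, or all indices if there are less than `q`; these indices are marked in array `4`. -/
def HasTopEars (n q : ℕ) (E : ℕ → ℝ) (s : State) : Prop :=
  (∀ c < q, s.nat 3 c < n) ∧ (∀ i < n, s.nat 4 i ≠ 0 → ∃ c < q, s.nat 3 c = i) ∧
    ∀ i < n, s.nat 4 i = 0 →
      ∃ F : Finset ℕ, F.card = q ∧ ∀ x ∈ F, x < n ∧ s.nat 4 x ≠ 0 ∧ E i ≤ E x

theorem runs_topEarProgram {E : ℕ → ℝ} (hE : ∀ i < n, 0 < E i) {q : ℕ} (h0 : s.nat 0 0 = n)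
    (h2 : ∀ i < n, s.real 2 i = E i) (hq : HasTopEars n q E s) :
    Runs n (topEarProgram q) s fun s' => HasTopEars n (q + 1) E s' := by
  have hn : 1 ≤ n := NeZero.one_le
  -- the variables `12` and `10` hold the largest unmarked ear so far and its value
  have hloop : ∀ s₁ : State, (s₁.nat 0 = s.nat 0 ∧ s₁.nat 3 = s.nat 3 ∧ s₁.nat 4 = s.nat 4 ∧
      s₁.real 2 = s.real 2) → s₁.nat 10 0 = 0 → s₁.nat 12 0 = 0 → s₁.real 10 0 = 0 →
      Runs n (.while (.lt (natVar 10) (natVar 0))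
      (.seq (.ite (.and (.natLE (.get 4 (natVar 10)) (.const 0))
          (.not (.realLE (.get 2 (natVar 10)) (realVar 10))))
        (.seq (setVar 12 (natVar 10)) (setRealVar 10 (.get 2 (natVar 10)))) .skip)
        (setVar 10 (.succ (natVar 10))))) s₁ fun s' =>
        (s'.nat 3 = s.nat 3 ∧ s'.nat 4 = s.nat 4) ∧ s'.nat 12 0 < n ∧
        ((∀ i < n, s.nat 4 i ≠ 0) ∨ (s.nat 4 (s'.nat 12 0) = 0 ∧
          ∀ i < n, s.nat 4 i = 0 → E i ≤ E (s'.nat 12 0))) := by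
    rintro s₁ ⟨f0, f3, f4, f2⟩ g1 g2 g3
    refine (Runs.while (k := n) (I := fun k s' => (s'.nat 0 = s.nat 0 ∧ s'.nat 3 = s.nat 3 ∧
      s'.nat 4 = s.nat 4 ∧ s'.real 2 = s.real 2) ∧ k ≤ n ∧ s'.nat 10 0 = n - k ∧ s'.nat 12 0 < n ∧
      ((s'.real 10 0 = 0 ∧ ∀ i < n - k, s.nat 4 i ≠ 0) ∨ (s'.real 10 0 = E (s'.nat 12 0) ∧
        s.nat 4 (s'.nat 12 0) = 0 ∧ ∀ i < n - k, s.nat 4 i = 0 → E i ≤ E (s'.nat 12 0))))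
      le_rfl hn ?_ ?_ ?_).mono fun s' hs' => ?_
    · exact ⟨⟨f0, f3, f4, f2⟩, le_rfl, by simpa using g1, by omega, Or.inl ⟨g3, by simp⟩⟩
    · rintro s' ⟨⟨h1, -⟩, -, h3, -⟩
      simp [h1, h0, h3]
    · rintro k s' ⟨⟨e0, e3, e4, e2⟩, hk, hi, hb, hm⟩
      refine ⟨by simp [hi, e0, h0]; omega, .of_wp le_rfl ?_⟩
      have hEi := h2 (n - (k + 1)) (by omega)
      have hsucc : ∀ i < n - k, i < n - (k + 1) ∨ i = n - (k + 1) := fun i _ => by omega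
      refine ⟨fun hc => ?_, fun hc => ?_⟩
      · simp only [Test.Holds, NExpr.eval, RExpr.eval, natVar_eval, realVar_eval, hi, e4, e2, hEi,
          not_le, Nat.le_zero] at hc
        refine ⟨by simp [e0, e3, e4, e2], by omega, by simp [hi]; omega,
          by simp [hi]; omega, Or.inr ⟨by simp [hi, e2, hEi], by simp [hi, hc.1], ?_⟩⟩
        intro i hik hu
        suffices E i ≤ E (n - (k + 1)) by simpa [hi] using this
        rcases hsucc i hik with hlt | rfl
        · rcases hm with hm | hm
          · exact absurd hu (hm.2 i hlt)
          · exact (hm.2.2 i hlt hu).trans (hm.1 ▸ hc.2.le)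
        · exact le_rfl
      · simp only [Test.Holds, NExpr.eval, RExpr.eval, natVar_eval, realVar_eval, hi, e4, e2, hEi,
          not_and, not_not, Nat.le_zero] at hc
        refine ⟨by simp [e0, e3, e4, e2], by omega, by simp [hi]; omega, by simpa using hb, ?_⟩
        simp only [State.setNat_real, ne_eq, Nat.reduceEqDiff, not_false_eq_true,
          State.setNat_nat_of_ne]
        rcases hm with hm | hm
        · refine Or.inl ⟨hm.1, fun i hik hu => ?_⟩
          rcases hsucc i hik with hlt | rfl
          · exact hm.2 i hlt hu
          · have := hc hu
            have := hE (n - (k + 1)) (by omega)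
            linarith
        · refine Or.inr ⟨hm.1, hm.2.1, fun i hik hu => ?_⟩
          rcases hsucc i hik with hlt | rfl
          · exact hm.2.2 i hlt hu
          · exact hm.1 ▸ hc hu
    · obtain ⟨⟨-, e3, e4, -⟩, -, -, hb, hm⟩ := hs'
      refine ⟨⟨e3, e4⟩, hb, ?_⟩
      rcases hm with hm | hm
      · exact Or.inl (by simpa using hm.2)
      · exact Or.inr ⟨hm.2.1, by simpa using hm.2.2⟩
  refine Runs.seq (Q := fun s₁ => (s₁.nat 0 = s.nat 0 ∧ s₁.nat 3 = s.nat 3 ∧ s₁.nat 4 = s.nat 4 ∧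
      s₁.real 2 = s.real 2) ∧ s₁.nat 10 0 = 0 ∧ s₁.nat 12 0 = 0 ∧ s₁.real 10 0 = 0)
    (.of_wp hn ?_) fun s₁ hs₁ => Runs.seq (hloop s₁ hs₁.1 hs₁.2.1 hs₁.2.2.1 hs₁.2.2.2)
      fun s₂ hs₂ => .of_wp hn ?_
  · refine ⟨⟨?_, ?_, ?_, ?_⟩, ?_⟩ <;> simp
  · obtain ⟨⟨e3, e4⟩, hb, hm⟩ := hs₂
    obtain ⟨q1, q2, q3⟩ := hq
    set b := s₂.nat 12 0 with hbdef
    have v3 : ∀ c, ((s₂.setNat 3 q b).setNat 4 b 1).nat 3 c = if c = q then b else s.nat 3 c := by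
      intro c
      simp [e3]
    have v4 : ∀ i, ((s₂.setNat 3 q b).setNat 4 b 1).nat 4 i = if i = b then 1 else s.nat 4 i := by
      intro c
      simp [e4]
    have hgoal : HasTopEars n (q + 1) E ((s₂.setNat 3 q b).setNat 4 b 1) := by
      refine ⟨fun c hc => ?_, fun i hi hi' => ?_, fun i hi hi' => ?_⟩
      · rw [v3]
        split_ifs with e
        · exact hb
        · exact q1 c (by omega)
      · rw [v4] at hi'
        by_cases e : i = b
        · exact ⟨q, by omega, by rw [v3, if_pos rfl, e]⟩
        · rw [if_neg e] at hi'
          obtain ⟨c, c1, c2⟩ := q2 i hi hi'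
          exact ⟨c, by omega, by rw [v3, if_neg (by omega), c2]⟩
      · rw [v4] at hi'
        by_cases e : i = b
        · simp [e] at hi'
        rw [if_neg e] at hi'
        rcases hm with hm | hm
        · exact absurd hi' (hm i hi)
        obtain ⟨F, F1, F2⟩ := q3 i hi hi'
        have hbF : b ∉ F := fun h => (F2 b h).2.1 hm.1
        refine ⟨insert b F, by rw [Finset.card_insert_of_notMem hbF, F1], fun x hx => ?_⟩
        rw [v4]
        rcases Finset.mem_insert.1 hx with rfl | hx
        · exact ⟨hb, by simp, hm.2 i hi hi'⟩
        · obtain ⟨x1, x2, x3⟩ := F2 x hx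
          refine ⟨x1, ?_, x3⟩
          split_ifs
          · simp
          · exact x2
    simpa [hbdef] using hgoal

end

section

variable {n : ℕ} {θ : ℤ → ℝ}

/-! ### The greedy construction of a path -/

/-- A path from the side `[x, x + 1]` to the complement of a side, starting at `y`, has been
constructed up to the index `a` and from the index `b` on, and all optimal paths between these
sides agree with it there. -/
structure PartialPath (n : ℕ) (θ : ℤ → ℝ) (x y : ℤ) (w : ℕ → ℤ) (a b : ℕ) : Prop where
  one_le : 1 ≤ a
  lt : a < b
  le : b + 1 ≤ n
  low : ∀ k, 1 ≤ k → k < a → w (k + 1) = w k ∨ w (k + 1) = w k - 1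
  high : ∀ k, b ≤ k → k + 2 ≤ n → w (k + 1) = w k ∨ w (k + 1) = w k - 1
  left : w b ≤ w a
  right : w a + a ≤ w b + b
  first : w 1 = x
  last : w (n - 1) = y
  forced : ∀ w', POpt n θ w' → w' 1 = x → w' (n - 1) = y →
    ∀ k, 1 ≤ k → k + 1 ≤ n → k ≤ a ∨ b ≤ k → w' k = w k

namespace PartialPath

variable {x y : ℤ} {w : ℕ → ℤ} {a b : ℕ}

theorem isPath (hw : PartialPath n θ x y w a b) (hab : b = a + 1) : IsPath n w := by
  intro k h1 h2
  rcases lt_trichotomy k a with hk | rfl | hk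
  · exact hw.low k h1 hk
  · have h3 := hw.left
    have h4 := hw.right
    rw [hab] at h3 h4
    push_cast at h4
    omega
  · exact hw.high k (by omega) h2

theorem start (hn : 3 ≤ n) (h1 : y ≤ x) (h2 : x + 2 ≤ y + n) :
    PartialPath n θ x y (fun k => if k ≤ 1 then x else y) 1 (n - 1) where
  one_le := le_rfl
  lt := by omega
  le := by omega
  low := fun k _ _ => by omega
  high := fun k _ _ => by omega
  left := by rwa [if_neg (by omega), if_pos le_rfl]
  right := by
    rw [if_pos le_rfl, if_neg (by omega)]
    omega
  first := if_pos le_rfl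
  last := if_neg (by omega)
  forced := by
    intro w' _ h1 h2 k k1 k2 k3
    rcases k3 with k3 | k3
    · rw [if_pos k3, ← h1, show k = 1 by omega]
    · rw [if_neg (by omega), ← h2, show k = n - 1 by omega]

/-- Extension of the lower part. -/
theorem extendLow (hw : PartialPath n θ x y w a b) (hab : a + 2 ≤ b) {z : ℤ}
    (hz : z = w a ∨ z = w a - 1) (hl : w b ≤ z) (hr : z + (a + 1) ≤ w b + b)
    (hf : ∀ w', POpt n θ w' → w' a = w a → w' b = w b → w' (a + 1) = z) :
    PartialPath n θ x y (Function.update w (a + 1) z) (a + 1) b := by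
  have hne : ∀ k, k ≠ a + 1 → Function.update w (a + 1) z k = w k :=
    fun k hk => Function.update_of_ne hk _ _
  have heq : Function.update w (a + 1) z (a + 1) = z := Function.update_self _ _ _
  have := hw.one_le
  have := hw.le
  refine ⟨by omega, by omega, hw.le, fun k h1 h2 => ?_, fun k h1 h2 => ?_, ?_, ?_, ?_, ?_, ?_⟩
  · rw [hne k (by omega)]
    rcases Nat.lt_or_ge k a with hk | hk
    · rw [hne (k + 1) (by omega)]
      exact hw.low k h1 hk
    · rw [show k = a by omega, heq]
      exact hz
  · rw [hne k (by omega), hne (k + 1) (by omega)]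
    exact hw.high k h1 h2
  · rwa [heq, hne b (by omega)]
  · rw [heq, hne b (by omega)]
    push_cast
    exact hr
  · rw [hne 1 (by omega), hw.first]
  · rw [hne (n - 1) (by omega), hw.last]
  · intro w' h' h1 h2 k k1 k2 k3
    by_cases e : k = a + 1
    · rw [e, heq]
      exact hf w' h' (hw.forced w' h' h1 h2 a (by omega) (by omega) (by omega))
        (hw.forced w' h' h1 h2 b (by omega) (by omega) (by omega))
    · rw [hne k e]
      exact hw.forced w' h' h1 h2 k k1 k2 (by omega)

/-- Extension of the upper part. -/
theorem extendHigh (hw : PartialPath n θ x y w a b) (hab : a + 2 ≤ b) {z : ℤ}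
    (hz : z = w b ∨ z = w b + 1) (hl : z ≤ w a) (hr : w a + a + 1 ≤ z + b)
    (hf : ∀ w', POpt n θ w' → w' a = w a → w' b = w b → w' (b - 1) = z) :
    PartialPath n θ x y (Function.update w (b - 1) z) a (b - 1) := by
  have hne : ∀ k, k ≠ b - 1 → Function.update w (b - 1) z k = w k :=
    fun k hk => Function.update_of_ne hk _ _
  have heq : Function.update w (b - 1) z (b - 1) = z := Function.update_self _ _ _
  have := hw.one_le
  have := hw.le
  refine ⟨by omega, by omega, by omega, fun k h1 h2 => ?_, fun k h1 h2 => ?_, ?_, ?_, ?_, ?_, ?_⟩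
  · rw [hne k (by omega), hne (k + 1) (by omega)]
    exact hw.low k h1 h2
  · rw [hne (k + 1) (by omega)]
    rcases Nat.lt_or_ge k b with hk | hk
    · rw [show k = b - 1 by omega, heq, show b - 1 + 1 = b by omega]
      omega
    · rw [hne k (by omega)]
      exact hw.high k hk h2
  · rwa [heq, hne a (by omega)]
  · rw [heq, hne a (by omega)]
    omega
  · rw [hne 1 (by omega), hw.first]
  · rw [hne (n - 1) (by omega), hw.last]
  · intro w' h' h1 h2 k k1 k2 k3
    by_cases e : k = b - 1
    · rw [e, heq]
      exact hf w' h' (hw.forced w' h' h1 h2 a (by omega) (by omega) (by omega))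
        (hw.forced w' h' h1 h2 b (by omega) (by omega) (by omega))
    · rw [hne k e]
      exact hw.forced w' h' h1 h2 k k1 k2 (by omega)

end PartialPath

/-- The greedy rule extends the window `[l, r]` inside the window `[l', r']` to the left. -/
def GrowLeft (θ : ℤ → ℝ) (l r l' r' : ℤ) : Prop :=
  r = r' ∨ l ≠ l' ∧ r ≠ r' ∧ ExtendLower θ l r l' r' ∧
    chordVal θ l (r + 1) ≤ chordVal θ (l - 1) r

/-- The greedy rule extends the window `[l, r]` inside the window `[l', r']` to the right. -/
def GrowRight (θ : ℤ → ℝ) (l r l' r' : ℤ) : Prop :=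
  r ≠ r' ∧ l = l' ∨ l ≠ l' ∧ r ≠ r' ∧ ExtendLower θ l r l' r' ∧
    chordVal θ (l - 1) r ≤ chordVal θ l (r + 1)

/-- The greedy rule shrinks the window `[l', r']` around the window `[l, r]` on the left. -/
def ShrinkLeft (θ : ℤ → ℝ) (l r l' r' : ℤ) : Prop :=
  l ≠ l' ∧ r ≠ r' ∧ ¬ ExtendLower θ l r l' r' ∧
    chordVal θ l' (r' - 1) ≤ chordVal θ (l' + 1) r'

/-- The greedy rule shrinks the window `[l', r']` around the window `[l, r]` on the right. -/
def ShrinkRight (θ : ℤ → ℝ) (l r l' r' : ℤ) : Prop :=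
  l ≠ l' ∧ r ≠ r' ∧ ¬ ExtendLower θ l r l' r' ∧
    chordVal θ (l' + 1) r' ≤ chordVal θ l' (r' - 1)

namespace PartialPath

variable {x y : ℤ} {w : ℕ → ℤ} {a b : ℕ}

theorem growLeft (h : CircSeq n θ) (hw : PartialPath n θ x y w a b) (hab : a + 2 ≤ b)
    (hg : GrowLeft θ (w a) (w a + a) (w b) (w b + b)) :
    PartialPath n θ x y (Function.update w (a + 1) (w a - 1)) (a + 1) b := by
  have := hw.left
  have := hw.right
  have h1 := hw.one_le
  have h2 := hw.le
  refine hw.extendLow hab (Or.inr rfl) ?_ (by omega) fun w' h' ea eb => ?_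
  · rcases hg with hg | hg
    · omega
    · omega
  · rcases hg with hg | ⟨g1, g2, g3, g4⟩
    · have e1 := h'.1.nested (j := a + 1) (k := b) (by omega) (by omega) (by omega)
      have e2 := h'.1 a h1 (by omega)
      push_cast at e1
      omega
    · rw [← ea, ← eb] at g3
      rw [← ea]
      refine (h'.lower_step h h1 hab h2 (by omega) (by omega) g3).2 ?_
      rw [ea]
      exact g4

theorem growRight (h : CircSeq n θ) (hw : PartialPath n θ x y w a b) (hab : a + 2 ≤ b)
    (hg : GrowRight θ (w a) (w a + a) (w b) (w b + b)) :
    PartialPath n θ x y (Function.update w (a + 1) (w a)) (a + 1) b := by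
  have := hw.left
  have := hw.right
  have h1 := hw.one_le
  have h2 := hw.le
  refine hw.extendLow hab (Or.inl rfl) hw.left ?_ fun w' h' ea eb => ?_
  · rcases hg with hg | hg
    · omega
    · omega
  · rcases hg with hg | ⟨g1, g2, g3, g4⟩
    · have e1 := h'.1.nested (j := a + 1) (k := b) (by omega) (by omega) (by omega)
      have e2 := h'.1 a h1 (by omega)
      omega
    · rw [← ea, ← eb] at g3
      rw [← ea]
      refine (h'.lower_step h h1 hab h2 (by omega) (by omega) g3).1 ?_
      rw [ea]
      exact g4

theorem shrinkLeft (h : CircSeq n θ) (hw : PartialPath n θ x y w a b) (hab : a + 2 ≤ b)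
    (hg : ShrinkLeft θ (w a) (w a + a) (w b) (w b + b)) :
    PartialPath n θ x y (Function.update w (b - 1) (w b + 1)) a (b - 1) := by
  have := hw.left
  have := hw.right
  obtain ⟨g1, g2, g3, g4⟩ := hg
  refine hw.extendHigh hab (Or.inr rfl) (by omega) (by omega) fun w' h' ea eb => ?_
  rw [← ea, ← eb] at g3
  rw [← eb]
  refine (h'.upper_step h hw.one_le hab hw.le (by omega) (by omega) g3).2 ?_
  rw [eb]
  exact g4

theorem shrinkRight (h : CircSeq n θ) (hw : PartialPath n θ x y w a b) (hab : a + 2 ≤ b)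
    (hg : ShrinkRight θ (w a) (w a + a) (w b) (w b + b)) :
    PartialPath n θ x y (Function.update w (b - 1) (w b)) a (b - 1) := by
  have := hw.left
  have := hw.right
  obtain ⟨g1, g2, g3, g4⟩ := hg
  refine hw.extendHigh hab (Or.inl rfl) hw.left (by omega) fun w' h' ea eb => ?_
  rw [← ea, ← eb] at g3
  rw [← eb]
  refine (h'.upper_step h hw.one_le hab hw.le (by omega) (by omega) g3).1 ?_
  rw [eb]
  exact g4

end PartialPath

end

section

variable {n : ℕ} [NeZero n] {p : Fin n → Plane} {s : State} {θ : ℤ → ℝ} {r₀ : ℝ}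

/-! ### The greedy construction on the machine -/

/-- Sort two real numbers into the variables `i` and `j`, and record in the variable `d` whether
their order was preserved (`c`) or reversed (`c'`). -/
def sortTwo (e f : RExpr) (i j d c c' : ℕ) : Program :=
  .ite (.realLE e f)
    (.seq (setRealVar i e) (.seq (setRealVar j f) (setVar d (.const c))))
    (.seq (setRealVar i f) (.seq (setRealVar j e) (setVar d (.const c'))))

/-- Determine the next step of the greedy rule. The windows `[l, r]` and `[l', r']` are in the
variables `15`, `16` and `17`, `18`; the vertices `l - 1`, `r + 1`, `l' + 1`, `r' - 1` are stored
in the variables `21`, …, `24`. The result, in the variable `19`, is `0` or `1` if `[l, r]` grows to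
the left or right, and `2` or `3` if `[l', r']` shrinks on the left or right. -/
def chooseProgram : Program :=
  .seq (.seq (prevVertex 21 15) (.seq (nextVertex 22 16) (.seq (nextVertex 23 17)
    (prevVertex 24 18))))
  (.ite (.eq (natVar 16) (natVar 18)) (setVar 19 (.const 0))
  (.ite (.eq (natVar 15) (natVar 17)) (setVar 19 (.const 1))
  (.seq (sortTwo (sqDistExpr (natVar 15) (natVar 22)) (sqDistExpr (natVar 21) (natVar 16)) 11 12
      25 0 1)
  (.seq (sortTwo (sqDistExpr (natVar 17) (natVar 24)) (sqDistExpr (natVar 23) (natVar 18)) 13 14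
      26 2 3)
    (.ite (.not (.and (.realLE (realVar 13) (realVar 11))
        (.not (.and (.realLE (realVar 11) (realVar 13)) (.realLE (realVar 14) (realVar 12))))))
      (setVar 19 (natVar 25)) (setVar 19 (natVar 26)))))))

theorem wp_sortTwo {i j d c c' a₁ a₂ b₁ b₂ : ℕ} {x₁ x₂ y₁ y₂ : ℤ} {Q : State → Prop}
    (h : HasInput p s) (hi : 2 ≤ i) (ha₁ : s.nat a₁ 0 = vtx n x₁) (ha₂ : s.nat a₂ 0 = vtx n x₂)
    (hb₁ : s.nat b₁ 0 = vtx n y₁) (hb₂ : s.nat b₂ 0 = vtx n y₂) {u v : ℝ}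
    (hu : u = sqDist (p (vtx n x₁)) (p (vtx n x₂))) (hv : v = sqDist (p (vtx n y₁)) (p (vtx n y₂)))
    (hQ : ∀ u' v' m, (u ≤ v ∧ u' = u ∧ v' = v ∧ m = c ∨ v ≤ u ∧ u' = v ∧ v' = u ∧ m = c') →
      Q (((s.setReal i 0 u').setReal j 0 v').setNat d 0 m)) :
    (sortTwo (sqDistExpr (natVar a₁) (natVar a₂)) (sqDistExpr (natVar b₁) (natVar b₂)) i j d c
      c').wp Q s := by
  have h' : ∀ z, HasInput p (s.setReal i 0 z) := fun z =>
    h.congr rfl (State.setReal_real_of_ne _ (by omega) _ _)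
      (State.setReal_real_of_ne _ (by omega) _ _)
  have e1 := h.sqDistExpr_eval (e := natVar a₁) (f := natVar a₂) ha₁ ha₂
  have e2 := h.sqDistExpr_eval (e := natVar b₁) (f := natVar b₂) hb₁ hb₂
  have e1' := fun z => (h' z).sqDistExpr_eval (e := natVar a₁) (f := natVar a₂) ha₁ ha₂
  have e2' := fun z => (h' z).sqDistExpr_eval (e := natVar b₁) (f := natVar b₂) hb₁ hb₂
  rw [← hu] at e1 e1'
  rw [← hv] at e2 e2'
  refine ⟨fun hc => ?_, fun hc => ?_⟩
  · simp only [Test.Holds, e1, e2] at hc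
    simp only [Program.wp, setRealVar_wp, setVar_wp, e1, e2']
    exact hQ _ _ _ (Or.inl ⟨hc, rfl, rfl, rfl⟩)
  · simp only [Test.Holds, e1, e2, not_le] at hc
    simp only [Program.wp, setRealVar_wp, setVar_wp, e2, e1']
    exact hQ _ _ _ (Or.inr ⟨hc.le, rfl, rfl, rfl⟩)

/-- The greedy rule in terms of the ordered pairs of candidates. -/
theorem extendLower_iff {l r l' r' : ℤ} {a a' b b' : ℝ} (ha : a ≤ a') (hb : b ≤ b')
    (h1 : chordVal θ (l - 1) r = a ∧ chordVal θ l (r + 1) = a' ∨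
      chordVal θ (l - 1) r = a' ∧ chordVal θ l (r + 1) = a)
    (h2 : chordVal θ (l' + 1) r' = b ∧ chordVal θ l' (r' - 1) = b' ∨
      chordVal θ (l' + 1) r' = b' ∧ chordVal θ l' (r' - 1) = b) :
    ExtendLower θ l r l' r' ↔ ¬ (b ≤ a ∧ ¬ (a ≤ b ∧ b' ≤ a')) := by
  have key : (a < b ∨ a = b ∧ b' ≤ a') ↔ ¬ (b ≤ a ∧ ¬ (a ≤ b ∧ b' ≤ a')) := by
    rcases lt_trichotomy a b with h | rfl | h
    · simp [h]
    · simp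
    · simp [h.not_gt, h.ne', h.le]
      exact fun h' => absurd h' h.not_ge
  unfold ExtendLower
  rw [← key]
  rcases h1 with ⟨e1, e2⟩ | ⟨e1, e2⟩ <;> rcases h2 with ⟨e3, e4⟩ | ⟨e3, e4⟩ <;>
    simp only [e1, e2, e3, e4, min_eq_left ha, min_eq_right ha, min_eq_left hb, min_eq_right hb,
      max_eq_left ha, max_eq_right ha, max_eq_left hb, max_eq_right hb]

theorem vtx_val_eq_iff {x y : ℤ} (h1 : x ≤ y) (h2 : y < x + n) :
    (vtx n x : ℕ) = vtx n y ↔ x = y := by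
  constructor
  · intro h
    rw [Fin.val_inj, vtx_eq_iff] at h
    by_contra hne
    exact emod_ne_of_lt (lt_of_le_of_ne h1 hne) h2 h
  · rintro rfl
    rfl

theorem runs_chooseProgram (hp : Inscribed p r₀ θ) (h : CircSeq n θ) (hs : HasInput p s)
    {l r l' r' : ℤ} (h1 : l' ≤ l) (h2 : l < r) (h3 : r ≤ r') (h4 : r' < l' + n)
    (hl : s.nat 15 0 = vtx n l) (hr : s.nat 16 0 = vtx n r) (hl' : s.nat 17 0 = vtx n l')
    (hr' : s.nat 18 0 = vtx n r') : Runs 1 chooseProgram s fun s' =>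
      (s'.nat 21 0 = vtx n (l - 1) ∧ s'.nat 22 0 = vtx n (r + 1) ∧ s'.nat 23 0 = vtx n (l' + 1) ∧
        s'.nat 24 0 = vtx n (r' - 1)) ∧
      (s'.nat 19 0 = 0 ∧ GrowLeft θ l r l' r' ∨ s'.nat 19 0 = 1 ∧ GrowRight θ l r l' r' ∨
        s'.nat 19 0 = 2 ∧ ShrinkLeft θ l r l' r' ∨ s'.nat 19 0 = 3 ∧ ShrinkRight θ l r l' r') := by
  -- the vertices, which do not change any more once they are computed
  set V : State → Prop := fun s => HasInput p s ∧ s.nat 15 0 = vtx n l ∧ s.nat 16 0 = vtx n r ∧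
    s.nat 17 0 = vtx n l' ∧ s.nat 18 0 = vtx n r' ∧ s.nat 21 0 = vtx n (l - 1) ∧
    s.nat 22 0 = vtx n (r + 1) ∧ s.nat 23 0 = vtx n (l' + 1) ∧ s.nat 24 0 = vtx n (r' - 1) with hV
  have hn : 1 ≤ 1 := le_rfl
  refine Runs.seq (Q := V) (.of_wp hn ?_) fun s₁ hs₁ => ?_
  · refine wp_prevVertex hs.1 hl (wp_nextVertex (n := n) (x := r) ?_ ?_ (wp_nextVertex (n := n) (x := l') ?_ ?_
      (wp_prevVertex (n := n) (x := r') ?_ ?_ ?_)))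
    any_goals simpa using hs.1
    · simpa using hr
    · simpa using hl'
    · simpa using hr'
    · simpa [hV, HasInput, hl, hr, hl', hr'] using hs
  obtain ⟨v0, v15, v16, v17, v18, v21, v22, v23, v24⟩ := id hs₁
  refine Runs.ite hn (fun hc => .of_wp hn ?_) fun hc => Runs.ite hn (fun hd => .of_wp hn ?_)
    fun hd => ?_
  · simp only [Test.holds_eq, natVar_eval, v16, v18] at hc
    rw [vtx_val_eq_iff h3 (by omega)] at hc
    exact ⟨by simp [v21, v22, v23, v24], Or.inl ⟨by simp, Or.inl hc⟩⟩
  · simp only [Test.holds_eq, natVar_eval, v15, v16, v17, v18] at hc hd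
    rw [vtx_val_eq_iff h3 (by omega)] at hc
    rw [eq_comm, vtx_val_eq_iff h1 (by omega)] at hd
    exact ⟨by simp [v21, v22, v23, v24], Or.inr (Or.inl ⟨by simp, Or.inl ⟨hc, hd.symm⟩⟩)⟩
  simp only [Test.holds_eq, natVar_eval, v15, v16, v17, v18] at hc hd
  rw [vtx_val_eq_iff h3 (by omega)] at hc
  rw [eq_comm, vtx_val_eq_iff h1 (by omega), eq_comm] at hd
  obtain ⟨q, hq⟩ : ∃ q : ℤ → ℤ → ℝ, ∀ x y, q x y = sqDist (p (vtx n x)) (p (vtx n y)) :=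
    ⟨_, fun _ _ => rfl⟩
  have p1 : 0 < chordVal θ (l - 1) r := h.val_pos (by omega) (by omega)
  have p2 : 0 < chordVal θ l (r + 1) := h.val_pos (by omega) (by omega)
  have p3 : 0 < chordVal θ (l' + 1) r' := h.val_pos (by omega) (by omega)
  have p4 : 0 < chordVal θ l' (r' - 1) := h.val_pos (by omega) (by omega)
  refine Runs.seq (Q := fun s => V s ∧
    (q l (r + 1) ≤ q (l - 1) r ∧ s.real 11 0 = q l (r + 1) ∧ s.real 12 0 = q (l - 1) r ∧
        s.nat 25 0 = 0 ∨
      q (l - 1) r ≤ q l (r + 1) ∧ s.real 11 0 = q (l - 1) r ∧ s.real 12 0 = q l (r + 1) ∧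
        s.nat 25 0 = 1)) (.of_wp hn (wp_sortTwo v0 (by omega) v15 v22 v21 v16 (hq _ _) (hq _ _)
      fun u v m hm => ?_)) fun s₂ hs₂ => ?_
  · refine ⟨by simpa [hV, HasInput] using hs₁, ?_⟩
    rcases hm with ⟨m1, rfl, rfl, rfl⟩ | ⟨m1, rfl, rfl, rfl⟩
    · exact Or.inl (by simpa using m1)
    · exact Or.inr (by simpa using m1)
  obtain ⟨hV₂, hA⟩ := hs₂
  obtain ⟨v0, v15, v16, v17, v18, v21, v22, v23, v24⟩ := id hV₂
  refine Runs.seq (Q := fun s => V s ∧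
    (q l (r + 1) ≤ q (l - 1) r ∧ s.real 11 0 = q l (r + 1) ∧ s.real 12 0 = q (l - 1) r ∧
        s.nat 25 0 = 0 ∨
      q (l - 1) r ≤ q l (r + 1) ∧ s.real 11 0 = q (l - 1) r ∧ s.real 12 0 = q l (r + 1) ∧
        s.nat 25 0 = 1) ∧
    (q l' (r' - 1) ≤ q (l' + 1) r' ∧ s.real 13 0 = q l' (r' - 1) ∧ s.real 14 0 = q (l' + 1) r' ∧
        s.nat 26 0 = 2 ∨
      q (l' + 1) r' ≤ q l' (r' - 1) ∧ s.real 13 0 = q (l' + 1) r' ∧ s.real 14 0 = q l' (r' - 1) ∧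
        s.nat 26 0 = 3)) (.of_wp hn (wp_sortTwo v0 (by omega) v17 v24 v23 v18 (hq _ _) (hq _ _)
      fun u v m hm => ?_)) fun s₃ hs₃ => ?_
  · refine ⟨by simpa [hV, HasInput] using hV₂, by simpa using hA, ?_⟩
    rcases hm with ⟨m1, rfl, rfl, rfl⟩ | ⟨m1, rfl, rfl, rfl⟩
    · exact Or.inl (by simpa using m1)
    · exact Or.inr (by simpa using m1)
  obtain ⟨⟨-, -, -, -, -, v21, v22, v23, v24⟩, hA, hB⟩ := hs₃
  -- lengths and sizes of the four candidates are in the same order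
  have le_iff : ∀ x y x' y', 0 < chordVal θ x y → 0 < chordVal θ x' y' →
      (q x y ≤ q x' y' ↔ chordVal θ x y ≤ chordVal θ x' y') := by
    intro x y x' y' h1 h2
    rw [hq, hq]
    exact hp.sqDist_le_iff h1 h2
  have hT : (Test.not (.and (.realLE (realVar 13) (realVar 11)) (.not (.and
      (.realLE (realVar 11) (realVar 13)) (.realLE (realVar 14) (realVar 12)))))).Holds s₃ ↔
      ExtendLower θ l r l' r' := by
    simp only [Test.Holds, realVar_eval]
    rcases hA with ⟨a1, a2, a3, -⟩ | ⟨a1, a2, a3, -⟩ <;>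
    rcases hB with ⟨b1, b2, b3, -⟩ | ⟨b1, b2, b3, -⟩ <;>
    rw [a2, a3, b2, b3, le_iff _ _ _ _ (by assumption) (by assumption),
      le_iff _ _ _ _ (by assumption) (by assumption),
      le_iff _ _ _ _ (by assumption) (by assumption)] <;>
    rw [le_iff _ _ _ _ (by assumption) (by assumption)] at a1 b1 <;>
    rw [extendLower_iff a1 b1 (by simp) (by simp)]
  refine Runs.ite hn (fun hc => .of_wp hn ?_) fun hc => .of_wp hn ?_
  · rw [hT] at hc
    refine ⟨by simp [v21, v22, v23, v24], ?_⟩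
    rcases hA with ⟨a1, -, -, a4⟩ | ⟨a1, -, -, a4⟩
    · rw [le_iff _ _ _ _ p2 p1] at a1
      exact Or.inl ⟨by simp [a4], Or.inr ⟨hd, by tauto, hc, a1⟩⟩
    · rw [le_iff _ _ _ _ p1 p2] at a1
      exact Or.inr (Or.inl ⟨by simp [a4], Or.inr ⟨hd, by tauto, hc, a1⟩⟩)
  · rw [hT] at hc
    refine ⟨by simp [v21, v22, v23, v24], ?_⟩
    rcases hB with ⟨b1, -, -, b4⟩ | ⟨b1, -, -, b4⟩
    · rw [le_iff _ _ _ _ p4 p3] at b1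
      exact Or.inr (Or.inr (Or.inl ⟨by simp [b4], hd, by tauto, hc, b1⟩))
    · rw [le_iff _ _ _ _ p3 p4] at b1
      exact Or.inr (Or.inr (Or.inr ⟨by simp [b4], hd, by tauto, hc, b1⟩))

end

section

variable {n : ℕ} [NeZero n] {p : Fin n → Plane} {s : State} {θ : ℤ → ℝ} {r₀ : ℝ}

/-- Cell `c` of the arrays `5`, `6` and of the real array `3` holds the endpoints and the squared
length of the chord of the window of size `c + 2` of the path `w`. -/
def HasChord (p : Fin n → Plane) (w : ℕ → ℤ) (c : ℕ) (s : State) : Prop :=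
  s.nat 5 c = vtx n (w (c + 2)) ∧ s.nat 6 c = vtx n (w (c + 2) + (c + 2 : ℕ)) ∧
    s.real 3 c = sqDist (p (vtx n (w (c + 2)))) (p (vtx n (w (c + 2) + (c + 2 : ℕ))))

/-- The variables `13` and `14` delimit the cells for the windows of sizes between `a` and `b`, the
variables `15`, …, `18` hold the windows of sizes `a` and `b`, and the other cells are filled. -/
def HasWindows (p : Fin n → Plane) (w : ℕ → ℤ) (a b : ℕ) (s : State) : Prop :=
  (s.nat 13 0 + 1 = a ∧ s.nat 14 0 + 2 = b) ∧
  (s.nat 15 0 = vtx n (w a) ∧ s.nat 16 0 = vtx n (w a + a)) ∧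
  (s.nat 17 0 = vtx n (w b) ∧ s.nat 18 0 = vtx n (w b + b)) ∧
  ∀ c < n - 3, c + 2 ≤ a ∨ b ≤ c + 2 → HasChord p w c s

/-- Store the window `[l, r]`, after its growth. -/
def storeLow : Program :=
  .seq (.setNat 5 (natVar 13) (natVar 15)) (.seq (.setNat 6 (natVar 13) (natVar 16))
    (.seq (.setReal 3 (natVar 13) (sqDistExpr (natVar 15) (natVar 16)))
      (setVar 13 (.succ (natVar 13)))))

/-- Store the window `[l', r']`, after it was shrunk. -/
def storeHigh : Program :=
  .seq (setVar 14 (.pred (natVar 14)))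
    (.seq (.setNat 5 (natVar 14) (natVar 17)) (.seq (.setNat 6 (natVar 14) (natVar 18))
      (.setReal 3 (natVar 14) (sqDistExpr (natVar 17) (natVar 18)))))

theorem wp_storeLow (hs : HasInput p s) {w : ℕ → ℤ} {a b : ℕ} {z : ℤ} (hab : a + 2 ≤ b)
    (h1 : s.nat 13 0 + 1 = a ∧ s.nat 14 0 + 2 = b)
    (h2 : s.nat 15 0 = vtx n z ∧ s.nat 16 0 = vtx n (z + (a + 1 : ℕ)))
    (h3 : s.nat 17 0 = vtx n (w b) ∧ s.nat 18 0 = vtx n (w b + b))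
    (h4 : ∀ c < n - 3, c + 2 ≤ a ∨ b ≤ c + 2 → HasChord p w c s) :
    storeLow.wp (fun s' => HasInput p s' ∧
      HasWindows p (Function.update w (a + 1) z) (a + 1) b s') s := by
  have hne : ∀ k, k ≠ a + 1 → Function.update w (a + 1) z k = w k :=
    fun k hk => Function.update_of_ne hk _ _
  have heq : Function.update w (a + 1) z (a + 1) = z := Function.update_self _ _ _
  set s₁ := (s.setNat 5 (s.nat 13 0) (s.nat 15 0)).setNat 6 (s.nat 13 0) (s.nat 16 0) with hs₁
  have hi : HasInput p s₁ := by simpa [hs₁, HasInput] using hs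
  have he := hi.sqDistExpr_eval (e := natVar 15) (f := natVar 16) (x := z)
    (y := z + (a + 1 : ℕ)) (by simpa [hs₁] using h2.1) (by simpa [hs₁] using h2.2)
  simp only [storeLow, Program.wp, setVar_wp, natVar_eval, NExpr.eval]
  simp only [State.setNat_nat_of_ne, ne_eq, Nat.reduceEqDiff, not_false_eq_true]
  rw [← hs₁, he]
  refine ⟨by simpa [HasInput] using hi, ⟨by simp [hs₁]; omega, by simpa [hs₁] using h1.2⟩, ?_, ?_,
    fun c hc hc' => ?_⟩
  · rw [heq]
    simpa [hs₁] using h2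
  · rw [hne b (by omega)]
    simpa [hs₁] using h3
  · unfold HasChord
    by_cases e : c + 2 = a + 1
    · rw [e, heq]
      have : c = s.nat 13 0 := by omega
      simp [hs₁, this, h2]
    · rw [hne _ e]
      have : c ≠ s.nat 13 0 := by omega
      have hold := h4 c hc (by omega)
      unfold HasChord at hold
      simpa [hs₁, this] using hold

theorem wp_storeHigh (hs : HasInput p s) {w : ℕ → ℤ} {a b : ℕ} {z : ℤ} (ha : 1 ≤ a)
    (hab : a + 2 ≤ b) (h1 : s.nat 13 0 + 1 = a ∧ s.nat 14 0 + 2 = b)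
    (h2 : s.nat 15 0 = vtx n (w a) ∧ s.nat 16 0 = vtx n (w a + a))
    (h3 : s.nat 17 0 = vtx n z ∧ s.nat 18 0 = vtx n (z + (b - 1 : ℕ)))
    (h4 : ∀ c < n - 3, c + 2 ≤ a ∨ b ≤ c + 2 → HasChord p w c s) :
    storeHigh.wp (fun s' => HasInput p s' ∧
      HasWindows p (Function.update w (b - 1) z) a (b - 1) s') s := by
  have hne : ∀ k, k ≠ b - 1 → Function.update w (b - 1) z k = w k :=
    fun k hk => Function.update_of_ne hk _ _
  have heq : Function.update w (b - 1) z (b - 1) = z := Function.update_self _ _ _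
  set m := s.nat 14 0 - 1 with hm
  set s₁ := ((s.setNat 14 0 m).setNat 5 m (s.nat 17 0)).setNat 6 m (s.nat 18 0) with hs₁
  have hi : HasInput p s₁ := by simpa [hs₁, HasInput] using hs
  have he := hi.sqDistExpr_eval (e := natVar 17) (f := natVar 18) (x := z)
    (y := z + (b - 1 : ℕ)) (by simpa [hs₁] using h3.1) (by simpa [hs₁] using h3.2)
  simp only [storeHigh, Program.wp, setVar_wp, natVar_eval, NExpr.eval]
  simp only [State.setNat_nat, Nat.reduceEqDiff, false_and, if_false, and_self, if_true]
  rw [← hm, ← hs₁, he]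
  refine ⟨by simpa [HasInput] using hi, ⟨by simpa [hs₁] using h1.1, by simp [hs₁]; omega⟩, ?_, ?_,
    fun c hc hc' => ?_⟩
  · rw [hne a (by omega)]
    simpa [hs₁] using h2
  · rw [heq]
    simpa [hs₁] using h3
  · unfold HasChord
    by_cases e : c + 2 = b - 1
    · rw [e, heq]
      have : c = m := by omega
      simp [hs₁, this, h3]
    · rw [hne _ e]
      have : c ≠ m := by omega
      have hold := h4 c hc (by omega)
      unfold HasChord at hold
      simpa [hs₁, this] using hold

/-- Take the step determined by `chooseProgram`. -/
def stepProgram : Program :=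
  .ite (.natLE (natVar 19) (.const 1))
    (.seq (.ite (.natLE (natVar 19) (.const 0)) (setVar 15 (natVar 21)) (setVar 16 (natVar 22)))
      storeLow)
    (.seq (.ite (.natLE (natVar 19) (.const 2)) (setVar 17 (natVar 23)) (setVar 18 (natVar 24)))
      storeHigh)

/-- Construct the path that starts at the ear in cell `c` of array `3` and ends at the ear in
cell `c'`. -/
def greedyProgram (c c' : ℕ) : Program :=
  .seq (.seq (setVar 15 (.get 3 (.const c))) (.seq (nextVertex 16 15)
    (.seq (setVar 18 (.get 3 (.const c'))) (.seq (nextVertex 17 18)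
      (.seq (setVar 13 (.const 0)) (setVar 14 (.pred (.pred (.pred (natVar 0))))))))))
  (.while (.lt (natVar 13) (natVar 14)) (.seq chooseProgram stepProgram))

theorem HasChord.congr {w : ℕ → ℤ} {c : ℕ} {s' : State} (h : HasChord p w c s)
    (h5 : s'.nat 5 = s.nat 5) (h6 : s'.nat 6 = s.nat 6) (h3 : s'.real 3 = s.real 3) :
    HasChord p w c s' := by
  unfold HasChord
  rw [h5, h6, h3]
  exact h

/-- One iteration of the greedy construction. -/
theorem runs_greedyStep (hp : Inscribed p r₀ θ) (h : CircSeq n θ) (hs : HasInput p s) {x y : ℤ}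
    {w : ℕ → ℤ} {a b : ℕ} (hab : a + 2 ≤ b) (hw : PartialPath n θ x y w a b)
    (hs' : HasWindows p w a b s) :
    Runs 1 (.seq chooseProgram stepProgram) s fun s' => HasInput p s' ∧
      ∃ w' a' b', b' - a' + 1 = b - a ∧ PartialPath n θ x y w' a' b' ∧ HasWindows p w' a' b' s' := by
  obtain ⟨g1, ⟨g2, g3⟩, ⟨g4, g5⟩, g6⟩ := hs'
  have h1 := hw.one_le
  have h2 := hw.le
  refine Runs.seq (runs_chooseProgram hp h hs hw.left (by omega) hw.right (by omega) g2 g3 g4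
    g5).frame fun s₁ hs₁ => ?_
  obtain ⟨⟨⟨v1, v2, v3, v4⟩, hm⟩, fn, fr⟩ := hs₁
  have hs₁ : HasInput p s₁ := hs.congr (fn 0 (by simp [Program.KeepsNat, chooseProgram,
    prevVertex, nextVertex, sortTwo, setVar, setRealVar])) (fr 0 (by simp [Program.KeepsReal,
    chooseProgram, prevVertex, nextVertex, sortTwo, setVar, setRealVar])) (fr 1 (by
    simp [Program.KeepsReal, chooseProgram, prevVertex, nextVertex, sortTwo, setVar, setRealVar]))
  have fn' : ∀ a, a ∈ [5, 6, 13, 14, 15, 16, 17, 18] → s₁.nat a = s.nat a := by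
    intro a ha
    apply fn
    simp only [List.mem_cons, List.not_mem_nil, or_false] at ha
    rcases ha with rfl | rfl | rfl | rfl | rfl | rfl | rfl | rfl <;>
    simp [Program.KeepsNat, chooseProgram, prevVertex, nextVertex, sortTwo, setVar, setRealVar]
  have f3 : s₁.real 3 = s.real 3 := fr 3 (by simp [Program.KeepsReal, chooseProgram, prevVertex,
    nextVertex, sortTwo, setVar, setRealVar])
  rw [← fn' 13 (by simp), ← fn' 14 (by simp)] at g1
  rw [← fn' 15 (by simp)] at g2
  rw [← fn' 16 (by simp)] at g3
  rw [← fn' 17 (by simp)] at g4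
  rw [← fn' 18 (by simp)] at g5
  replace g6 : ∀ c < n - 3, c + 2 ≤ a ∨ b ≤ c + 2 → HasChord p w c s₁ := fun c hc hc' =>
    (g6 c hc hc').congr (fn' 5 (by simp)) (fn' 6 (by simp)) f3
  have hl := hw.left
  have hr := hw.right
  refine .of_wp le_rfl ⟨fun hc => ⟨fun hd => ?_, fun hd => ?_⟩, fun hc => ⟨fun hd => ?_, fun hd => ?_⟩⟩
  · replace hd : s₁.nat 19 0 ≤ 0 := hd
    have hg : GrowLeft θ (w a) (w a + a) (w b) (w b + b) := by
      rcases hm with ⟨m1, m2⟩ | ⟨m1, m2⟩ | ⟨m1, m2⟩ | ⟨m1, m2⟩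
      · exact m2
      all_goals omega
    refine Program.wp_mono (wp_storeLow (s := s₁.setNat 15 0 (s₁.nat 21 0)) (w := w) (a := a)
      (b := b) (z := w a - 1) (by simpa [HasInput] using hs₁) hab (by simpa using g1) ⟨?_, ?_⟩
      (by simpa using ⟨g4, g5⟩) fun c hc hc' => (g6 c hc hc').congr (by simp) (by simp) rfl)
      fun s' hs' => ⟨hs'.1, _, _, _, ?_, hw.growLeft h hab hg, hs'.2⟩
    · simpa using v1
    · rw [State.setNat_nat_of_ne _ (by omega), g3]
      congr 2
      push_cast
      ring
    · omega
  · replace hc : s₁.nat 19 0 ≤ 1 := hc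
    replace hd : ¬ s₁.nat 19 0 ≤ 0 := hd
    have hg : GrowRight θ (w a) (w a + a) (w b) (w b + b) := by
      rcases hm with ⟨m1, m2⟩ | ⟨m1, m2⟩ | ⟨m1, m2⟩ | ⟨m1, m2⟩
      · omega
      · exact m2
      all_goals omega
    refine Program.wp_mono (wp_storeLow (s := s₁.setNat 16 0 (s₁.nat 22 0)) (w := w) (a := a)
      (b := b) (z := w a) (by simpa [HasInput] using hs₁) hab (by simpa using g1) ⟨?_, ?_⟩
      (by simpa using ⟨g4, g5⟩) fun c hc hc' => (g6 c hc hc').congr (by simp) (by simp) rfl)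
      fun s' hs' => ⟨hs'.1, _, _, _, ?_, hw.growRight h hab hg, hs'.2⟩
    · simpa using g2
    · rw [State.setNat_nat, if_pos ⟨rfl, rfl⟩, v2]
      congr 2
      push_cast
      ring
    · omega
  · replace hc : ¬ s₁.nat 19 0 ≤ 1 := hc
    replace hd : s₁.nat 19 0 ≤ 2 := hd
    have hg : ShrinkLeft θ (w a) (w a + a) (w b) (w b + b) := by
      rcases hm with ⟨m1, m2⟩ | ⟨m1, m2⟩ | ⟨m1, m2⟩ | ⟨m1, m2⟩
      · omega
      · omega
      · exact m2
      · omega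
    refine Program.wp_mono (wp_storeHigh (s := s₁.setNat 17 0 (s₁.nat 23 0)) (w := w) (a := a)
      (b := b) (z := w b + 1) (by simpa [HasInput] using hs₁) h1 hab (by simpa using g1)
      (by simpa using ⟨g2, g3⟩) ⟨?_, ?_⟩
      fun c hc hc' => (g6 c hc hc').congr (by simp) (by simp) rfl)
      fun s' hs' => ⟨hs'.1, _, _, _, ?_, hw.shrinkLeft h hab hg, hs'.2⟩
    · simpa using v3
    · rw [State.setNat_nat_of_ne _ (by omega), g5]
      congr 2
      push_cast [show 1 ≤ b by omega]
      ring
    · omega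
  · replace hd : ¬ s₁.nat 19 0 ≤ 2 := hd
    have hg : ShrinkRight θ (w a) (w a + a) (w b) (w b + b) := by
      rcases hm with ⟨m1, m2⟩ | ⟨m1, m2⟩ | ⟨m1, m2⟩ | ⟨m1, m2⟩
      · omega
      · omega
      · omega
      · exact m2
    refine Program.wp_mono (wp_storeHigh (s := s₁.setNat 18 0 (s₁.nat 24 0)) (w := w) (a := a)
      (b := b) (z := w b) (by simpa [HasInput] using hs₁) h1 hab (by simpa using g1)
      (by simpa using ⟨g2, g3⟩) ⟨?_, ?_⟩
      fun c hc hc' => (g6 c hc hc').congr (by simp) (by simp) rfl)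
      fun s' hs' => ⟨hs'.1, _, _, _, ?_, hw.shrinkRight h hab hg, hs'.2⟩
    · simpa using g4
    · rw [State.setNat_nat, if_pos ⟨rfl, rfl⟩, v4]
      congr 2
      push_cast [show 1 ≤ b by omega]
      ring
    · omega

/-- The start of the complement of the side at `v`, such that it contains the side at `u`. -/
def complStart (n u v : ℕ) : ℤ := if v < u then v + 1 else v + 1 - n

/-- The greedy construction follows every optimal path between the given ears. -/
theorem runs_greedyProgram (hp : Inscribed p r₀ θ) (h : CircSeq n θ) (hn : 3 ≤ n)
    (hs : HasInput p s) {c c' u v : ℕ} (hu : s.nat 3 c = u) (hv : s.nat 3 c' = v) (hun : u < n)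
    (hvn : v < n) (huv : u ≠ v) : Runs n (greedyProgram c c') s fun s' =>
      ∃ w, IsPath n w ∧ (∀ c < n - 3, HasChord p w c s') ∧ ∀ w', POpt n θ w' → w' 1 = u →
        w' (n - 1) = complStart n u v → ∀ k, 1 ≤ k → k + 1 ≤ n → w' k = w k := by
  set y := complStart n u v with hy
  have hy1 : y ≤ u ∧ (u : ℤ) + 2 ≤ y + n := by
    rw [hy, complStart]
    split_ifs <;> omega
  have vu : (u : ℕ) = vtx n u := by
    have := vtx_coe_of_lt (n := n) (x := u) (by omega) (by omega)
    omega
  have vv : (v : ℕ) = vtx n v := by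
    have := vtx_coe_of_lt (n := n) (x := v) (by omega) (by omega)
    omega
  have vy : vtx n (v + 1) = vtx n y := by
    rw [hy, complStart]
    split_ifs
    · rfl
    · rw [← vtx_add (_ - _)]
      congr 1
      ring
  have vy' : vtx n v = vtx n (y + (n - 1 : ℕ)) := by
    rw [hy, complStart]
    push_cast [show 1 ≤ n by omega]
    split_ifs
    · rw [← vtx_add]
      congr 1
      ring
    · congr 1
      ring
  refine Runs.seq (Q := fun s' => HasInput p s' ∧ ∃ w, PartialPath n θ u y w 1 (n - 1) ∧
    HasWindows p w 1 (n - 1) s') (.of_wp (by omega) ?_) fun s₁ hs₁ => ?_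
  · have hst : (s.setNat 15 0 u).nat 15 0 = vtx n u := by simpa using vu
    simp only [Program.wp, setVar_wp, NExpr.eval, hu]
    refine wp_nextVertex (by simpa using hs.1) hst ?_
    refine wp_nextVertex (n := n) (x := v) (by simpa using hs.1) (by simpa [hv] using vv) ?_
    refine ⟨by simpa [HasInput] using hs, _, PartialPath.start hn hy1.1 hy1.2, ⟨?_, ?_⟩, ?_, ?_, ?_⟩
    · simp
    · simp [hs.1]
      omega
    · simp [← vu]
    · have e : ¬ n - 1 ≤ 1 := by omega
      simp only [e, if_false]
      rw [← vy', ← vy]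
      simpa [hv] using vv
    · intro c hc hc'
      omega
  · obtain ⟨hi, w, hw, hw'⟩ := hs₁
    refine (Runs.while (k := n - 3) (I := fun k s => HasInput p s ∧ ∃ w a b, b = a + 1 + k ∧
      PartialPath n θ u y w a b ∧ HasWindows p w a b s) (by omega) (by omega)
      ⟨hi, w, 1, n - 1, by omega, hw, hw'⟩ ?_ ?_).mono ?_
    · rintro s ⟨-, w, a, b, h1, -, h2, -⟩
      simp only [Test.holds_lt, natVar_eval]
      omega
    · rintro k s ⟨hi, w, a, b, h1, h2, h3⟩
      refine ⟨?_, (runs_greedyStep hp h hi (by omega) h2 h3).mono fun s' hs' => ?_⟩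
      · have := h3.1
        simp only [Test.holds_lt, natVar_eval]
        omega
      · obtain ⟨hi', w', a', b', e, h2', h3'⟩ := hs'
        have := h2'.lt
        exact ⟨hi', w', a', b', by omega, h2', h3'⟩
    · rintro s' ⟨-, w, a, b, h1, h2, h3⟩
      exact ⟨w, h2.isPath (by omega), fun c hc => h3.2.2.2 c hc (by omega),
        fun w' h' e1 e2 k k1 k2 => h2.forced w' h' e1 e2 k k1 k2 (by omega)⟩

end

section

/-! ### Sorting and comparing the chords of paths -/

/-- `f` lists the first `m` values of `V` in increasing order. -/
def IsSorting (V f : ℕ → ℝ) (m : ℕ) : Prop :=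
  ∃ σ : ℕ → ℕ, (∀ c < m, σ c < m ∧ f c = V (σ c)) ∧ (∀ c < m, ∀ c' < m, σ c = σ c' → c = c') ∧
    ∀ c c', c ≤ c' → c' < m → f c ≤ f c'

/-- The result of comparing the first `c` terms of two sequences lexicographically: `0` if they are
equal, `1` if the first sequence is larger, and `2` if it is smaller. -/
def IsComparison (f g : ℕ → ℝ) (c d : ℕ) : Prop :=
  d = 0 ∧ (∀ i < c, f i = g i) ∨ d = 1 ∧ (∃ j < c, g j < f j ∧ ∀ i < j, f i = g i) ∨
    d = 2 ∧ ∃ j < c, f j < g j ∧ ∀ i < j, f i = g i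

theorem IsComparison.succ {f f' g : ℕ → ℝ} {c d : ℕ} (h : IsComparison f g c d)
    (hf : ∀ i < c, f' i = f i) (hd : d ≠ 0 ∨ f' c = g c) : IsComparison f' g (c + 1) d := by
  rcases h with ⟨h1, h2⟩ | ⟨h1, j, h2, h3, h4⟩ | ⟨h1, j, h2, h3, h4⟩
  · refine Or.inl ⟨h1, fun i hi => ?_⟩
    rcases Nat.lt_succ_iff_lt_or_eq.1 hi with hi | rfl
    · rw [hf i hi, h2 i hi]
    · tauto
  · exact Or.inr (Or.inl ⟨h1, j, by omega, by rwa [hf j h2], fun i hi => by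
      rw [hf i (by omega), h4 i hi]⟩)
  · exact Or.inr (Or.inr ⟨h1, j, by omega, by rwa [hf j h2], fun i hi => by
      rw [hf i (by omega), h4 i hi]⟩)

/-- An intermediate stage of sorting a unimodal sequence `V` by taking terms from its ends. The
terms with indices from `a` to `b - 1` remain, and `f` lists the other ones. -/
structure Merging (V f : ℕ → ℝ) (m a b c : ℕ) (σ : ℕ → ℕ) : Prop where
  le : a ≤ b
  le' : b ≤ m
  count : a + (m - b) = c
  spec : ∀ i < c, (σ i < a ∨ b ≤ σ i ∧ σ i < m) ∧ f i = V (σ i)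
  inj : ∀ i < c, ∀ j < c, σ i = σ j → i = j
  mono : ∀ i j, i ≤ j → j < c → f i ≤ f j
  bound : ∀ i < c, ∀ j, a ≤ j → j < b → f i ≤ V j

namespace Merging

variable {V f f' : ℕ → ℝ} {m a b c : ℕ} {σ : ℕ → ℕ}

/-- The next term in increasing order is at the index `x`, one of the two ends. -/
theorem next (h : Merging V f m a b c σ) {x a' b' : ℕ} (hab : a < b)
    (hx : x = a ∧ a' = a + 1 ∧ b' = b ∨ x + 1 = b ∧ a' = a ∧ b' + 1 = b)
    (hmin : ∀ j, a ≤ j → j < b → V x ≤ V j) (hf : ∀ i < c, f' i = f i) (hf' : f' c = V x) :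
    Merging V f' m a' b' (c + 1) (Function.update σ c x) := by
  have hm := h.le'
  have hc := h.count
  have hne : ∀ i, i ≠ c → Function.update σ c x i = σ i := fun i hi => Function.update_of_ne hi _ _
  have heq : Function.update σ c x c = x := Function.update_self _ _ _
  refine ⟨by omega, by omega, by omega, fun i hi => ?_, fun i hi j hj hij => ?_,
    fun i j hij hj => ?_, fun i hi j hj hj' => ?_⟩
  · rcases Nat.lt_succ_iff_lt_or_eq.1 hi with hi | rfl
    · have := h.spec i hi
      rw [hne i hi.ne, hf i hi]
      exact ⟨by omega, this.2⟩
    · rw [heq]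
      exact ⟨by omega, hf'⟩
  · rcases Nat.lt_succ_iff_lt_or_eq.1 hi with hi | rfl <;>
    rcases Nat.lt_succ_iff_lt_or_eq.1 hj with hj | rfl
    · rw [hne i hi.ne, hne j hj.ne] at hij
      exact h.inj i hi j hj hij
    · have := h.spec i hi
      rw [hne i hi.ne, heq] at hij
      omega
    · have := h.spec j hj
      rw [hne j hj.ne, heq] at hij
      omega
    · rfl
  · rcases Nat.lt_succ_iff_lt_or_eq.1 hj with hj | rfl
    · rw [hf i (by omega), hf j hj]
      exact h.mono i j hij hj
    · rcases hij.lt_or_eq with hi | rfl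
      · rw [hf i hi, hf']
        exact h.bound i hi x (by omega) (by omega)
      · exact le_rfl
  · rcases Nat.lt_succ_iff_lt_or_eq.1 hi with hi | rfl
    · rw [hf i hi]
      exact h.bound i hi j (by omega) (by omega)
    · rw [hf']
      exact hmin j (by omega) (by omega)

theorem isSorting (h : Merging V f m a b c σ) (hc : c = m) : IsSorting V f m := by
  have := h.le
  have := h.le'
  have := h.count
  subst hc
  refine ⟨σ, fun i hi => ?_, h.inj, h.mono⟩
  have := h.spec i hi
  exact ⟨by omega, this.2⟩

end Merging

/-- Sort the lengths of the chords of the new path from the real array `3` into the array `4`, and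
compare them in the variable `20` with those of the best path so far, in array `5`. -/
def mergeProgram : Program :=
  .seq (.seq (setVar 13 (.const 0)) (.seq (setVar 14 (.pred (.pred (.pred (natVar 0)))))
    (.seq (setVar 10 (.const 0)) (setVar 20 (.const 0)))))
  (.while (.lt (natVar 13) (natVar 14))
    (.seq (.ite (.realLE (.get 3 (natVar 13)) (.get 3 (.pred (natVar 14))))
        (.seq (setRealVar 15 (.get 3 (natVar 13))) (setVar 13 (.succ (natVar 13))))
        (.seq (setRealVar 15 (.get 3 (.pred (natVar 14)))) (setVar 14 (.pred (natVar 14)))))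
    (.seq (.seq (.setReal 4 (natVar 10) (realVar 15))
      (.ite (.natLE (natVar 20) (.const 0))
        (.ite (.realLE (realVar 15) (.get 5 (natVar 10)))
          (.ite (.realLE (.get 5 (natVar 10)) (realVar 15)) .skip (setVar 20 (.const 2)))
          (setVar 20 (.const 1))) .skip))
      (setVar 10 (.succ (natVar 10))))))

variable {n : ℕ} [NeZero n] {p : Fin n → Plane} {s : State} {θ : ℤ → ℝ} {r₀ : ℝ}

/-- The values, which form a unimodal sequence, are sorted, and compared with the sequence `g`. -/
theorem runs_mergeProgram {V g : ℕ → ℝ} (h0 : s.nat 0 0 = n) (hV : ∀ c < n - 3, s.real 3 c = V c)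
    (hg : ∀ c < n - 3, s.real 5 c = g c)
    (huni : ∀ i j k, i ≤ j → j ≤ k → k < n - 3 → V i ≤ V j ∨ V k ≤ V j) :
    Runs n mergeProgram s fun s' => IsSorting V (s'.real 4) (n - 3) ∧
      IsComparison (s'.real 4) g (n - 3) (s'.nat 20 0) := by
  have hn : 1 ≤ n := NeZero.one_le
  set I : ℕ → State → Prop := fun k s => (s.nat 0 0 = n ∧ (∀ c < n - 3, s.real 3 c = V c) ∧
    ∀ c < n - 3, s.real 5 c = g c) ∧ s.nat 13 0 + k = s.nat 14 0 ∧
    (∃ σ, Merging V (s.real 4) (n - 3) (s.nat 13 0) (s.nat 14 0) (s.nat 10 0) σ) ∧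
    IsComparison (s.real 4) g (s.nat 10 0) (s.nat 20 0) with hI
  refine Runs.seq (Q := I (n - 3)) (.of_wp hn ?_) fun s₁ hs₁ =>
    (Runs.while (k := n - 3) (I := I) (by omega) hn hs₁ ?_ ?_).mono ?_
  · refine ⟨by simpa using ⟨h0, hV, hg⟩, by simp [h0]; omega, ⟨id, ?_⟩, ?_⟩
    · have e : n - 1 - 1 - 1 = n - 3 := by omega
      simp only [NExpr.eval, natVar_eval, State.setNat_nat, State.setNat_real]
      simp only [h0, e, Nat.reduceEqDiff, OfNat.zero_ne_ofNat, false_and, if_false, and_self,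
        if_true]
      constructor <;> intros <;> omega
    · exact Or.inl ⟨by simp, by simp⟩
  · rintro s ⟨-, h1, -⟩
    simp only [Test.holds_lt, natVar_eval]
    omega
  · rintro k s ⟨⟨h1, h2, h3⟩, h4, ⟨σ, h5⟩, h6⟩
    refine ⟨by simp only [Test.holds_lt, natVar_eval]; omega, ?_⟩
    have hlt : s.nat 13 0 < s.nat 14 0 := by omega
    have hm := h5.le'
    have hcnt := h5.count
    set a := s.nat 13 0 with ha
    set b := s.nat 14 0 with hb
    set c := s.nat 10 0 with hc
    -- the smaller one of the two end terms
    refine Runs.seq (Q := fun s' => (s'.nat 0 0 = n ∧ s'.nat 10 0 = c ∧ s'.nat 20 0 = s.nat 20 0 ∧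
      s'.real 3 = s.real 3 ∧ s'.real 4 = s.real 4 ∧ s'.real 5 = s.real 5) ∧
      s'.nat 13 0 + k = s'.nat 14 0 ∧ ∃ x, s'.real 15 0 = V x ∧
        (x = a ∧ s'.nat 13 0 = a + 1 ∧ s'.nat 14 0 = b ∨
          x + 1 = b ∧ s'.nat 13 0 = a ∧ s'.nat 14 0 + 1 = b) ∧
        ∀ j, a ≤ j → j < b → V x ≤ V j) (.of_wp le_rfl ⟨fun hle => ?_, fun hle => ?_⟩)
        fun s₁ hs₁ => ?_
    · simp only [Test.Holds, RExpr.eval, NExpr.eval, natVar_eval, ← ha, ← hb, h2 a (by omega),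
        h2 (b - 1) (by omega)] at hle
      refine ⟨by simp [h1, ← hc], by simp [← ha, ← hb]; omega, a, by simp [← ha, h2 a (by omega)],
        Or.inl ⟨rfl, by simp [← ha], by simp [← hb]⟩, fun j hj hj' => ?_⟩
      rcases huni a j (b - 1) hj (by omega) (by omega) with hu | hu
      · exact hu
      · exact hle.trans hu
    · simp only [Test.Holds, RExpr.eval, NExpr.eval, natVar_eval, ← ha, ← hb, h2 a (by omega),
        h2 (b - 1) (by omega), not_le] at hle
      refine ⟨by simp [h1, ← hc], by simp [← ha, ← hb]; omega, b - 1,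
        by simp [← hb, h2 (b - 1) (by omega)],
        Or.inr ⟨by omega, by simp [← ha], by simp [← hb]; omega⟩, fun j hj hj' => ?_⟩
      rcases huni a j (b - 1) hj (by omega) (by omega) with hu | hu
      · exact hle.le.trans hu
      · exact hu
    obtain ⟨⟨f0, f10, f20, f3, f4, f5⟩, hk, x, hx, hxab, hmin⟩ := hs₁
    refine Runs.seq (Q := fun s' => s'.nat 0 = s₁.nat 0 ∧ s'.nat 10 = s₁.nat 10 ∧
      s'.nat 13 = s₁.nat 13 ∧ s'.nat 14 = s₁.nat 14 ∧ s'.real 3 = s₁.real 3 ∧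
      s'.real 5 = s₁.real 5 ∧ (∀ i < c, s'.real 4 i = s₁.real 4 i) ∧ s'.real 4 c = V x ∧
      IsComparison (s'.real 4) g (c + 1) (s'.nat 20 0)) (.of_wp le_rfl ?_) fun s₂ hs₂ => ?_
    · rw [← f4, ← f20] at h6
      have hgc : s₁.real 5 c = g c := by rw [f5, h3 c (by omega)]
      set s₂ := s₁.setReal 4 c (V x) with hs₂
      have e4 : ∀ i < c, s₂.real 4 i = s₁.real 4 i := fun i hi => by simp [hs₂, hi.ne]
      have e4' : s₂.real 4 c = V x := by simp [hs₂]
      have e20 : s₂.nat = s₁.nat := rfl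
      have e5 : s₂.real 5 c = g c := by simp [hs₂, hgc]
      have e15 : s₂.real 15 0 = V x := by simp [hs₂, hx]
      have e10 : s₂.nat 10 0 = c := f10
      simp only [Program.wp, natVar_eval, realVar_eval, f10, hx]
      rw [← hs₂]
      refine ⟨fun t1 => ⟨fun t2 => ⟨fun t3 => ?_, fun t3 => ?_⟩, fun t2 => ?_⟩, fun t1 => ?_⟩
      · simp only [Test.Holds, RExpr.eval, natVar_eval, realVar_eval, e10, e5, e15] at t2 t3
        exact ⟨rfl, rfl, rfl, rfl, rfl, rfl, e4, e4',
          h6.succ e4 (Or.inr (by rw [e4']; exact le_antisymm t2 t3))⟩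
      · simp only [Test.Holds, RExpr.eval, natVar_eval, realVar_eval, e10, e5, e15, not_le] at t2 t3
        simp only [Test.Holds, NExpr.eval, natVar_eval, e20] at t1
        refine ⟨by simp [e20], by simp [e20], by simp [e20], by simp [e20], rfl, rfl, e4, e4',
          Or.inr (Or.inr ⟨by simp, c, by omega, by rw [State.setNat_real, e4']; exact t3,
            fun i hi => ?_⟩)⟩
        rw [State.setNat_real, e4 i hi]
        rcases h6 with h | ⟨h, -⟩ | ⟨h, -⟩
        · exact h.2 i hi
        · omega
        · omega
      · simp only [Test.Holds, RExpr.eval, natVar_eval, realVar_eval, e10, e5, e15, not_le] at t2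
        simp only [Test.Holds, NExpr.eval, natVar_eval, e20] at t1
        refine ⟨by simp [e20], by simp [e20], by simp [e20], by simp [e20], rfl, rfl, e4, e4',
          Or.inr (Or.inl ⟨by simp, c, by omega, by rw [State.setNat_real, e4']; exact t2,
            fun i hi => ?_⟩)⟩
        rw [State.setNat_real, e4 i hi]
        rcases h6 with h | ⟨h, -⟩ | ⟨h, -⟩
        · exact h.2 i hi
        · omega
        · omega
      · simp only [Test.Holds, NExpr.eval, natVar_eval, e20] at t1
        exact ⟨rfl, rfl, rfl, rfl, rfl, rfl, e4, e4', h6.succ e4 (Or.inl (by omega))⟩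
    · obtain ⟨k0, k10, k13, k14, k3, k5, k4, k4', kcmp⟩ := hs₂
      refine .of_wp le_rfl ?_
      simp only [hI, setVar_wp, NExpr.eval, natVar_eval, State.setNat_real, State.setNat_nat,
        Nat.reduceEqDiff, OfNat.zero_ne_ofNat, false_and, if_false, and_self, if_true]
      rw [k0, k3, k5, k13, k14, k10, f10, f0, f3, f5]
      exact ⟨⟨rfl, h2, h3⟩, hk, ⟨_, h5.next hlt hxab hmin (fun i hi => by rw [k4 i hi, f4]) k4'⟩,
        kcmp⟩
  · rintro s' ⟨-, h1, ⟨σ, h2⟩, h3⟩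
    have e1 := h2.count
    have e2 := h2.le'
    have e3 : s'.nat 10 0 = n - 3 := by omega
    rw [e3] at h3
    exact ⟨h2.isSorting e3, h3⟩

end

section

variable {n : ℕ} [NeZero n] {p : Fin n → Plane} {s : State} {θ : ℤ → ℝ} {r₀ : ℝ}

/-- If the new path is better, then copy its sorted lengths to the real array `5` and its diagonals
to the output arrays `1` and `2`. -/
def copyProgram : Program :=
  .ite (.eq (natVar 20) (.const 1))
    (.seq (setVar 10 (.const 0)) (.while (.lt (natVar 10) (.pred (.pred (.pred (natVar 0)))))
      (.seq (.setReal 5 (natVar 10) (.get 4 (natVar 10)))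
        (.seq (.ite (.natLE (.get 5 (natVar 10)) (.get 6 (natVar 10)))
          (.seq (.setNat 1 (natVar 10) (.get 5 (natVar 10)))
            (.setNat 2 (natVar 10) (.get 6 (natVar 10))))
          (.seq (.setNat 1 (natVar 10) (.get 6 (natVar 10)))
            (.setNat 2 (natVar 10) (.get 5 (natVar 10)))))
          (setVar 10 (.succ (natVar 10)))))))
    .skip

omit [NeZero n] in
theorem runs_copyProgram (hn : 1 ≤ n) (h0 : s.nat 0 0 = n) : Runs n copyProgram s fun s' =>
    (s.nat 20 0 = 1 → ∀ c < n - 3, s'.real 5 c = s.real 4 c ∧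
      s'.nat 1 c = min (s.nat 5 c) (s.nat 6 c) ∧ s'.nat 2 c = max (s.nat 5 c) (s.nat 6 c)) ∧
    (s.nat 20 0 ≠ 1 → s' = s) := by
  refine Runs.ite hn (fun hf => ?_) fun hf => .of_wp hn ⟨fun h => absurd h ?_, fun _ => rfl⟩
  · have hf' : s.nat 20 0 = 1 := by simpa using hf
    set I : ℕ → State → Prop := fun k s' => s'.nat 0 0 = n ∧ s'.nat 10 0 + k = n - 3 ∧
      s'.real 4 = s.real 4 ∧ s'.nat 5 = s.nat 5 ∧ s'.nat 6 = s.nat 6 ∧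
      ∀ c < s'.nat 10 0, s'.real 5 c = s.real 4 c ∧ s'.nat 1 c = min (s.nat 5 c) (s.nat 6 c) ∧
        s'.nat 2 c = max (s.nat 5 c) (s.nat 6 c) with hI
    refine Runs.seq (Q := I (n - 3)) (.of_wp hn (by simp [hI, h0])) fun s₁ hs₁ =>
      (Runs.while (k := n - 3) (I := I) (by omega) hn hs₁ ?_ ?_).mono ?_
    · rintro s' ⟨h1, h2, -⟩
      simp only [Test.holds_lt, natVar_eval, NExpr.eval]
      omega
    · rintro k s' ⟨h1, h2, h4, h5, h6, h7⟩
      refine ⟨by simp only [Test.holds_lt, natVar_eval, NExpr.eval]; omega, .of_wp le_rfl ?_⟩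
      set c := s'.nat 10 0 with hc
      have hcopy : ∀ u v, u = min (s.nat 5 c) (s.nat 6 c) → v = max (s.nat 5 c) (s.nat 6 c) →
          I k ((((s'.setReal 5 c (s'.real 4 c)).setNat 1 c u).setNat 2 c v).setNat 10 0 (c + 1)) := by
        intro u v hu hv
        refine ⟨by simpa using h1, by simp; omega, by simpa using h4, by simpa using h5,
          by simpa using h6, fun i hi => ?_⟩
        simp only [State.setNat_nat, and_self, if_true] at hi
        rcases Nat.lt_succ_iff_lt_or_eq.1 hi with hi | rfl
        · simpa [hi.ne] using h7 i hi
        · simp [hu, hv, h4]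
      refine ⟨fun hle => ?_, fun hle => ?_⟩
      · have hle' : s.nat 5 c ≤ s.nat 6 c := by
          simpa [← hc, h5, h6] using hle
        have := hcopy (s'.nat 5 c) (s'.nat 6 c) (by rw [h5, min_eq_left hle'])
          (by rw [h6, max_eq_right hle'])
        simpa [← hc] using this
      · have hle' : s.nat 6 c ≤ s.nat 5 c := by
          have : s.nat 6 c < s.nat 5 c := by simpa [← hc, h5, h6] using hle
          exact this.le
        have := hcopy (s'.nat 6 c) (s'.nat 5 c) (by rw [h6, min_eq_right hle'])
          (by rw [h5, max_eq_left hle'])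
        simpa [← hc] using this
    · rintro s' ⟨-, h2, -, -, -, h7⟩
      rw [show s'.nat 10 0 = n - 3 by omega] at h7
      exact ⟨fun _ => h7, fun h => absurd hf' h⟩
  · simpa using hf

/-! ### The best path -/

/-- The squared lengths of the chords of a path, starting with its first ear. -/
def pathSq (p : Fin n → Plane) (w : ℕ → ℤ) (c : ℕ) : ℝ :=
  sqDist (p (vtx n (w (c + 2)))) (p (vtx n (w (c + 2) + (c + 2 : ℕ))))

/-- The output arrays hold the diagonals of the path `w`, and the real array `5` their squared
lengths in increasing order. -/
def IsBest (p : Fin n → Plane) (w : ℕ → ℤ) (s : State) : Prop :=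
  IsPath n w ∧ (∀ c < n - 3, s.nat 1 c = (chord n (w (c + 2)) (w (c + 2) + (c + 2 : ℕ))).1 ∧
    s.nat 2 c = (chord n (w (c + 2)) (w (c + 2) + (c + 2 : ℕ))).2) ∧
  IsSorting (pathSq p w) (s.real 5) (n - 3)

theorem pathSq_le_iff (hp : Inscribed p r₀ θ) (h : CircSeq n θ) {w w' : ℕ → ℤ} {c c' : ℕ}
    (hc : c < n - 3) (hc' : c' < n - 3) :
    pathSq p w c ≤ pathSq p w' c' ↔ pathVal θ w (c + 2) ≤ pathVal θ w' (c' + 2) :=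
  hp.sqDist_le_iff (h.val_pos (by omega) (by omega)) (h.val_pos (by omega) (by omega))

theorem pathSq_pos (hp : Inscribed p r₀ θ) (h : CircSeq n θ) (w : ℕ → ℤ) {c : ℕ}
    (hc : c < n - 3) : 0 < pathSq p w c :=
  hp.sqDist_pos (h.val_pos (by omega) (by omega))

omit [NeZero n] in
theorem pathCount_eq_of_sorting {w : ℕ → ℤ} {σ : ℕ → ℕ} (h1 : ∀ c < n - 3, σ c < n - 3)
    (h2 : ∀ c < n - 3, ∀ c' < n - 3, σ c = σ c' → c = c') (t : ℝ) :
    pathCount n θ w t = ((Finset.range (n - 3)).filter fun c => pathVal θ w (σ c + 2) ≤ t).card := by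
  have hinj : Set.InjOn (fun c => σ c + 2) (Finset.range (n - 3)) := by
    intro c hc c' hc' e
    simp only [Finset.coe_range, Set.mem_Iio] at hc hc'
    exact h2 c hc c' hc' (Nat.add_right_cancel e)
  have himg : (Finset.range (n - 3)).image (fun c => σ c + 2) = Finset.Icc 2 (n - 2) := by
    apply Finset.eq_of_subset_of_card_le
    · intro k hk
      simp only [Finset.mem_image, Finset.mem_range] at hk
      obtain ⟨c, hc, rfl⟩ := hk
      have := h1 c hc
      rw [Finset.mem_Icc]
      omega
    · rw [Finset.card_image_of_injOn hinj, Finset.card_range, Nat.card_Icc]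
      omega
  unfold pathCount
  rw [← himg, Finset.filter_image, Finset.card_image_of_injOn]
  exact hinj.mono fun c hc => (Finset.mem_filter.1 hc).1

/-- The path whose sorted lengths are larger at the first difference is better. -/
theorem better_of_sorting (hp : Inscribed p r₀ θ) (h : CircSeq n θ) {w w' : ℕ → ℤ} {f f' : ℕ → ℝ}
    (hf : IsSorting (pathSq p w) f (n - 3)) (hf' : IsSorting (pathSq p w') f' (n - 3)) {j : ℕ}
    (hj : j < n - 3) (hlt : f' j < f j) (heq : ∀ i < j, f i = f' i) :
    Better (pathCount n θ w) (pathCount n θ w') := by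
  obtain ⟨σ, h1, h2, h3⟩ := hf
  obtain ⟨σ', h1', h2', h3'⟩ := hf'
  have hm : ∀ c c', c ≤ c' → c' < n - 3 → pathVal θ w (σ c + 2) ≤ pathVal θ w (σ c' + 2) := by
    intro c c' hc hc'
    rw [← pathSq_le_iff hp h (h1 c (by omega)).1 (h1 c' hc').1, ← (h1 c (by omega)).2,
      ← (h1 c' hc').2]
    exact h3 c c' hc hc'
  have hm' : ∀ c c', c ≤ c' → c' < n - 3 → pathVal θ w' (σ' c + 2) ≤ pathVal θ w' (σ' c' + 2) := by
    intro c c' hc hc'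
    rw [← pathSq_le_iff hp h (h1' c (by omega)).1 (h1' c' hc').1, ← (h1' c (by omega)).2,
      ← (h1' c' hc').2]
    exact h3' c c' hc hc'
  have hltj : pathVal θ w' (σ' j + 2) < pathVal θ w (σ j + 2) := by
    rw [← not_le, ← pathSq_le_iff hp h (h1 j hj).1 (h1' j hj).1, ← (h1 j hj).2, ← (h1' j hj).2,
      not_le]
    exact hlt
  have heqj : ∀ i < j, pathVal θ w (σ i + 2) = pathVal θ w' (σ' i + 2) := by
    intro i hi
    have e := heq i hi
    rw [(h1 i (by omega)).2, (h1' i (by omega)).2] at e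
    exact le_antisymm ((pathSq_le_iff hp h (h1 i (by omega)).1 (h1' i (by omega)).1).1 e.le)
      ((pathSq_le_iff hp h (h1' i (by omega)).1 (h1 i (by omega)).1).1 e.ge)
  refine ⟨pathVal θ w' (σ' j + 2), ?_, fun t ht => ?_⟩
  · rw [pathCount_eq_of_sorting (fun c hc => (h1 c hc).1) h2,
      pathCount_eq_of_sorting (fun c hc => (h1' c hc).1) h2']
    calc _ ≤ (Finset.range j).card := by
          apply Finset.card_le_card
          intro c hc
          rw [Finset.mem_filter, Finset.mem_range] at hc
          rw [Finset.mem_range]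
          by_contra hcj
          have := hm j c (by omega) hc.1
          linarith [hc.2]
      _ < (Finset.range (j + 1)).card := by simp
      _ ≤ _ := by
          apply Finset.card_le_card
          intro c hc
          rw [Finset.mem_range] at hc
          rw [Finset.mem_filter, Finset.mem_range]
          exact ⟨by omega, hm' c j (by omega) hj⟩
  · rw [pathCount_eq_of_sorting (fun c hc => (h1 c hc).1) h2,
      pathCount_eq_of_sorting (fun c hc => (h1' c hc).1) h2']
    apply Finset.card_le_card
    intro c hc
    rw [Finset.mem_filter, Finset.mem_range] at hc ⊢
    refine ⟨hc.1, ?_⟩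
    have hcj : c < j := by
      by_contra hcj
      have := hm j c (by omega) hc.1
      linarith [hc.2]
    rw [← heqj c hcj]
    exact hc.2

theorem pathCount_eq_of_sorting_eq (hp : Inscribed p r₀ θ) (h : CircSeq n θ) {w w' : ℕ → ℤ}
    {f f' : ℕ → ℝ} (hf : IsSorting (pathSq p w) f (n - 3))
    (hf' : IsSorting (pathSq p w') f' (n - 3)) (heq : ∀ i < n - 3, f i = f' i) :
    pathCount n θ w = pathCount n θ w' := by
  obtain ⟨σ, h1, h2, h3⟩ := hf
  obtain ⟨σ', h1', h2', h3'⟩ := hf'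
  funext t
  rw [pathCount_eq_of_sorting (fun c hc => (h1 c hc).1) h2,
    pathCount_eq_of_sorting (fun c hc => (h1' c hc).1) h2']
  congr 1
  apply Finset.filter_congr
  intro i hi
  rw [Finset.mem_range] at hi
  have e := heq i hi
  rw [(h1 i hi).2, (h1' i hi).2] at e
  have : pathVal θ w (σ i + 2) = pathVal θ w' (σ' i + 2) :=
    le_antisymm ((pathSq_le_iff hp h (h1 i hi).1 (h1' i hi).1).1 e.le)
      ((pathSq_le_iff hp h (h1' i hi).1 (h1 i hi).1).1 e.ge)
  rw [this]

/-- The lengths of the chords of a path increase up to some index and decrease from there on. -/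
theorem IsPath.pathSq_unimodal (hp : Inscribed p r₀ θ) (h : CircSeq n θ) {w : ℕ → ℤ}
    (hw : IsPath n w) {i j k : ℕ} (hij : i ≤ j) (hjk : j ≤ k) (hk : k < n - 3) :
    pathSq p w i ≤ pathSq p w j ∨ pathSq p w k ≤ pathSq p w j := by
  rw [pathSq_le_iff hp h (by omega) (by omega), pathSq_le_iff hp h (by omega) (by omega),
    ← min_le_iff]
  have e1 := hw.nested (j := i + 2) (k := j + 2) (by omega) (by omega) (by omega)
  have e2 := hw.nested (j := j + 2) (k := k + 2) (by omega) (by omega) (by omega)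
  exact h.min_le_val e1.1 e2.1 e1.2 e2.2

end

section

variable {n : ℕ} [NeZero n] {p : Fin n → Plane} {s : State} {θ : ℤ → ℝ} {r₀ : ℝ}

/-- Construct the path between the ears in the cells `c` and `c'` of array `3`, and keep it if it
is better than the best path so far. -/
def pairProgram (c c' : ℕ) : Program :=
  .ite (.eq (.get 3 (.const c)) (.get 3 (.const c'))) .skip
    (.seq (greedyProgram c c') (.seq mergeProgram copyProgram))

/-- The state holds the input, the indices `S c` of seven ears, and the best path so far, if there
is one. -/
def Ready (p : Fin n → Plane) (S : ℕ → ℕ) (s : State) : Prop :=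
  HasInput p s ∧ (∀ c < 7, s.nat 3 c = S c) ∧
    ((∀ c < n - 3, s.real 5 c = 0) ∨ ∃ w, IsBest p w s)

/-- The best path so far is optimal. -/
def HasOptimum (p : Fin n → Plane) (θ : ℤ → ℝ) (s : State) : Prop :=
  ∃ w, IsBest p w s ∧ POpt n θ w

/-- Some optimal path starts at the side after `u` and ends at the complement of the side
after `v`. -/
def JoinedByOptimum (n : ℕ) (θ : ℤ → ℝ) (u v : ℕ) : Prop :=
  u ≠ v ∧ ∃ w, POpt n θ w ∧ w 1 = u ∧ w (n - 1) = complStart n u v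

theorem IsBest.congr {w : ℕ → ℤ} {s' : State} (h : IsBest p w s) (h1 : s'.nat 1 = s.nat 1)
    (h2 : s'.nat 2 = s.nat 2) (h5 : s'.real 5 = s.real 5) : IsBest p w s' := by
  unfold IsBest
  rw [h1, h2, h5]
  exact h

theorem greedyProgram_keeps (c c' : ℕ) :
    (∀ a ∈ [0, 1, 2, 3], (greedyProgram c c').KeepsNat a) ∧
      ∀ a ∈ [0, 1, 5], (greedyProgram c c').KeepsReal a := by
  constructor <;>
  simp [Program.KeepsNat, Program.KeepsReal, greedyProgram, chooseProgram, stepProgram, storeLow,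
    storeHigh, prevVertex, nextVertex, sortTwo, setVar, setRealVar]

theorem mergeProgram_keeps :
    (∀ a ∈ [0, 1, 2, 3, 5, 6], mergeProgram.KeepsNat a) ∧
      ∀ a ∈ [0, 1, 3, 5], mergeProgram.KeepsReal a := by
  constructor <;>
  simp [Program.KeepsNat, Program.KeepsReal, mergeProgram, setVar, setRealVar]

theorem copyProgram_keeps :
    (∀ a ∈ [0, 3], copyProgram.KeepsNat a) ∧ ∀ a ∈ [0, 1], copyProgram.KeepsReal a := by
  constructor <;>
  simp [Program.KeepsNat, Program.KeepsReal, copyProgram, setVar]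

omit [NeZero n] in
theorem POpt.congr {w w' : ℕ → ℤ} (hw : POpt n θ w) (hw' : IsPath n w')
    (he : pathCount n θ w' = pathCount n θ w) : POpt n θ w' :=
  ⟨hw', fun v hv => by rw [he]; exact hw.2 v hv⟩

/-- A path that is followed by the greedy construction is kept unless the best path so far is as
good, and an optimal path is never replaced. -/
theorem runs_pairProgram (hp : Inscribed p r₀ θ) (h : CircSeq n θ) (hn : 3 ≤ n) {S : ℕ → ℕ}
    (hS : ∀ c < 7, S c < n) {c c' : ℕ} (hc : c < 7) (hc' : c' < 7) (hs : Ready p S s) :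
    Runs n (pairProgram c c') s fun s' => Ready p S s' ∧
      (4 ≤ n → JoinedByOptimum n θ (S c) (S c') → HasOptimum p θ s') ∧
      (HasOptimum p θ s → HasOptimum p θ s') := by
  obtain ⟨hi, hS3, hbest⟩ := id hs
  refine Runs.ite (by omega) (fun heq => .of_wp (by omega) ⟨hs, fun _ hj => ?_, id⟩) fun hne => ?_
  · have : S c = S c' := by simpa [hS3 c hc, hS3 c' hc'] using heq
    exact absurd this hj.1
  have hne' : S c ≠ S c' := by simpa [hS3 c hc, hS3 c' hc'] using hne
  refine Runs.seq (runs_greedyProgram hp h hn hi (hS3 c hc) (hS3 c' hc') (hS c hc) (hS c' hc')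
    hne').frame fun s₁ hs₁ => ?_
  obtain ⟨⟨w, hw, hch, hforced⟩, fn, fr⟩ := hs₁
  replace fn := fun a ha => fn a ((greedyProgram_keeps c c').1 a ha)
  replace fr := fun a ha => fr a ((greedyProgram_keeps c c').2 a ha)
  simp only [List.mem_cons, List.not_mem_nil, or_false, forall_eq_or_imp, forall_eq] at fn fr
  refine Runs.seq (runs_mergeProgram (V := pathSq p w) (g := s.real 5) (by rw [fn.1, hi.1])
    (fun c hc => (hch c hc).2.2) (fun c _ => by rw [fr.2.2])
    fun i j k hij hjk hk => hw.pathSq_unimodal hp h hij hjk hk).frame fun s₂ hs₂ => ?_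
  obtain ⟨⟨hsort, hcmp⟩, gn, gr⟩ := hs₂
  replace gn := fun a ha => gn a (mergeProgram_keeps.1 a ha)
  replace gr := fun a ha => gr a (mergeProgram_keeps.2 a ha)
  simp only [List.mem_cons, List.not_mem_nil, or_false, forall_eq_or_imp, forall_eq] at gn gr
  refine (runs_copyProgram (by omega) (by rw [gn.1, fn.1, hi.1])).frame.mono fun s₃ hs₃ => ?_
  obtain ⟨⟨hcopy, hkeep⟩, kn, kr⟩ := hs₃
  replace kn := fun a ha => kn a (copyProgram_keeps.1 a ha)
  replace kr := fun a ha => kr a (copyProgram_keeps.2 a ha)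
  simp only [List.mem_cons, List.not_mem_nil, or_false, forall_eq_or_imp, forall_eq] at kn kr
  have hi₃ : HasInput p s₃ := hi.congr (by rw [kn.1, gn.1, fn.1]) (by rw [kr.1, gr.1, fr.1])
    (by rw [kr.2, gr.2.1, fr.2.1])
  have hS₃ : ∀ c < 7, s₃.nat 3 c = S c := fun c hc => by
    rw [kn.2, gn.2.2.2.1, fn.2.2.2, hS3 c hc]
  have hnew : s₂.nat 20 0 = 1 → IsBest p w s₃ := by
    intro hf
    refine ⟨hw, fun c hc => ?_, ?_⟩
    · obtain ⟨-, e1, e2⟩ := hcopy hf c hc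
      rw [e1, e2, gn.2.2.2.2.1, gn.2.2.2.2.2, (hch c hc).1, (hch c hc).2.1]
      simp only [chord]
      constructor
      · exact (Fin.val_strictMono.monotone.map_min).symm
      · exact (Fin.val_strictMono.monotone.map_max).symm
    · obtain ⟨σ, h1, h2, h3⟩ := hsort
      refine ⟨σ, fun c hc => ⟨(h1 c hc).1, by rw [(hcopy hf c hc).1, (h1 c hc).2]⟩, h2,
        fun c c' hcc hc' => ?_⟩
      rw [(hcopy hf c (by omega)).1, (hcopy hf c' hc').1]
      exact h3 c c' hcc hc'
  have hold : s₂.nat 20 0 ≠ 1 → s₃.nat 1 = s.nat 1 ∧ s₃.nat 2 = s.nat 2 ∧ s₃.real 5 = s.real 5 := by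
    intro hf
    rw [hkeep hf]
    exact ⟨by rw [gn.2.1, fn.2.1], by rw [gn.2.2.1, fn.2.2.1], by rw [gr.2.2.2, fr.2.2]⟩
  refine ⟨⟨hi₃, hS₃, ?_⟩, fun hn4 hj => ?_, fun ⟨w₀, hw₀, hopt⟩ => ?_⟩
  · by_cases hf : s₂.nat 20 0 = 1
    · exact Or.inr ⟨w, hnew hf⟩
    · obtain ⟨e1, e2, e5⟩ := hold hf
      rcases hbest with hb | ⟨w₀, hw₀⟩
      · exact Or.inl (by rw [e5]; exact hb)
      · exact Or.inr ⟨w₀, hw₀.congr e1 e2 e5⟩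
  · -- the new path is optimal
    obtain ⟨-, w', hw', e1, e2⟩ := hj
    have hcount : pathCount n θ w = pathCount n θ w' := by
      funext t
      unfold pathCount pathVal
      congr 1
      apply Finset.filter_congr
      intro k hk
      rw [Finset.mem_Icc] at hk
      rw [hforced w' hw' e1 e2 k (by omega) (by omega)]
    have hwopt : POpt n θ w := hw'.congr hw hcount
    by_cases hf : s₂.nat 20 0 = 1
    · exact ⟨w, hnew hf, hwopt⟩
    obtain ⟨e1, e2, e5⟩ := hold hf
    rcases hbest with hb | ⟨w₀, hw₀⟩
    · -- all terms are larger than the initial ones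
      have hpos : ∀ j < n - 3, s.real 5 j < s₂.real 4 j := by
        intro j hj
        obtain ⟨σ, h1, -⟩ := hsort
        rw [hb j hj, (h1 j hj).2]
        exact pathSq_pos hp h w (h1 j hj).1
      rcases hcmp with ⟨-, hc⟩ | ⟨hc, -⟩ | ⟨-, j, hj, hc, -⟩
      · have := hc 0 (by omega)
        have := hpos 0 (by omega)
        linarith
      · exact absurd hc hf
      · have := hpos j hj
        linarith
    · refine ⟨w₀, hw₀.congr e1 e2 e5, ?_⟩
      rcases hcmp with ⟨-, hc⟩ | ⟨hc, -⟩ | ⟨-, j, hj, hc, heq⟩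
      · exact hwopt.congr hw₀.1 (pathCount_eq_of_sorting_eq hp h hw₀.2.2 hsort
          fun i hi => (hc i hi).symm)
      · exact absurd hc hf
      · exact absurd (better_of_sorting hp h hw₀.2.2 hsort hj hc fun i hi => (heq i hi).symm)
          (hwopt.2 w₀ hw₀.1)
  · have hf : s₂.nat 20 0 ≠ 1 := by
      intro hf
      rcases hcmp with ⟨hc, -⟩ | ⟨-, j, hj, hc, heq⟩ | ⟨hc, -⟩
      · omega
      · exact hopt.2 w hw (better_of_sorting hp h hsort hw₀.2.2 hj hc heq)
      · omega
    obtain ⟨e1, e2, e5⟩ := hold hf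
    exact ⟨w₀, hw₀.congr e1 e2 e5, hopt⟩

/-! ### The whole program -/

/-- Determine the `k` largest ears. -/
def topEarsProgram : ℕ → Program
  | 0 => .skip
  | k + 1 => .seq (topEarsProgram k) (topEarProgram k)

theorem topEarProgram_keeps (q : ℕ) :
    (topEarProgram q).KeepsNat 0 ∧ ∀ a, a ≠ 10 → (topEarProgram q).KeepsReal a := by
  constructor
  · simp [Program.KeepsNat, topEarProgram, setVar, setRealVar]
  · intro a ha
    simp [Program.KeepsReal, topEarProgram, setVar, setRealVar, ha.symm]

theorem runs_topEarsProgram {E : ℕ → ℝ} (hE : ∀ i < n, 0 < E i) (h0 : s.nat 0 0 = n)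
    (h2 : ∀ i < n, s.real 2 i = E i) (hq : HasTopEars n 0 E s) (k : ℕ) :
    Runs n (topEarsProgram k) s fun s' => HasTopEars n k E s' ∧ s'.nat 0 = s.nat 0 ∧
      ∀ a, a ≠ 10 → s'.real a = s.real a := by
  induction k with
  | zero => exact .of_wp NeZero.one_le ⟨hq, rfl, fun _ _ => rfl⟩
  | succ k ih =>
    refine ih.seq fun s₁ hs₁ => ?_
    obtain ⟨t1, t2, t3⟩ := hs₁
    refine (runs_topEarProgram hE (by rw [t2, h0]) (fun i hi => by rw [t3 2 (by omega), h2 i hi])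
      t1).frame.mono fun s₂ hs₂ => ⟨hs₂.1, ?_, fun a ha => ?_⟩
    · rw [hs₂.2.1 0 (topEarProgram_keeps k).1, t2]
    · rw [hs₂.2.2 a ((topEarProgram_keeps k).2 a ha), t3 a ha]

/-- The linear time algorithm: compute the best path between any two of the seven largest ears. -/
def delaunayProgram : Program :=
  .seq earProgram (.seq (topEarsProgram 7)
    (.seqList (((List.finRange 7).product (List.finRange 7)).map fun c => pairProgram c.1 c.2)))

theorem earProgram_keeps : (∀ a ∈ [0, 3, 4], earProgram.KeepsNat a) ∧
    ∀ a ∈ [0, 1, 5], earProgram.KeepsReal a := by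
  constructor <;>
  simp [Program.KeepsNat, Program.KeepsReal, earProgram, nextVertex, setVar]

omit [NeZero n] in
theorem hasInput_inputState (p : Fin n → Plane) : HasInput p (inputState p) := by
  refine ⟨by simp [inputState], fun i => ?_⟩
  simp [inputState]

/-- The program finds an optimal path if there is one that joins two of the seven largest ears. -/
theorem runs_delaunayProgram (hp : Inscribed p r₀ θ) (h : CircSeq n θ) (hn : 3 ≤ n) :
    Runs n delaunayProgram (inputState p) fun s' => ∃ S : ℕ → ℕ,
      (∀ i < n, (∃ c < 7, S c = i) ∨
        ∃ F : Finset ℕ, F.card = 7 ∧ ∀ x ∈ F, x < n ∧ earSq p i ≤ earSq p x) ∧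
      (4 ≤ n → ∀ c < 7, ∀ c' < 7, JoinedByOptimum n θ (S c) (S c') → HasOptimum p θ s') := by
  have hi := hasInput_inputState p
  refine Runs.seq (runs_earProgram hi).frame fun s₁ hs₁ => ?_
  obtain ⟨hear, fn, fr⟩ := hs₁
  replace fn := fun a ha => fn a (earProgram_keeps.1 a ha)
  replace fr := fun a ha => fr a (earProgram_keeps.2 a ha)
  simp only [List.mem_cons, List.not_mem_nil, or_false, forall_eq_or_imp, forall_eq] at fn fr
  have hpos : ∀ i < n, 0 < earSq p i := fun i _ => hp.sqDist_pos (h.val_pos (by omega) (by omega))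
  have htop : HasTopEars n 0 (earSq p) s₁ := by
    refine ⟨by omega, fun i _ hi => absurd ?_ hi, fun i _ _ => ⟨∅, rfl, by simp⟩⟩
    rw [fn.2.2]
    simp [inputState]
  refine Runs.seq (runs_topEarsProgram hpos (by rw [fn.1, hi.1]) hear htop 7) fun s₂ hs₂ => ?_
  obtain ⟨⟨t1, t2, t3⟩, t4, t5⟩ := hs₂
  have hready : Ready p (s₂.nat 3) s₂ := by
    refine ⟨hi.congr (by rw [t4, fn.1]) (by rw [t5 0 (by omega), fr.1])
      (by rw [t5 1 (by omega), fr.2.1]), fun c _ => rfl, Or.inl fun c hc => ?_⟩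
    rw [t5 5 (by omega), fr.2.2]
    simp [inputState]
  refine (Runs.seqList (I := Ready p (s₂.nat 3)) (J := fun (c : Fin 7 × Fin 7) s' => 4 ≤ n →
    JoinedByOptimum n θ (s₂.nat 3 c.1) (s₂.nat 3 c.2) → HasOptimum p θ s') (by omega) _
    (fun c s hs => ?_) s₂ hready).mono fun s₃ hs₃ => ⟨s₂.nat 3, fun i hi => ?_, ?_⟩
  · refine (runs_pairProgram hp h hn t1 c.1.isLt c.2.isLt hs).mono fun s' hs' =>
      ⟨hs'.1, hs'.2.1, fun j hj hn4 hj' => hs'.2.2 (hj hn4 hj')⟩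
  · by_cases hm : s₂.nat 4 i = 0
    · obtain ⟨F, F1, F2⟩ := t3 i hi hm
      exact Or.inr ⟨F, F1, fun x hx => ⟨(F2 x hx).1, (F2 x hx).2.2⟩⟩
    · exact Or.inl (t2 i hi hm)
  · intro hn4 c hc c' hc' hj
    exact hs₃.2.1 (⟨c, hc⟩, ⟨c', hc'⟩)
      (List.mem_product.2 ⟨List.mem_finRange _, List.mem_finRange _⟩) hn4 hj

end

section

variable {n : ℕ} [NeZero n] {p : Fin n → Plane} {s : State} {θ : ℤ → ℝ} {r₀ : ℝ}
  {T : Finset (Fin n × Fin n)}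

/-! ### Correctness -/

/-- The optimal triangulation comes from an optimal path between two ears with the indices `u`
and `v`. -/
theorem TOpt.exists_joined (h : CircSeq n θ) (hT : TOpt θ T) (hn : 4 ≤ n) :
    ∃ w u v, POpt n θ w ∧ T = pathDiags n w ∧ u < n ∧ v < n ∧ u ≠ v ∧ w 1 = (u : ℕ) ∧
      w (n - 1) = complStart n u v ∧ earVal θ (w 2) = earVal θ u ∧
      earVal θ (lastEar n w) = earVal θ (v : ℕ) := by
  obtain ⟨w₀, hw₀, hTw, e1, e2⟩ := hT.exists_eq_pathDiags h hn
  have hpos := coe_pos_of_neZero n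
  have d1 := Int.emod_add_mul_ediv (w₀ 1) n
  have d2 := Int.emod_nonneg (w₀ 1) hpos.ne'
  have d3 := Int.emod_lt_of_pos (w₀ 1) hpos
  set w := pathShift n (-(w₀ 1 / n)) w₀ with hw
  have hwk : ∀ k, w k = w₀ k - n * (w₀ 1 / n) := fun k => by
    rw [hw, pathShift]
    ring
  have hopt : POpt n θ w := hw₀.shift h _
  have f1 : w 1 = w₀ 1 % n := by
    rw [hwk]
    linarith
  have f2 : w 2 = w 1 := by rw [hwk, hwk, e1]
  have f3 : w (n - 1) = w (n - 2) - 1 := by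
    rw [hwk, hwk, e2]
    ring
  have hnest := hopt.1.nested (j := 1) (k := n - 2) (by omega) (by omega) (by omega)
  set q := lastEar n w with hq
  have hq' : q = w (n - 1) + n - 1 := by
    rw [hq, lastEar, f3]
    push_cast [show 2 ≤ n by omega]
    ring
  push_cast [show 2 ≤ n by omega] at hnest
  have g1 := Int.emod_add_mul_ediv q n
  have g2 := Int.emod_nonneg q hpos.ne'
  have g3 := Int.emod_lt_of_pos q hpos
  obtain ⟨u, hu⟩ := Int.eq_ofNat_of_zero_le (f1 ▸ d2)
  obtain ⟨v, hv⟩ := Int.eq_ofNat_of_zero_le g2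
  -- the last ear starts before or after a full turn
  have hqv : q = v ∨ q = v + n := by
    by_cases hlt : q < n
    · exact Or.inl (by rw [← hv, Int.emod_eq_of_lt (by omega) hlt])
    · right
      have g4 := Int.sub_emod_right q n
      rw [Int.emod_eq_of_lt (by omega) (by omega)] at g4
      omega
  refine ⟨w, u, v, hopt, ?_, by omega, by omega, by omega, hu, ?_, by rw [f2, hu], ?_⟩
  · rw [hTw]
    unfold pathDiags
    congr 1
    funext k
    rw [hwk, ← chord_shift (w₀ k) _ (-(w₀ 1 / n))]
    congr 1 <;> ring
  · unfold complStart
    split_ifs <;> omega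
  · rw [← hv, h.earVal_emod]

theorem earSq_le_iff (hp : Inscribed p r₀ θ) (h : CircSeq n θ) (hn : 3 ≤ n) {i j : ℕ} :
    earSq p i ≤ earSq p j ↔ earVal θ i ≤ earVal θ j :=
  hp.sqDist_le_iff (h.val_pos (by omega) (by omega)) (h.val_pos (by omega) (by omega))

/-- The ears of an optimal path are among the seven largest ones. -/
theorem POpt.mem_top_ears (hp : Inscribed p r₀ θ) (h : CircSeq n θ) (hn : 3 ≤ n) {w : ℕ → ℤ}
    (hw : POpt n θ w) {i : ℕ}
    (hi : min (earVal θ (w 2)) (earVal θ (lastEar n w)) ≤ earVal θ i) {F : Finset ℕ}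
    (hF : F.card = 7) (hF' : ∀ x ∈ F, x < n ∧ earSq p i ≤ earSq p x) : False := by
  refine hw.card_large_ears h (F.map Nat.castEmbedding) ?_ (by rw [Finset.card_map, hF]) ?_
  · intro x hx
    obtain ⟨y, hy, rfl⟩ := Finset.mem_map.1 hx
    have := (hF' y hy).1
    simp only [Nat.castEmbedding_apply]
    omega
  · intro x hx
    obtain ⟨y, hy, rfl⟩ := Finset.mem_map.1 hx
    exact hi.trans ((earSq_le_iff hp h hn).1 (hF' y hy).2)

theorem outputs_of_isBest {w : ℕ → ℤ} (hw : IsBest p w s) : Outputs s (pathDiags n w) := by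
  unfold Outputs
  rw [hw.1.card_pathDiags]
  unfold pathDiags
  rw [Finset.image_image]
  ext ⟨x, y⟩
  simp only [Finset.mem_image, Finset.mem_range, Finset.mem_Icc, Function.comp_apply]
  constructor
  · rintro ⟨c, hc, he⟩
    refine ⟨c + 2, by omega, ?_⟩
    rw [← he, (hw.2.1 c hc).1, (hw.2.1 c hc).2]
  · rintro ⟨k, hk, he⟩
    obtain ⟨c, rfl⟩ : ∃ c, k = c + 2 := ⟨k - 2, by omega⟩
    refine ⟨c, by omega, ?_⟩
    rw [← he, (hw.2.1 c (by omega)).1, (hw.2.1 c (by omega)).2]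

theorem TOpt.eq_pathDiags (h : CircSeq n θ) (hn : 4 ≤ n) (hT : TOpt θ T) {w : ℕ → ℤ}
    (hw : POpt n θ w) : T = pathDiags n w := by
  obtain ⟨w', hw', rfl, -⟩ := hT.exists_eq_pathDiags h hn
  have he : triCount θ (pathDiags n w) = triCount θ (pathDiags n w') := by
    rw [hw.1.triCount_pathDiags h, hw'.1.triCount_pathDiags h]
    funext t
    exact pathCount_eq_of_not_better (hw'.2 w hw.1) (hw.2 w' hw'.1) t
  exact hT.eq h hn ⟨hw.1.isTriangulation (by omega), fun T' hT' => by rw [he]; exact hT.2 T' hT'⟩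

/-- The program outputs the optimal triangulation. -/
theorem TOpt.runs_delaunayProgram (hp : Inscribed p r₀ θ) (h : CircSeq n θ) (hn : 3 ≤ n)
    (hT : TOpt θ T) : Runs n delaunayProgram (inputState p) fun s => Outputs s T := by
  refine (ConcyclicDelaunay.runs_delaunayProgram hp h hn).mono fun s ⟨S, hS, hs⟩ => ?_
  rcases hn.eq_or_lt with h3 | hn4
  · have hT0 : T = ∅ := by
      rw [← Finset.card_eq_zero, hT.1.card hn]
      omega
    rw [hT0]
    simp [Outputs]
  obtain ⟨w, u, v, hw, rfl, hu, hv, huv, w1, w2, eu, ev⟩ := hT.exists_joined h hn4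
  have hmem : ∀ i < n, min (earVal θ (w 2)) (earVal θ (lastEar n w)) ≤ earVal θ (i : ℕ) →
      ∃ c < 7, S c = i := by
    intro i hi hle
    rcases hS i hi with hc | ⟨F, F1, F2⟩
    · exact hc
    · exact (hw.mem_top_ears hp h hn hle F1 F2).elim
  obtain ⟨c, hc, rfl⟩ := hmem u hu (eu ▸ min_le_left _ _)
  obtain ⟨c', hc', rfl⟩ := hmem v hv (ev ▸ min_le_right _ _)
  obtain ⟨w₀, hbest, hopt⟩ := hs hn4 c hc c' hc' ⟨huv, w, hw, w1, w2⟩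
  rw [hT.eq_pathDiags h hn4 hopt]
  exact outputs_of_isBest hbest

theorem TOpt.unique (h : CircSeq n θ) (hn : 3 ≤ n) {T' : Finset (Fin n × Fin n)} (hT : TOpt θ T)
    (hT' : TOpt θ T') : T = T' := by
  rcases hn.eq_or_lt with h3 | hn4
  · have e1 := hT.1.card hn
    have e2 := hT'.1.card hn
    rw [show n - 3 = 0 by omega, Finset.card_eq_zero] at e1 e2
    rw [e1, e2]
  · exact hT.eq h hn4 hT'

end

end ConcyclicDelaunay

end

theorem theorem2 :
    ∃ (P : Program) (C : ℕ), ∀ (n : ℕ), 3 ≤ n → ∀ p : Fin n → Plane,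
      OnCircle p → NoSymmetricQuadruple p →
        ∃ T : Finset (Fin n × Fin n),
          IsMaxMinAngleDelaunay p T ∧ (∀ T', IsMaxMinAngleDelaunay p T' → T' = T) ∧
          ∃ (t : ℕ) (s : State), Exec P (inputState p) t s ∧ t ≤ C * n ∧ Outputs s T := by
  refine ⟨delaunayProgram, delaunayProgram.rate, fun n hn p hp hq => ?_⟩
  have : NeZero n := ⟨by omega⟩
  obtain ⟨r, θ, hins, hseq⟩ := exists_circSeq hp hq
  obtain ⟨T, hT⟩ := exists_isMaxMinAngleDelaunay hn p
  have hopt := hT.tOpt hins hseq hn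
  exact ⟨T, hT, fun T' hT' => (hT'.tOpt hins hseq hn).unique hseq hn hopt,
    hopt.runs_delaunayProgram hins hseq hn⟩
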